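/- Let $X$ be a connected $2$-dimensional topological manifold (Hausdorff, second countable), possibly with boundary $\partial X$, and let $\Delta$ be a one-dimensional foliation on $X$ such that * every leaf of $\Delta$ is a closed subset of $X$; * every connected component of $\partial X$ is a leaf of $\Delta$; * for every leaf $\omega$, setting $J=[0,1)$ if $\omega\subset\partial X$ and $J=(-1,1)$ otherwise, there are an open neighborhood $U$ of $\omega$ and a homeomorphism $\psi:\mathbb R\times J\to U$ such that $\psi(\mathbb R\times 0)=\omega$ and $\psi(\mathbb R\times t)$ is a leaf of $\Delta$ for every $t\in J$. Let $Y=X/\Delta$ be the space of leaves with the quotient topology. A leaf is called special if the corresponding point $y\in Y$ satisfies $\bigcap_{V}\overline V\neq\{y\}$, where $V$ runs over all neighborhoods of $y$ in $Y$. Suppose that the family $\Sigma$ of all special leaves is locally finite in $X$, and let $Q$ be a connected component of $X\setminus(\bigcup\Sigma\cup\partial X)$. A homeomorphism is called foliated if it maps leaves onto leaves; subsets of $X$ that are unions of leaves are foliated by the leaves they contain. A model strip is a set $S\subset\mathbb R^2$ such that for some $a<b$ we have $\mathbb R\times(a,b)\subset S\subset\mathbb R\times[a,b]$ and $S\cap(\mathbb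 R\times\{a,b\})$ is a disjoint union of (possibly none, possibly unbounded) open intervals of the lines $\mathbb R\times a$ and $\mathbb R\times b$; its leaves are the lines $\mathbb R\times t$, $a<t<b$, and these boundary intervals. The standard cylinder (resp. the standard Möbius band) is the quotient of $\mathbb R\times[-1,1]$ by the identifications $(t,-1)\sim(t,1)$ (resp. $(t,-1)\sim(-t,1)$), $t\in\mathbb R$, foliated by the images of the lines $\mathbb R\times t$. Then: 1. $Q$ is foliated homeomorphic to the standard cylinder, to the standard Möbius band, or to the open model strip $\mathbb R\times(-1,1)$. In the first two cases $Q=X$. 2. If $\varphi:\mathbb R\times(-1,1)\to Q$ is any foliated homeomorphism, then each of the closures in $X$ of $\varphi(\mathbb R\times(-1,0])$ and of $\varphi(\mathbb R\times[0,1))$ is a union of leaves and is foliated homeomorphic to some model strip. -/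

import Mathlib

open Set Topology
open scoped Manifold

namespace StripFoliation

/-! A partition of a space into leaves is a `Setoid`; its leaves are the classes `Δ.classes`, and
the leaf space is `Quotient Δ` with the quotient topology. -/

section ClassF

variable {X : Type*} [TopologicalSpace X]

/-- `ω` has an open neighbourhood `U` with a homeomorphism `φ : ℝ × J → U` such that
`φ (ℝ × 0) = ω` and every `φ (ℝ × t)` is a leaf. -/
def HasTrivialNhd (Δ : Setoid X) (ω : Set X) (J : Set ℝ) : Prop :=
  ∃ U : Set X, IsOpen U ∧ ω ⊆ U ∧ ∃ φ : (ℝ × J) ≃ₜ U,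
    (fun p : ℝ × J => (φ p : X)) '' {p | (p.2 : ℝ) = 0} = ω ∧
    ∀ t : J, range (fun x : ℝ => (φ (x, t) : X)) ∈ Δ.classes

/-- Foliations of class `F` on a surface `X`, possibly with boundary. (A partition with the
property `trivial_interior` and `trivial_boundary` is in particular a one-dimensional foliation:
the trivializations are foliated charts.) -/
structure IsClassF [ChartedSpace (EuclideanHalfSpace 2) X] (Δ : Setoid X) : Prop where
  isClosed_leaf : ∀ ω ∈ Δ.classes, IsClosed ω
  boundary_component : ∀ x ∈ (𝓡∂ 2).boundary X,
    connectedComponentIn ((𝓡∂ 2).boundary X) x ∈ Δ.classes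
  trivial_boundary : ∀ ω ∈ Δ.classes, ω ⊆ (𝓡∂ 2).boundary X → HasTrivialNhd Δ ω (Ico 0 1)
  trivial_interior : ∀ ω ∈ Δ.classes, ¬ ω ⊆ (𝓡∂ 2).boundary X → HasTrivialNhd Δ ω (Ioo (-1) 1)

/-- The intersection of the closures of all neighbourhoods of `y`. -/
def hausdorffClosure {Y : Type*} [TopologicalSpace Y] (y : Y) : Set Y :=
  ⋂ V ∈ 𝓝 y, closure V

/-- `y` is special if the space is not Hausdorff at `y`. -/
def IsSpecialPoint {Y : Type*} [TopologicalSpace Y] (y : Y) : Prop :=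
  hausdorffClosure y ≠ {y}

/-- The family of special leaves: those whose image in the leaf space is a special point. -/
def specialLeaves (Δ : Setoid X) : Set (Set X) :=
  {ω | ∃ y : Quotient Δ, IsSpecialPoint y ∧ ω = (Quotient.mk Δ) ⁻¹' {y}}

/-- `Q` is a connected component of the subspace `F`. -/
def IsComponentOf (F Q : Set X) : Prop :=
  ∃ x ∈ F, Q = connectedComponentIn F x

/-- The homeomorphism `h` from the foliated space `(M, Γ)` onto the subset `A` of `X` is foliated:
it maps leaves of `Γ` onto leaves of `Δ` (which then lie in `A`). -/
def IsFoliated {M : Type*} [TopologicalSpace M] (Γ : Setoid M) (Δ : Setoid X) {A : Set X}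
    (h : M ≃ₜ A) : Prop :=
  ∀ l ∈ Γ.classes, (fun m : M => (h m : X)) '' l ∈ Δ.classes

/-- `A`, with the leaves of `Δ` that it consists of, is foliated homeomorphic to `(M, Γ)`. -/
def FoliatedHomeomorphic {M : Type*} [TopologicalSpace M] (Γ : Setoid M) (Δ : Setoid X)
    (A : Set X) : Prop :=
  ∃ h : M ≃ₜ A, IsFoliated Γ Δ h

end ClassF

section Models

/-- `B` is a disjoint union of (nonempty, possibly unbounded) open intervals. -/
def IsDisjointUnionOfOpenIntervals (B : Set ℝ) : Prop :=
  ∃ I : Set (Set ℝ), I.PairwiseDisjoint id ∧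
    (∀ K ∈ I, K.Nonempty ∧ IsOpen K ∧ K.OrdConnected) ∧ ⋃₀ I = B

/-- Model strips: `ℝ × (a, b) ⊆ S ⊆ ℝ × [a, b]`, and `S` meets the two boundary lines in disjoint
unions of open intervals. -/
def IsModelStrip (S : Set (ℝ × ℝ)) : Prop :=
  ∃ a b : ℝ, a < b ∧ univ ×ˢ Ioo a b ⊆ S ∧ S ⊆ univ ×ˢ Icc a b ∧
    IsDisjointUnionOfOpenIntervals {x | (x, a) ∈ S} ∧
    IsDisjointUnionOfOpenIntervals {x | (x, b) ∈ S}

/-- The foliation of `S` by horizontal lines: two points are in the same leaf if they are joined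
by a horizontal segment inside `S`. For a model strip the leaves are the lines `ℝ × t` with
`a < t < b` and the intervals of the boundary. -/
def canonicalFoliation (S : Set (ℝ × ℝ)) : Setoid S where
  r p q := p.1.2 = q.1.2 ∧ ∀ x ∈ uIcc p.1.1 q.1.1, (x, p.1.2) ∈ S
  iseqv := by
    refine ⟨fun p => ⟨rfl, fun x hx => ?_⟩, fun {p q} h => ⟨h.1.symm, fun x hx => ?_⟩,
      fun {p q r} h k => ⟨h.1.trans k.1, fun x hx => ?_⟩⟩
    · rw [uIcc_self, mem_singleton_iff] at hx
      rw [hx]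
      exact p.2
    · rw [← h.1]
      exact h.2 x (uIcc_comm q.1.1 p.1.1 ▸ hx)
    · rcases uIcc_subset_uIcc_union_uIcc (b := q.1.1) hx with hx | hx
      · exact h.2 x hx
      · rw [h.1]
        exact k.2 x hx

/-- The open model strip `ℝ × (-1, 1)`. -/
def openStrip : Set (ℝ × ℝ) := univ ×ˢ Ioo (-1) 1

/-- The closed model strip `ℝ × [-1, 1]`. -/
def closedStrip : Set (ℝ × ℝ) := univ ×ˢ Icc (-1) 1

/-- The identification `(t, -1) ∼ (f t, 1)` of the boundary lines of `ℝ × [-1, 1]`. -/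
def glue (f : ℝ → ℝ) (p q : closedStrip) : Prop :=
  p.1.2 = -1 ∧ q.1.2 = 1 ∧ q.1.1 = f p.1.1

/-- The quotient space of `ℝ × [-1, 1]` by `(t, -1) ∼ (f t, 1)`. -/
def Glued (f : ℝ → ℝ) : Type := Quot (glue f)

instance (f : ℝ → ℝ) : TopologicalSpace (Glued f) :=
  inferInstanceAs (TopologicalSpace (Quot (glue f)))

/-- The foliation of the quotient induced by the canonical one: its leaves are the images of the
lines `ℝ × t`. -/
def gluedFoliation (f : ℝ → ℝ) : Setoid (Glued f) :=
  (canonicalFoliation closedStrip).map (Quot.mk (glue f))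

/-- The standard cylinder, with boundary lines identified by `(t, -1) ∼ (t, 1)`. -/
abbrev StandardCylinder : Type := Glued (fun t => t)

/-- The foliation of the standard cylinder. -/
abbrev cylinderFoliation : Setoid StandardCylinder := gluedFoliation (fun t => t)

/-- The standard Möbius band, with boundary lines identified by `(t, -1) ∼ (-t, 1)`. -/
abbrev StandardMobius : Type := Glued (fun t => -t)

/-- The foliation of the standard Möbius band. -/
abbrev mobiusFoliation : Setoid StandardMobius := gluedFoliation (fun t => -t)

end Models

end StripFoliation

namespace StripFoliation

open Filter

/-! ### Flattening a family of lines by a weighted sum of monotone functions -/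

section LevelMaps

/-! The argument takes place in the leaf space. A trivial neighbourhood of a leaf makes its
transversal parameter an open embedding of an interval into the leaf space
(`IsStrip.isOpenEmbedding_base`), and the quotient map is open. By local finiteness of the special
leaves, the leaves that are neither special nor in the boundary form an open set there, and each of
them is separated from every other leaf. Hence the image `Z` of `Q` is a connected Hausdorff second
countable one-manifold, and `line_or_loop` parametrizes it as a line or a loop.

The leaves pulled back along a curve `ℝ → Z` form a line bundle over `ℝ`, which is trivial
(`exists_homeomorph_of_locally_trivial`). If `Z` is a line, this makes `Q` a product. If `Z` is a
loop, the lines over the two ends are glued by a homeomorphism of `ℝ`; it is isotopic to the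
identity or to the reflection, which gives the cylinder or the Möbius band
(`LocallyStrip.cylinder_or_mobius`). In these two cases `Z` is compact and made of nonspecial
points, hence closed, so `Q` is clopen in `X`.

For the closure of a half, compact arcs of regular leaves are closed in the leaf space, so new
leaves can only appear as the parameter tends to the end. The whole curve of leaves then converges
to each of them (`IsClassF.eventually_of_mem_closure`). These limit leaves are not separated from
each other in the leaf space, yet each strip contains at most one of them, so they are countably
many. One chart below the top level and one chart at each limit leaf form an `IsStripAtlas`. The
coordinate of such a chart tends to plus or minus infinity near the limit leaves outside it, so
after a sigmoid it extends continuously to the whole closure. A weighted sum of the extended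
coordinates, normalized and sent back to `ℝ` by the inverse sigmoid, embeds the closure into `ℝ ×
[0, 1]` with complete lines below the level `1`. This summation (`exists_flattening`) is also what
trivializes the line bundles. -/

theorem isOpenMap_level {T : Type*} [TopologicalSpace T] {f : ℝ × T → ℝ} (hf : Continuous f)
    (hmono : ∀ t, StrictMono fun x => f (x, t)) :
    IsOpenMap fun q : ℝ × T => (f q, q.2) := by
  rw [isOpenMap_iff_nhds_le]
  rintro ⟨x, t⟩ W hW
  rw [mem_map] at hW
  obtain ⟨A, hA, B, hB, hAB⟩ := mem_nhds_prod_iff.1 hW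
  obtain ⟨a, b, ⟨hax, hxb⟩, hab⟩ := mem_nhds_iff_exists_Ioo_subset.1 hA
  obtain ⟨a', haa', ha'x⟩ := exists_between hax
  obtain ⟨b', hxb', hb'b⟩ := exists_between hxb
  -- The bounds `f (a', s) < y` and `z < f (b', s)` persist for `s` near `t`, so the intermediate
  -- value theorem reaches every level in `(y, z)` between `a'` and `b'`. No invariance of domain is
  -- involved.
  obtain ⟨y, hay, hyx⟩ := exists_between (hmono t ha'x)
  obtain ⟨z, hxz, hzb⟩ := exists_between (hmono t hxb')
  have h1 : ∀ᶠ s in 𝓝 t, f (a', s) < y :=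
    (hf.comp (Continuous.prodMk_right a')).continuousAt.eventually_lt_const hay
  have h2 : ∀ᶠ s in 𝓝 t, z < f (b', s) :=
    (hf.comp (Continuous.prodMk_right b')).continuousAt.eventually_const_lt hzb
  have h3 : Ioo y z ∈ 𝓝 (f (x, t)) := Ioo_mem_nhds hyx hxz
  filter_upwards [prod_mem_nhds h3 (inter_mem hB (inter_mem h1 h2))]
  rintro ⟨w, s⟩ ⟨⟨hw1, hw2⟩, hs, hs1, hs2⟩
  have hs1 : f (a', s) < y := hs1
  have hs2 : z < f (b', s) := hs2
  obtain ⟨v, hv, hvw⟩ := intermediate_value_Icc (ha'x.trans hxb').le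
    (hf.comp (Continuous.prodMk_left s)).continuousOn
    ⟨(hs1.trans hw1).le, (hw2.trans hs2).le⟩
  have : ((v, s) : ℝ × T) ∈ A ×ˢ B := ⟨hab ⟨haa'.trans_le hv.1, hv.2.trans_lt hb'b⟩, hs⟩
  have := hAB this
  simp only [Function.comp] at hvw
  simpa [hvw] using this

theorem tendsto_of_strictMono_surjective {f : ℝ → ℝ} (hf : StrictMono f)
    (hs : Function.Surjective f) : Tendsto f atTop atTop ∧ Tendsto f atBot atBot :=
  ⟨(hf.orderIsoOfSurjective f hs).tendsto_atTop, (hf.orderIsoOfSurjective f hs).tendsto_atBot⟩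

/-- The inverse of the sigmoid function. -/
noncomputable def logit (x : ℝ) : ℝ := -Real.log (x⁻¹ - 1)

theorem logit_sigmoid (x : ℝ) : logit (Real.sigmoid x) = x := by
  simp [logit, Real.sigmoid_def]

theorem sigmoid_logit {x : ℝ} (hx : x ∈ Ioo (0 : ℝ) 1) : Real.sigmoid (logit x) = x := by
  obtain ⟨y, rfl⟩ := Real.range_sigmoid ▸ hx
  rw [logit_sigmoid]

theorem continuousOn_logit : ContinuousOn logit (Ioo 0 1) := by
  intro x hx
  have h1 : x ≠ 0 := hx.1.ne'
  have h2 : x⁻¹ - 1 ≠ 0 := by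
    have := (one_lt_inv₀ hx.1).2 hx.2
    linarith
  apply ContinuousAt.continuousWithinAt
  unfold logit
  fun_prop (disch := assumption)

theorem logit_strictMonoOn : StrictMonoOn logit (Ioo 0 1) := by
  intro x hx y hy hxy
  rw [← sigmoid_logit hx, ← sigmoid_logit hy] at hxy
  exact Real.sigmoid_lt_iff.1 hxy

/-- A weighted sum of functions that are monotone along the fibres of `τ` flattens `A` into a
product. -/
theorem exists_flattening {A B J : Type*} [TopologicalSpace A] [TopologicalSpace B] [Countable J]
    {τ : A → B} (hτ : Continuous τ) {f : J → A → ℝ} (hf : ∀ j, Continuous (f j))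
    {χ : J → B → ℝ} (hχ : ∀ j, Continuous (χ j)) (hχ1 : ∀ j b, χ j b ≤ 1)
    (hf0 : ∀ j a, 0 ≤ f j a) (hfχ : ∀ j a, f j a ≤ χ j (τ a))
    (hch : ∀ a, ∃ (e : OpenPartialHomeomorph A (ℝ × B)) (V : Set B), a ∈ e.source ∧
      e.target = univ ×ˢ V ∧ (∀ x ∈ e.source, (e x).2 = τ x) ∧
      ∀ b ∈ V, (∀ j, Monotone fun u => f j (e.symm (u, b))) ∧
        ∃ j, StrictMono fun u => f j (e.symm (u, b))) :
    ∃ Ψ : A → ℝ × B, Continuous Ψ ∧ IsOpenMap Ψ ∧ (∀ a, (Ψ a).2 = τ a) ∧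
      (∀ b, ∀ s : ℝ → A, (∀ u, τ (s u) = b) → (∀ j, Monotone fun u => f j (s u)) →
        (∃ j, StrictMono fun u => f j (s u)) → StrictMono fun u => (Ψ (s u)).1) ∧
      (∀ b, ∀ s : ℝ → A, Continuous s → (∀ u, τ (s u) = b) →
        (∀ j, Tendsto (fun u => f j (s u)) atBot (𝓝 0)) →
        (∀ j, Tendsto (fun u => f j (s u)) atTop (𝓝 (χ j b))) →
        ∀ x, ∃ u, Ψ (s u) = (x, b)) := by
  obtain ⟨w', hw', c, hc, -⟩ := NNReal.exists_pos_sum_of_countable one_ne_zero J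
  set w : J → ℝ := fun j => w' j with hw
  have hwpos : ∀ j, 0 < w j := fun j => hw' j
  have hwsum : Summable w := NNReal.summable_coe.2 hc.summable
  set F : A → ℝ := fun a => ∑' j, w j * f j a with hF
  have hfb : ∀ j a, ‖w j * f j a‖ ≤ w j := fun j a => by
    rw [Real.norm_of_nonneg (mul_nonneg (hwpos j).le (hf0 j a))]
    exact mul_le_of_le_one_right (hwpos j).le ((hfχ j a).trans (hχ1 j _))
  have hFs : ∀ a, Summable fun j => w j * f j a := fun a =>
    Summable.of_norm_bounded hwsum fun j => hfb j a
  have hFc : Continuous F :=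
    continuous_tsum (fun j => (hf j).const_mul (w j)) hwsum hfb
  -- Nonnegativity of `χ j` is forced only on the image of `τ`; the truncation makes the series `M`
  -- converge uniformly on all of `B`.
  set χ' : J → B → ℝ := fun j b => max 0 (χ j b) with hχ'
  set M : B → ℝ := fun b => ∑' j, w j * χ' j b with hM
  have hχb : ∀ j b, ‖w j * χ' j b‖ ≤ w j := fun j b => by
    rw [Real.norm_of_nonneg (mul_nonneg (hwpos j).le (le_max_left _ _))]
    exact mul_le_of_le_one_right (hwpos j).le (max_le zero_le_one (hχ1 j _))
  have hMs : ∀ b, Summable fun j => w j * χ' j b := fun b =>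
    Summable.of_norm_bounded hwsum fun j => hχb j b
  have hMc : Continuous M :=
    continuous_tsum (fun j => (continuous_const.max (hχ j)).const_mul (w j)) hwsum hχb
  have hF0 : ∀ a, 0 ≤ F a := fun a => tsum_nonneg fun j => mul_nonneg (hwpos j).le (hf0 j a)
  have hFM : ∀ a, F a ≤ M (τ a) := fun a => (hFs a).tsum_le_tsum
    (fun j => mul_le_mul_of_nonneg_left ((hfχ j a).trans (le_max_right _ _)) (hwpos j).le)
    (hMs _)
  have hFmono : ∀ s : ℝ → A, (∀ j, Monotone fun u => f j (s u)) →
      (∃ j, StrictMono fun u => f j (s u)) → StrictMono fun u => F (s u) := by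
    rintro s h1 ⟨j, hj⟩ u v huv
    exact Summable.tsum_lt_tsum (i := j)
      (fun i => mul_le_mul_of_nonneg_left (h1 i huv.le) (hwpos i).le)
      (mul_lt_mul_of_pos_left (hj huv) (hwpos j)) (hFs _) (hFs _)
  -- Both inequalities are strict because `F` increases strictly along the fibre: the points one
  -- unit to the left and to the right of `a` in a chart already satisfy the weak bounds.
  have hFI : ∀ a, 0 < F a ∧ F a < M (τ a) := by
    intro a
    obtain ⟨e, V, ha, ht, he, hm⟩ := hch a
    have hea : e a ∈ univ ×ˢ V := ht ▸ e.map_source ha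
    have hm' := hFmono _ (hm (e a).2 hea.2).1 (hm (e a).2 hea.2).2
    have hτs : ∀ u, τ (e.symm (u, (e a).2)) = τ a := fun u => by
      have hmem : (u, (e a).2) ∈ e.target := by rw [ht]; exact ⟨mem_univ _, hea.2⟩
      rw [← he _ (e.map_target hmem), e.right_inv hmem, he _ ha]
    have h0 : F (e.symm ((e a).1, (e a).2)) = F a := by rw [Prod.mk.eta, e.left_inv ha]
    constructor
    · have := hm' (show (e a).1 - 1 < (e a).1 by linarith)
      simp only [h0] at this
      exact (hF0 _).trans_lt this
    · have := hm' (show (e a).1 < (e a).1 + 1 by linarith)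
      simp only [h0] at this
      exact this.trans_le ((hFM _).trans_eq (by rw [hτs]))
  have hMpos : ∀ a, 0 < M (τ a) := fun a => (hFI a).1.trans (hFI a).2
  have hdiv : ∀ a, F a / M (τ a) ∈ Ioo (0 : ℝ) 1 := fun a =>
    ⟨div_pos (hFI a).1 (hMpos a), (div_lt_one (hMpos a)).2 (hFI a).2⟩
  set Ψ : A → ℝ × B := fun a => (logit (F a / M (τ a)), τ a) with hΨ
  have hΨc : Continuous Ψ := by
    refine Continuous.prodMk ?_ hτ
    exact continuousOn_logit.comp_continuous
      (hFc.div (hMc.comp hτ) fun a => (hMpos a).ne') hdiv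
  have hΨmono : ∀ b, ∀ s : ℝ → A, (∀ u, τ (s u) = b) → (∀ j, Monotone fun u => f j (s u)) →
      (∃ j, StrictMono fun u => f j (s u)) → StrictMono fun u => (Ψ (s u)).1 := by
    intro b s hs h1 h2 u v huv
    refine logit_strictMonoOn (hdiv _) (hdiv _) ?_
    rw [hs, hs]
    refine div_lt_div_of_pos_right (hFmono s h1 h2 huv) ?_
    rw [← hs u]
    exact hMpos _
  refine ⟨Ψ, hΨc, ?_, fun a => rfl, hΨmono, ?_⟩
  · rw [isOpenMap_iff_nhds_le]
    intro a
    obtain ⟨e, V, ha, ht, he, hm⟩ := hch a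
    have hea : e a ∈ univ ×ˢ V := ht ▸ e.map_source ha
    have hVo : IsOpen V := by
      have := e.open_target.preimage (Continuous.prodMk_right (Y := B) (0 : ℝ))
      rw [ht] at this
      simpa [preimage] using this
    set ι : ℝ × V → ℝ × B := Prod.map id Subtype.val with hι
    have hιo : IsOpenEmbedding ι := IsOpenEmbedding.id.prodMap hVo.isOpenEmbedding_subtypeVal
    have hιt : ∀ q, ι q ∈ e.target := fun q => by rw [ht]; exact ⟨mem_univ _, q.2.2⟩
    have hτι : ∀ q, τ (e.symm (ι q)) = q.2 := fun q => by
      rw [← he _ (e.map_target (hιt q)), e.right_inv (hιt q)]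
      rfl
    have hcont : Continuous fun q => e.symm (ι q) :=
      e.continuousOn_symm.comp_continuous hιo.continuous hιt
    have hop : IsOpenMap fun q : ℝ × V => ((Ψ (e.symm (ι q))).1, q.2) := by
      refine isOpenMap_level (f := fun q => (Ψ (e.symm (ι q))).1)
        (continuous_fst.comp (hΨc.comp hcont)) fun t => ?_
      exact hΨmono t (fun u => e.symm (u, t)) (fun u => hτι (u, t)) (hm t t.2).1 (hm t t.2).2
    have hcomp : ∀ q, Ψ (e.symm (ι q)) = ι ((Ψ (e.symm (ι q))).1, q.2) := fun q => by
      refine Prod.ext rfl ?_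
      exact hτι q
    have hop2 : IsOpenMap fun q => Ψ (e.symm (ι q)) := by
      have := hιo.isOpenMap.comp hop
      refine (funext hcomp : (fun q => Ψ (e.symm (ι q))) = _) ▸ this
    set q₀ : ℝ × V := ((e a).1, ⟨(e a).2, hea.2⟩) with hq
    have hq₀ : e.symm (ι q₀) = a := e.left_inv ha
    have h1 := hop2.nhds_le q₀
    rw [hq₀] at h1
    refine h1.trans ?_
    have h2 : Tendsto (fun q => e.symm (ι q)) (𝓝 q₀) (𝓝 a) := by
      conv_rhs => rw [← hq₀]
      exact hcont.continuousAt
    have h3 := map_mono (m := Ψ) h2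
    rwa [map_map] at h3
  · intro b s hs hsb hbot htop x
    have hMb : 0 < M b := by rw [← hsb 0]; exact hMpos _
    -- Dominated convergence with the summable weights carries the limits of the single terms to the
    -- sum, so `F` sweeps out all values between `0` and `M b`.
    have hlim0 : Tendsto (fun u => F (s u)) atBot (𝓝 0) := by
      have := tendsto_tsum_of_dominated_convergence (f := fun u j => w j * f j (s u))
        (g := fun j => w j * 0) (𝓕 := atBot) hwsum (fun j => (hbot j).const_mul _)
        (Eventually.of_forall fun u j => hfb j _)
      simpa using this
    have hlim1 : Tendsto (fun u => F (s u)) atTop (𝓝 (M b)) := by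
      have h0 : ∀ j, χ' j b = χ j b := fun j => max_eq_right
        ((hf0 j (s 0)).trans ((hfχ j (s 0)).trans_eq (by rw [hsb])))
      have := tendsto_tsum_of_dominated_convergence (f := fun u j => w j * f j (s u))
        (g := fun j => w j * χ' j b) (𝓕 := atTop) hwsum
        (fun j => by rw [h0]; exact (htop j).const_mul _)
        (Eventually.of_forall fun u j => hfb j _)
      simpa using this
    set y := Real.sigmoid x * M b with hy
    have hy0 : 0 < y := mul_pos (Real.sigmoid_pos x) hMb
    have hy1 : y < M b := mul_lt_of_lt_one_left hMb (Real.sigmoid_lt_one x)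
    obtain ⟨u₁, hu₁⟩ := (hlim0.eventually_lt_const hy0).exists
    obtain ⟨u₂, hu₂⟩ := (hlim1.eventually_const_lt hy1).exists
    obtain ⟨u, hu⟩ := mem_range_of_exists_le_of_exists_ge (hFc.comp hs) ⟨u₁, hu₁.le⟩ ⟨u₂, hu₂.le⟩
    refine ⟨u, Prod.ext ?_ (hsb u)⟩
    have hu : F (s u) = y := hu
    simp only [hΨ, hsb, hu, hy, mul_div_assoc, div_self hMb.ne', mul_one, logit_sigmoid]

end LevelMaps

end StripFoliation

/-! ### Curves parametrized by the length of a measure -/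

namespace StripFoliation

open Filter MeasureTheory

theorem image_Ioo_of_strictMonoOn {f : ℝ → ℝ} {D : Set ℝ} {u v : ℝ} (huv : u ≤ v)
    (hD : Icc u v ⊆ D) (hf : ContinuousOn f D) (hm : StrictMonoOn f D) :
    f '' Ioo u v = Ioo (f u) (f v) := by
  refine Subset.antisymm ?_ (intermediate_value_Ioo huv (hf.mono hD))
  rintro _ ⟨x, hx, rfl⟩
  exact ⟨hm (hD (left_mem_Icc.2 huv)) (hD (Ioo_subset_Icc_self hx)) hx.1,
    hm (hD (Ioo_subset_Icc_self hx)) (hD (right_mem_Icc.2 huv)) hx.2⟩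

theorem image_Ioo_of_strictAntiOn {f : ℝ → ℝ} {D : Set ℝ} {u v : ℝ} (huv : u ≤ v)
    (hD : Icc u v ⊆ D) (hf : ContinuousOn f D) (hm : StrictAntiOn f D) :
    f '' Ioo u v = Ioo (f v) (f u) := by
  refine Subset.antisymm ?_ (intermediate_value_Ioo' huv (hf.mono hD))
  rintro _ ⟨x, hx, rfl⟩
  exact ⟨hm (hD (Ioo_subset_Icc_self hx)) (hD (right_mem_Icc.2 huv)) hx.2,
    hm (hD (left_mem_Icc.2 huv)) (hD (Ioo_subset_Icc_self hx)) hx.1⟩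

section UnitSpeed

variable {Z : Type*} [TopologicalSpace Z] [MeasurableSpace Z] (μ : Measure Z)

/-- Near `s` the curve `γ` is an arc parametrized by its `μ`-length. -/
def IsUnitSpeedAt (γ : ℝ → Z) (s : ℝ) : Prop :=
  ∃ ε > 0, ContinuousOn γ (Ioo (s - ε) (s + ε)) ∧ InjOn γ (Ioo (s - ε) (s + ε)) ∧
    ∀ u v, s - ε < u → u < v → v < s + ε → μ (γ '' Ioo u v) = ENNReal.ofReal (v - u)

variable {μ}

theorem IsUnitSpeedAt.continuousAt {γ : ℝ → Z} {s : ℝ} (h : IsUnitSpeedAt μ γ s) :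
    ContinuousAt γ s := by
  obtain ⟨ε, hε, hc, -, -⟩ := h
  exact hc.continuousAt (Ioo_mem_nhds (by linarith) (by linarith))

theorem IsUnitSpeedAt.exists_injOn {γ : ℝ → Z} {s : ℝ} (h : IsUnitSpeedAt μ γ s) :
    ∃ W ∈ 𝓝 s, InjOn γ W := by
  obtain ⟨ε, hε, -, hi, -⟩ := h
  exact ⟨_, Ioo_mem_nhds (by linarith) (by linarith), hi⟩

theorem isUnitSpeedAt_of_nhds {γ : ℝ → Z} {s : ℝ} {W : Set ℝ} (hW : W ∈ 𝓝 s)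
    (hc : ContinuousOn γ W) (hi : InjOn γ W)
    (hμ : ∀ u v, u < v → Icc u v ⊆ W → μ (γ '' Ioo u v) = ENNReal.ofReal (v - u)) :
    IsUnitSpeedAt μ γ s := by
  obtain ⟨ε, hε, hεW⟩ := Metric.mem_nhds_iff.1 hW
  rw [Real.ball_eq_Ioo] at hεW
  exact ⟨ε, hε, hc.mono hεW, hi.mono hεW, fun u v hu huv hv =>
    hμ u v huv fun x hx => hεW ⟨hu.trans_le hx.1, hx.2.trans_lt hv⟩⟩

theorem IsUnitSpeedAt.congr {γ γ' : ℝ → Z} {s : ℝ} (h : IsUnitSpeedAt μ γ s)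
    (he : γ =ᶠ[𝓝 s] γ') : IsUnitSpeedAt μ γ' s := by
  obtain ⟨ε, hε, hc, hi, hm⟩ := h
  have hmem : Ioo (s - ε) (s + ε) ∩ {x | γ x = γ' x} ∈ 𝓝 s :=
    inter_mem (Ioo_mem_nhds (by linarith) (by linarith)) he
  have heq : EqOn γ γ' (Ioo (s - ε) (s + ε) ∩ {x | γ x = γ' x}) := fun x hx => hx.2
  refine isUnitSpeedAt_of_nhds hmem ((hc.mono inter_subset_left).congr heq.symm)
    ((hi.mono inter_subset_left).congr heq) fun u v huv hsub => ?_
  have hu := (hsub (left_mem_Icc.2 huv.le)).1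
  have hv := (hsub (right_mem_Icc.2 huv.le)).1
  rw [← hm u v hu.1 huv hv.2]
  exact congrArg _ (image_congr fun x hx => (heq (hsub (Ioo_subset_Icc_self hx))).symm)

theorem IsUnitSpeedAt.comp_affine {γ : ℝ → Z} {s t σ x : ℝ} (hσ : σ = 1 ∨ σ = -1)
    (h : IsUnitSpeedAt μ γ (t + σ * (x - s))) :
    IsUnitSpeedAt μ (fun y => γ (t + σ * (y - s))) x := by
  obtain ⟨ε, hε, hc, hi, hm⟩ := h
  have hmaps : MapsTo (fun y => t + σ * (y - s)) (Ioo (x - ε) (x + ε))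
      (Ioo (t + σ * (x - s) - ε) (t + σ * (x - s) + ε)) := by
    rintro y ⟨h1, h2⟩
    rcases hσ with rfl | rfl <;> constructor <;> linarith
  refine ⟨ε, hε, hc.comp (by fun_prop) hmaps, ?_, ?_⟩
  · intro y hy z hz hyz
    have := hi (hmaps hy) (hmaps hz) hyz
    rcases hσ with rfl | rfl <;> linarith
  · intro u v hu huv hv
    have key : (fun y => γ (t + σ * (y - s))) '' Ioo u v =
        γ '' ((fun y => t + σ * (y - s)) '' Ioo u v) := by rw [image_image]
    rw [key]
    rcases hσ with rfl | rfl
    · have : (fun y => t + 1 * (y - s)) '' Ioo u v = Ioo (t + (u - s)) (t + (v - s)) := by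
        ext y
        constructor
        · rintro ⟨z, hz, rfl⟩
          constructor <;> linarith [hz.1, hz.2]
        · rintro ⟨h1, h2⟩
          exact ⟨y - t + s, ⟨by linarith, by linarith⟩, by ring⟩
      rw [this, hm _ _ (by linarith) (by linarith) (by linarith)]
      congr 1
      ring
    · have : (fun y => t + -1 * (y - s)) '' Ioo u v = Ioo (t - (v - s)) (t - (u - s)) := by
        ext y
        constructor
        · rintro ⟨z, hz, rfl⟩
          constructor <;> linarith [hz.1, hz.2]
        · rintro ⟨h1, h2⟩
          exact ⟨t - y + s, ⟨by linarith, by linarith⟩, by ring⟩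
      rw [this, hm _ _ (by linarith) (by linarith) (by linarith)]
      congr 1
      ring

/-- The `μ`-length coordinate of a chart. -/
noncomputable def chartLength (μ : Measure Z) (c : ℝ → Z) (x : ℝ) : ℝ :=
  ∫ _ in (0 : ℝ)..x, (1 : ℝ) ∂(μ.comap c)

section Chart

variable [BorelSpace Z] [IsFiniteMeasure μ] [NullSingletonClass μ]
variable {c : ℝ → Z} (hc : IsOpenEmbedding c)
include hc

theorem chart_comap_instances :
    IsFiniteMeasure (μ.comap c) ∧ NullSingletonClass (μ.comap c) := by
  refine ⟨⟨?_⟩, ⟨fun x => ?_⟩⟩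
  · rw [hc.measurableEmbedding.comap_apply]
    exact measure_lt_top _ _
  · rw [hc.measurableEmbedding.comap_apply, image_singleton]
    exact measure_singleton _

theorem continuous_chartLength : Continuous (chartLength μ c) := by
  obtain ⟨h1, h2⟩ := chart_comap_instances (μ := μ) hc
  exact intervalIntegral.continuous_primitive (fun a b => intervalIntegrable_const) 0

theorem measure_image_Ioo {a b : ℝ} (hab : a ≤ b) :
    μ (c '' Ioo a b) = ENNReal.ofReal (chartLength μ c b - chartLength μ c a) := by
  obtain ⟨h1, h2⟩ := chart_comap_instances (μ := μ) hc
  rw [chartLength, chartLength, intervalIntegral.integral_interval_sub_left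
    intervalIntegrable_const intervalIntegrable_const, intervalIntegral.integral_const',
    Ioc_eq_empty hab.not_gt, ← hc.measurableEmbedding.comap_apply]
  simp only [measureReal_empty, sub_zero, smul_eq_mul, mul_one]
  rw [ofReal_measureReal]
  exact measure_congr (Ioo_ae_eq_Ioc (α := ℝ))

variable [μ.IsOpenPosMeasure]

theorem strictMono_chartLength : StrictMono (chartLength μ c) := by
  intro a b hab
  have h := measure_image_Ioo (μ := μ) hc hab.le
  have hpos : 0 < μ (c '' Ioo a b) :=
    (hc.isOpenMap _ isOpen_Ioo).measure_pos μ ((nonempty_Ioo.2 hab).image c)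
  rw [h, ENNReal.ofReal_pos] at hpos
  linarith

/-- In the length coordinate of a chart a unit speed curve is affine with slope `±1`. -/
theorem IsUnitSpeedAt.exists_lift {γ : ℝ → Z} {s x : ℝ} (h : IsUnitSpeedAt μ γ s)
    (hx : c x = γ s) : ∃ σ : ℝ, (σ = 1 ∨ σ = -1) ∧ ∃ f : ℝ → ℝ, ∀ᶠ v in 𝓝 s, c (f v) = γ v ∧
      chartLength μ c (f v) = chartLength μ c x + σ * (v - s) := by
  obtain ⟨ε, hε, hcont, hinj, hm⟩ := h
  set e := hc.toOpenPartialHomeomorph c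
  have hr : γ ⁻¹' range c ∈ 𝓝 s := by
    refine (hcont.continuousAt (Ioo_mem_nhds (by linarith) (by linarith))) ?_
    exact hc.isOpen_range.mem_nhds ⟨x, hx⟩
  obtain ⟨δ, hδ, hδr⟩ := Metric.mem_nhds_iff.1 hr
  rw [Real.ball_eq_Ioo] at hδr
  set η := min ε δ with hη
  have hη0 : 0 < η := lt_min hε hδ
  set D := Ioo (s - η) (s + η) with hD
  have hDε : D ⊆ Ioo (s - ε) (s + ε) := fun y hy =>
    ⟨by linarith [hy.1, min_le_left ε δ], by linarith [hy.2, min_le_left ε δ]⟩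
  have hDδ : D ⊆ Ioo (s - δ) (s + δ) := fun y hy =>
    ⟨by linarith [hy.1, min_le_right ε δ], by linarith [hy.2, min_le_right ε δ]⟩
  have hmaps : MapsTo γ D (range c) := fun y hy => hδr (hDδ hy)
  set f : ℝ → ℝ := fun y => e.symm (γ y) with hf
  have hcf : ∀ y ∈ D, c (f y) = γ y := fun y hy =>
    e.right_inv (by simpa [e] using hmaps hy)
  have hfc : ContinuousOn f D := by
    refine e.continuousOn_symm.comp (hcont.mono hDε) ?_
    simpa [e] using hmaps
  have hfi : InjOn f D := fun y hy z hz hyz => by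
    refine hinj (hDε hy) (hDε hz) ?_
    rw [← hcf y hy, ← hcf z hz, hyz]
  have hsD : s ∈ D := ⟨by linarith, by linarith⟩
  have hfs : f s = x := hc.injective (by rw [hcf s hsD, hx])
  have himg : ∀ u v, Icc u v ⊆ D → γ '' Ioo u v = c '' (f '' Ioo u v) := fun u v huv => by
    rw [image_image]
    exact image_congr fun y hy => (hcf y (huv (Ioo_subset_Icc_self hy))).symm
  have hI : ∀ u ∈ D, ∀ v ∈ D, Icc u v ⊆ D := fun u hu v hv => ordConnected_Ioo.out hu hv
  have hN := strictMono_chartLength (μ := μ) hc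
  have hDn : D ∈ 𝓝 s := Ioo_mem_nhds hsD.1 hsD.2
  -- A continuous injection of an interval is monotone, so `f` sends intervals to intervals with
  -- known endpoints. The unit speed condition and `measure_image_Ioo` then give two values for the
  -- same measure.
  rcases hfc.strictMonoOn_of_injOn_Ioo (by linarith) hfi with hmono | hanti
  · have key : ∀ u ∈ D, ∀ v ∈ D, u < v →
        chartLength μ c (f v) - chartLength μ c (f u) = v - u := by
      intro u hu v hv huv
      have h1 := hm u v (hDε hu).1 huv (hDε hv).2
      rw [himg u v (hI u hu v hv), image_Ioo_of_strictMonoOn huv.le (hI u hu v hv) hfc hmono,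
        measure_image_Ioo hc (hmono hu hv huv).le] at h1
      have h2 := hN (hmono hu hv huv)
      exact (ENNReal.ofReal_eq_ofReal_iff (by linarith) (by linarith)).1 h1
    refine ⟨1, Or.inl rfl, f, ?_⟩
    filter_upwards [hDn] with v hv
    refine ⟨hcf v hv, ?_⟩
    rw [← hfs]
    rcases lt_trichotomy s v with h | h | h
    · linarith [key s hsD v hv h]
    · rw [h]; ring
    · linarith [key v hv s hsD h]
  · have key : ∀ u ∈ D, ∀ v ∈ D, u < v →
        chartLength μ c (f u) - chartLength μ c (f v) = v - u := by
      intro u hu v hv huv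
      have h1 := hm u v (hDε hu).1 huv (hDε hv).2
      rw [himg u v (hI u hu v hv), image_Ioo_of_strictAntiOn huv.le (hI u hu v hv) hfc hanti,
        measure_image_Ioo hc (hanti hu hv huv).le] at h1
      have h2 := hN (hanti hu hv huv)
      exact (ENNReal.ofReal_eq_ofReal_iff (by linarith) (by linarith)).1 h1
    refine ⟨-1, Or.inr rfl, f, ?_⟩
    filter_upwards [hDn] with v hv
    refine ⟨hcf v hv, ?_⟩
    rw [← hfs]
    rcases lt_trichotomy s v with h | h | h
    · linarith [key s hsD v hv h]
    · rw [h]; ring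
    · linarith [key v hv s hsD h]

/-- Two unit speed curves through a point agree up to an isometry of the parameter. -/
theorem IsUnitSpeedAt.eventuallyEq {γ₁ γ₂ : ℝ → Z} {s t : ℝ} (h₁ : IsUnitSpeedAt μ γ₁ s)
    (h₂ : IsUnitSpeedAt μ γ₂ t) (h : γ₁ s = γ₂ t) (hs : γ₁ s ∈ range c) :
    ∃ σ : ℝ, (σ = 1 ∨ σ = -1) ∧ ∀ᶠ v in 𝓝 s, γ₁ v = γ₂ (t + σ * (v - s)) := by
  obtain ⟨x, hx⟩ := hs
  obtain ⟨σ₁, hσ₁, f₁, hf₁⟩ := h₁.exists_lift hc hx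
  obtain ⟨σ₂, hσ₂, f₂, hf₂⟩ := h₂.exists_lift hc (hx.trans h)
  have hcont : Tendsto (fun v => t + σ₁ * σ₂ * (v - s)) (𝓝 s) (𝓝 t) := by
    have : Continuous fun v => t + σ₁ * σ₂ * (v - s) := by fun_prop
    simpa using this.tendsto s
  refine ⟨σ₁ * σ₂, ?_, ?_⟩
  · rcases hσ₁ with rfl | rfl <;> rcases hσ₂ with rfl | rfl <;> simp
  · filter_upwards [hf₁, hcont.eventually hf₂] with v hv hw
    rw [← hv.1, ← hw.1]
    congr 1
    apply (strictMono_chartLength (μ := μ) hc).injective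
    rw [hv.2, hw.2]
    rcases hσ₂ with rfl | rfl <;> ring

/-- The curve is the chart composed with the inverse of its length coordinate, shifted to start at
`x`. -/
theorem exists_unitSpeed (x : ℝ) : ∃ g : ℝ → Z, ∃ r > 0, g 0 = c x ∧
    (∀ s ∈ Ioo (-r) r, IsUnitSpeedAt μ g s) ∧ ∀ W ∈ 𝓝 (0 : ℝ), g '' W ∈ 𝓝 (c x) := by
  set N := chartLength μ c
  have hN : StrictMono N := strictMono_chartLength hc
  have hNc : Continuous N := continuous_chartLength hc
  have hNr : (range N).OrdConnected := (isPreconnected_range hNc).ordConnected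
  have hNo : IsOpenEmbedding N := by
    refine ⟨hN.isEmbedding_of_ordConnected hNr, isOpen_iff_mem_nhds.2 ?_⟩
    rintro _ ⟨y, rfl⟩
    exact mem_of_superset (Icc_mem_nhds (hN (sub_one_lt y)) (hN (lt_add_one y)))
      (hNr.out ⟨_, rfl⟩ ⟨_, rfl⟩)
  set e := hNo.toOpenPartialHomeomorph N
  have hleft : ∀ y, e.symm (N y) = y := fun y => e.left_inv (by simp [e])
  have hright : ∀ y ∈ range N, N (e.symm y) = y := fun y hy => e.right_inv (by simpa [e] using hy)
  set g : ℝ → Z := fun v => c (e.symm (N x + v)) with hg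
  set D : Set ℝ := {v | N x + v ∈ range N} with hD
  have hDo : IsOpen D := hNo.isOpen_range.preimage (by fun_prop)
  have h0D : (0 : ℝ) ∈ D := ⟨x, by simp⟩
  obtain ⟨r, hr, hrD⟩ := Metric.mem_nhds_iff.1 (hDo.mem_nhds h0D)
  rw [Real.ball_eq_Ioo, zero_sub, zero_add] at hrD
  refine ⟨g, r, hr, by simp [hg, hleft], fun s hs => ?_, fun W hW => ?_⟩
  · refine isUnitSpeedAt_of_nhds (hDo.mem_nhds (hrD hs)) ?_ ?_ ?_
    · refine hc.continuous.comp_continuousOn (e.continuousOn_symm.comp (by fun_prop) ?_)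
      intro v hv
      have hv : N x + v ∈ range N := hv
      simpa [e] using hv
    · intro u hu v hv huv
      have h1 := congrArg N (hc.injective huv)
      rw [hright _ hu, hright _ hv] at h1
      linarith
    · intro u v huv hsub
      obtain ⟨a, ha⟩ := hsub (left_mem_Icc.2 huv.le)
      obtain ⟨b, hb⟩ := hsub (right_mem_Icc.2 huv.le)
      have hab : a < b := hN.lt_iff_lt.1 (by linarith)
      have : g '' Ioo u v = c '' Ioo a b := by
        have h2 : (fun w => e.symm (N x + w)) '' Ioo u v = Ioo a b := by
          ext y
          constructor
          · rintro ⟨w, hw, rfl⟩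
            have h3 := hright _ (hsub (Ioo_subset_Icc_self hw))
            constructor <;> rw [← hN.lt_iff_lt, h3] <;> linarith [hw.1, hw.2]
          · rintro ⟨h3, h4⟩
            refine ⟨N y - N x, ⟨?_, ?_⟩, by simp [hleft]⟩
            · linarith [hN h3]
            · linarith [hN h4]
        rw [← h2, image_image]
      rw [this, measure_image_Ioo hc hab.le]
      congr 1
      change N b - N a = _
      linarith
  · have h1 : {y | N y - N x ∈ W} ∈ 𝓝 x := by
      have : Continuous fun y => N y - N x := by fun_prop
      exact this.continuousAt (by simpa using hW)
    refine mem_of_superset (hc.isOpenMap.image_mem_nhds h1) ?_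
    rintro _ ⟨y, hy, rfl⟩
    exact ⟨_, hy, by simp [hg, hleft]⟩

end Chart

end UnitSpeed

end StripFoliation

/-! ### Classification of connected one-manifolds -/

namespace StripFoliation

open Filter MeasureTheory

/-- Push a finite measure equivalent to Lebesgue measure forward through countably many charts that
cover `Z`, and add with summable positive weights. Such a measure replaces arc length: it singles
out parametrizations that are unique up to isometries of the parameter, so local curves can be
glued. -/
theorem exists_finite_measure_of_charts {Z : Type*} [TopologicalSpace Z] [T2Space Z]
    [SecondCountableTopology Z] [MeasurableSpace Z] [BorelSpace Z]
    (h : ∀ z : Z, ∃ c : ℝ → Z, IsOpenEmbedding c ∧ z ∈ range c) :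
    ∃ μ : Measure Z, IsFiniteMeasure μ ∧ NullSingletonClass μ ∧ μ.IsOpenPosMeasure := by
  choose c hc hz using h
  obtain ⟨S, hS, hSu⟩ := TopologicalSpace.countable_cover_nhds
    fun z => (hc z).isOpen_range.mem_nhds (hz z)
  have := hS.to_subtype
  obtain ⟨w, hw, hws⟩ := ENNReal.exists_pos_sum_of_countable' one_ne_zero S
  set ν : Measure ℝ := (volume : Measure ℝ).toFinite
  have hνn : ∀ A : Set ℝ, A.Subsingleton → ν A = 0 := fun A hA =>
    toFinite_absolutelyContinuous _ (hA.measure_zero _)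
  have hmap : ∀ z (A : Set Z), MeasurableSet A → ν.map (c z) A = ν (c z ⁻¹' A) := fun z A hA =>
    Measure.map_apply (hc z).continuous.measurable hA
  refine ⟨Measure.sum fun z : S => w z • ν.map (c z), ⟨?_⟩, ⟨fun z => ?_⟩, ⟨fun U hU hne h0 => ?_⟩⟩
  · rw [Measure.sum_apply _ MeasurableSet.univ]
    simp only [Measure.smul_apply, smul_eq_mul, hmap _ _ MeasurableSet.univ, preimage_univ]
    rw [ENNReal.tsum_mul_right]
    exact ENNReal.mul_lt_top (hws.trans ENNReal.one_lt_top) (measure_lt_top _ _)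
  · rw [Measure.sum_apply _ (measurableSet_singleton z), ENNReal.tsum_eq_zero]
    intro y
    rw [Measure.smul_apply, hmap _ _ (measurableSet_singleton z),
      hνn _ (subsingleton_singleton.preimage (hc y).injective), smul_zero]
  · rw [Measure.sum_apply _ hU.measurableSet, ENNReal.tsum_eq_zero] at h0
    obtain ⟨z, hzU⟩ := hne
    obtain ⟨y, hyS, hzy⟩ := mem_iUnion₂.1 (hSu ▸ mem_univ z)
    have h1 := h0 ⟨y, hyS⟩
    rw [Measure.smul_apply, smul_eq_mul, hmap _ _ hU.measurableSet, mul_eq_zero] at h1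
    have h2 : volume (c y ⁻¹' U) = 0 :=
      absolutelyContinuous_toFinite _ (h1.resolve_left (hw _).ne')
    obtain ⟨x, rfl⟩ := hzy
    exact ((hU.preimage (hc y).continuous).measure_pos volume ⟨x, hzU⟩).ne' h2

/-- The sigmoid turns `D` into a bounded open interval, so bounded and unbounded intervals are
treated alike; an affine image of the sigmoid fills that interval and the inverse sigmoid returns to
`D`. -/
theorem exists_openEmbedding_range_eq {D : Set ℝ} (ho : IsOpen D) (hD : D.OrdConnected)
    (hne : D.Nonempty) : ∃ k : ℝ → ℝ, IsOpenEmbedding k ∧ range k = D := by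
  set D' := Real.sigmoid '' D with hD'
  have hD'o : IsOpen D' := by
    have h1 : D' = Ioo 0 1 ∩ logit ⁻¹' D := by
      ext y
      constructor
      · rintro ⟨x, hx, rfl⟩
        exact ⟨⟨Real.sigmoid_pos x, Real.sigmoid_lt_one x⟩, by simpa [logit_sigmoid] using hx⟩
      · rintro ⟨hy, hx⟩
        exact ⟨logit y, hx, sigmoid_logit hy⟩
    rw [h1]
    exact continuousOn_logit.isOpen_inter_preimage isOpen_Ioo ho
  have hpre : IsPreconnected D' :=
    hD.isPreconnected.image _ continuous_sigmoid.continuousOn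
  have hsub : D' ⊆ Icc 0 1 := by
    rintro _ ⟨x, -, rfl⟩
    exact ⟨Real.sigmoid_nonneg x, Real.sigmoid_le_one x⟩
  have hbb : BddBelow D' := bddBelow_Icc.mono hsub
  have hba : BddAbove D' := bddAbove_Icc.mono hsub
  set a := sInf D'
  set b := sSup D'
  have hIoo : D' = Ioo a b := by
    refine Subset.antisymm (fun x hx => ?_) (IsConnected.Ioo_csInf_csSup_subset ⟨hne.image _, hpre⟩ hbb hba)
    obtain ⟨l, u, hlu, hsub⟩ := mem_nhds_iff_exists_Ioo_subset.1 (hD'o.mem_nhds hx)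
    obtain ⟨y, hy1, hy2⟩ := exists_between hlu.1
    obtain ⟨z, hz1, hz2⟩ := exists_between hlu.2
    exact ⟨(csInf_le hbb (hsub ⟨hy1, hy2.trans hlu.2⟩)).trans_lt hy2,
      hz1.trans_le (le_csSup hba (hsub ⟨hlu.1.trans hz1, hz2⟩))⟩
  obtain ⟨x₀, hx₀⟩ := hne
  have hab : a < b := by
    have : Real.sigmoid x₀ ∈ Ioo a b := hIoo ▸ ⟨x₀, hx₀, rfl⟩
    exact this.1.trans this.2
  have hmem : ∀ x, a + (b - a) * Real.sigmoid x ∈ Ioo a b := fun x => by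
    have h1 := mul_pos (sub_pos.2 hab) (Real.sigmoid_pos x)
    have h2 := mul_lt_mul_of_pos_left (Real.sigmoid_lt_one x) (sub_pos.2 hab)
    constructor <;> linarith
  have hsub' : Ioo a b ⊆ Ioo 0 1 := by
    rw [← hIoo]
    rintro _ ⟨x, -, rfl⟩
    exact ⟨Real.sigmoid_pos x, Real.sigmoid_lt_one x⟩
  set k : ℝ → ℝ := fun x => logit (a + (b - a) * Real.sigmoid x) with hk
  have hkm : StrictMono k := fun x y hxy => by
    refine logit_strictMonoOn (hsub' (hmem x)) (hsub' (hmem y)) ?_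
    have := mul_lt_mul_of_pos_left (Real.sigmoid_lt hxy) (sub_pos.2 hab)
    linarith
  have hkr : range k = D := by
    ext y
    constructor
    · rintro ⟨x, rfl⟩
      obtain ⟨z, hz, hzx⟩ : a + (b - a) * Real.sigmoid x ∈ D' := hIoo ▸ hmem x
      simp only [hk]
      rwa [← hzx, logit_sigmoid]
    · intro hy
      have h1 : Real.sigmoid y ∈ Ioo a b := hIoo ▸ ⟨y, hy, rfl⟩
      have hba' : 0 < b - a := sub_pos.2 hab
      refine ⟨logit ((Real.sigmoid y - a) / (b - a)), ?_⟩
      simp only [hk]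
      rw [sigmoid_logit ⟨div_pos (sub_pos.2 h1.1) hba', (div_lt_one hba').2 (by linarith [h1.2])⟩,
        mul_div_cancel₀ _ hba'.ne', add_sub_cancel, logit_sigmoid]
  exact ⟨k, ⟨hkm.isEmbedding_of_ordConnected (hkr ▸ hD), hkr ▸ ho⟩, hkr⟩

section Classification

variable {Z : Type*} [TopologicalSpace Z] [T2Space Z] [MeasurableSpace Z] [BorelSpace Z]
  {μ : Measure Z} [IsFiniteMeasure μ] [NullSingletonClass μ] [μ.IsOpenPosMeasure]

/-- Unique continuation: the set where the germs agree is open, and at a limit point of it the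
curves agree up to a translation or a reflection of the parameter. -/
theorem IsUnitSpeedAt.eventuallyEq_of_preconnected
    (hch : ∀ z : Z, ∃ c : ℝ → Z, IsOpenEmbedding c ∧ z ∈ range c)
    {γ₁ γ₂ : ℝ → Z} {I : Set ℝ} (hI : IsPreconnected I)
    (h₁ : ∀ s ∈ I, IsUnitSpeedAt μ γ₁ s) (h₂ : ∀ s ∈ I, IsUnitSpeedAt μ γ₂ s)
    {s : ℝ} (hs : s ∈ I) (he : γ₁ =ᶠ[𝓝 s] γ₂) : ∀ x ∈ I, γ₁ =ᶠ[𝓝 x] γ₂ := by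
  set W : Set ℝ := {x | γ₁ =ᶠ[𝓝 x] γ₂} with hW
  have hWo : IsOpen W := isOpen_setOfPred_eventually_nhds
  refine hI.subset_of_closure_inter_subset hWo ⟨s, hs, he⟩ ?_
  rintro x ⟨hxW, hxI⟩
  have hx : γ₁ x = γ₂ x := by
    have := mem_closure_iff_frequently.1 hxW
    refine tendsto_nhds_unique_of_frequently_eq (h₁ x hxI).continuousAt (h₂ x hxI).continuousAt
      (this.mono fun y hy => EventuallyEq.eq_of_nhds hy)
  obtain ⟨c, hc, hcx⟩ := hch (γ₁ x)
  obtain ⟨σ, hσ, hev⟩ := (h₁ x hxI).eventuallyEq hc (h₂ x hxI) hx hcx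
  rcases hσ with rfl | rfl
  · filter_upwards [hev] with v hv
    rw [hv]
    congr 1
    ring
  -- In the reflected case a nearby parameter `w` with equal germs satisfies `γ₂ w = γ₂ (2x - w)`,
  -- and local injectivity leaves only `w = x`.
  · obtain ⟨V, hV, hVi⟩ := (h₂ x hxI).exists_injOn
    have hV' : ∀ᶠ v in 𝓝 x, x + -1 * (v - x) ∈ V := by
      have : Continuous fun v => x + -1 * (v - x) := by fun_prop
      exact this.continuousAt (by simpa using hV)
    obtain ⟨w, hwW, hwe, hwV, hwV'⟩ :=
      ((mem_closure_iff_frequently.1 hxW).and_eventually (hev.and (hV'.and hV))).exists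
    have h3 : γ₂ w = γ₂ (x + -1 * (w - x)) := by
      rw [← hwe]; exact (EventuallyEq.eq_of_nhds hwW).symm
    have h4 := hVi hwV' hwV h3
    have : w = x := by linarith
    exact this ▸ hwW

omit [T2Space Z] in
theorem IsUnitSpeedAt.image_mem_nhds
    (hch : ∀ z : Z, ∃ c : ℝ → Z, IsOpenEmbedding c ∧ z ∈ range c) {γ : ℝ → Z} {s : ℝ}
    (h : IsUnitSpeedAt μ γ s) {W : Set ℝ} (hW : W ∈ 𝓝 s) : γ '' W ∈ 𝓝 (γ s) := by
  obtain ⟨c, hc, x, hx⟩ := hch (γ s)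
  obtain ⟨g, r, hr, hg0, hg, hgn⟩ := exists_unitSpeed (μ := μ) hc x
  have h0 := hg 0 ⟨by linarith, hr⟩
  obtain ⟨σ, hσ, hev⟩ := h0.eventuallyEq hc h (hg0.trans hx) ⟨x, hg0.symm⟩
  have hcont : Tendsto (fun v => s + σ * (v - 0)) (𝓝 0) (𝓝 s) := by
    have : Continuous fun v : ℝ => s + σ * (v - 0) := by fun_prop
    simpa using this.tendsto 0
  rw [← hx]
  refine mem_of_superset (hgn _ (hev.and (hcont hW))) ?_
  rintro _ ⟨v, ⟨hv, hvW⟩, rfl⟩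
  exact ⟨_, hvW, hv.symm⟩

/-- A connected one-manifold is the image of a unit speed curve. -/
theorem exists_unitSpeed_surjective [ConnectedSpace Z]
    (hch : ∀ z : Z, ∃ c : ℝ → Z, IsOpenEmbedding c ∧ z ∈ range c) :
    ∃ (Γ : ℝ → Z) (D : Set ℝ), IsOpen D ∧ D.OrdConnected ∧ D.Nonempty ∧
      (∀ s ∈ D, IsUnitSpeedAt μ Γ s) ∧ Γ '' D = univ := by
  obtain ⟨z₀⟩ : Nonempty Z := inferInstance
  obtain ⟨c₀, hc₀, x₀, rfl⟩ := hch z₀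
  obtain ⟨g₀, r₀, hr₀, hg₀0, hg₀, -⟩ := exists_unitSpeed (μ := μ) hc₀ x₀
  set P : (ℝ → Z) → Set ℝ → Prop := fun γ I => IsOpen I ∧ I.OrdConnected ∧ (0 : ℝ) ∈ I ∧
    (∀ s ∈ I, IsUnitSpeedAt μ γ s) ∧ γ =ᶠ[𝓝 0] g₀ with hP
  -- By unique continuation all unit speed curves with the germ of `g₀` at `0` agree on common
  -- intervals, so their union is a largest one and Zorn's lemma is not needed.
  set D : Set ℝ := ⋃₀ {I | ∃ γ, P γ I} with hD
  have hex : ∀ s ∈ D, ∃ γ I, P γ I ∧ s ∈ I := fun s hs => by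
    obtain ⟨I, ⟨γ, hγ⟩, hsI⟩ := hs
    exact ⟨γ, I, hγ, hsI⟩
  choose! G J hG hJ using hex
  set Γ : ℝ → Z := fun s => G s s with hΓ
  have hsubD : ∀ γ I, P γ I → I ⊆ D := fun γ I h => subset_sUnion_of_mem ⟨γ, h⟩
  have hΓeq : ∀ γ I, P γ I → ∀ s ∈ I, Γ s = γ s := by
    intro γ I h s hs
    have hsD := hsubD γ I h hs
    have h' := hG s hsD
    have hpre : IsPreconnected (J s ∩ I) := (h'.2.1.inter h.2.1).isPreconnected
    exact (IsUnitSpeedAt.eventuallyEq_of_preconnected hch hpre (fun x hx => h'.2.2.2.1 x hx.1)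
      (fun x hx => h.2.2.2.1 x hx.2) ⟨h'.2.2.1, h.2.2.1⟩ (h'.2.2.2.2.trans h.2.2.2.2.symm)
      s ⟨hJ s hsD, hs⟩).self_of_nhds
  have hΓev : ∀ γ I, P γ I → ∀ s ∈ I, γ =ᶠ[𝓝 s] Γ := fun γ I h s hs => by
    filter_upwards [h.1.mem_nhds hs] with x hx using (hΓeq γ I h x hx).symm
  have hP₀ : P g₀ (Ioo (-r₀) r₀) :=
    ⟨isOpen_Ioo, ordConnected_Ioo, ⟨by linarith, hr₀⟩, hg₀, EventuallyEq.rfl⟩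
  have hΓD : P Γ D := by
    refine ⟨isOpen_sUnion fun I ⟨γ, h⟩ => h.1, ?_, hsubD _ _ hP₀ hP₀.2.2.1, fun s hs => ?_,
      (hΓev _ _ hP₀ 0 hP₀.2.2.1).symm⟩
    · exact (isPreconnected_sUnion 0 _ (by rintro I ⟨γ, h⟩; exact h.2.2.1)
        (by rintro I ⟨γ, h⟩; exact h.2.1.isPreconnected)).ordConnected
    · exact ((hG s hs).2.2.2.1 s (hJ s hs)).congr (hΓev _ _ (hG s hs) s (hJ s hs))
  refine ⟨Γ, D, hΓD.1, hΓD.2.1, ⟨0, hΓD.2.2.1⟩, hΓD.2.2.2.1, ?_⟩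
  refine IsClopen.eq_univ ⟨?_, ?_⟩ ⟨Γ 0, 0, hΓD.2.2.1, rfl⟩
  · refine isClosed_of_closure_subset fun y hy => ?_
    obtain ⟨c, hc, x, rfl⟩ := hch y
    obtain ⟨g, r, hr, hg0, hg, hgn⟩ := exists_unitSpeed (μ := μ) hc x
    obtain ⟨_, ⟨⟨u, hu, rfl⟩, huc⟩, s, hs, hsu⟩ := mem_closure_iff_nhds.1 hy _
      (inter_mem (hgn _ (Ioo_mem_nhds (by linarith : -r < 0) hr))
        (hc.isOpen_range.mem_nhds ⟨x, rfl⟩))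
    obtain ⟨σ, hσ, hev⟩ := (hΓD.2.2.2.1 s hs).eventuallyEq hc (hg u hu) hsu (hsu ▸ huc)
    -- An arc through the limit point, reparametrized to agree with `Γ` near the meeting parameter
    -- `s`. It extends `Γ`, so maximality puts its interval inside `D`, including the parameter `s +
    -- σ * (0 - u)` at which it passes through the limit point.
    set k : ℝ → Z := fun y => g (u + σ * (y - s)) with hk
    set I : Set ℝ := {y | u + σ * (y - s) ∈ Ioo (-r) r} with hI
    have hIo : IsOpen I := isOpen_Ioo.preimage (by fun_prop)
    have hIc : I.OrdConnected := by
      refine ⟨fun a ha b hb y hy => ?_⟩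
      obtain ⟨ha1, ha2⟩ := ha
      obtain ⟨hb1, hb2⟩ := hb
      obtain ⟨hy1, hy2⟩ := hy
      rcases hσ with rfl | rfl <;> constructor <;> linarith
    have hsI : s ∈ I := by
      simp only [hI, mem_ofPred_eq, sub_self, mul_zero, add_zero]
      exact hu
    have hkI : ∀ y ∈ I, IsUnitSpeedAt μ k y := fun y hy => (hg _ hy).comp_affine hσ
    have hag := IsUnitSpeedAt.eventuallyEq_of_preconnected hch
      (hΓD.2.1.inter hIc).isPreconnected (fun y hy => hΓD.2.2.2.1 y hy.1)
      (fun y hy => hkI y hy.2) ⟨hs, hsI⟩ hev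
    classical
    set γ' : ℝ → Z := D.piecewise Γ k with hγ'
    have hγD : ∀ y ∈ D, Γ =ᶠ[𝓝 y] γ' := fun y hy => by
      filter_upwards [hΓD.1.mem_nhds hy] with v hv
      exact (piecewise_eq_of_mem D _ _ hv).symm
    have hγI : ∀ y ∈ I, k =ᶠ[𝓝 y] γ' := fun y hy => by
      filter_upwards [hIo.mem_nhds hy] with v hv
      by_cases hvD : v ∈ D
      · rw [hγ', piecewise_eq_of_mem D _ _ hvD]
        exact (hag v ⟨hvD, hv⟩).eq_of_nhds.symm
      · rw [hγ', piecewise_eq_of_notMem D _ _ hvD]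
    have hP' : P γ' (D ∪ I) := by
      refine ⟨hΓD.1.union hIo, ?_, Or.inl hΓD.2.2.1, ?_,
        (hγD 0 hΓD.2.2.1).symm.trans hΓD.2.2.2.2⟩
      · exact (IsPreconnected.union s hs hsI hΓD.2.1.isPreconnected
          hIc.isPreconnected).ordConnected
      · rintro y (hy | hy)
        · exact (hΓD.2.2.2.1 y hy).congr (hγD y hy)
        · exact (hkI y hy).congr (hγI y hy)
    have h0 : u + σ * (s + σ * (0 - u) - s) = 0 := by
      rcases hσ with rfl | rfl <;> ring
    have hyI : s + σ * (0 - u) ∈ I := by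
      simp only [hI, mem_ofPred_eq, h0]
      exact ⟨by linarith, hr⟩
    have hyD := hsubD _ _ hP' (Or.inr hyI)
    refine ⟨_, hyD, ?_⟩
    rw [(hag _ ⟨hyD, hyI⟩).eq_of_nhds, hk]
    simp only [h0, hg0]
  · rw [isOpen_iff_mem_nhds]
    rintro _ ⟨s, hs, rfl⟩
    exact (hΓD.2.2.2.1 s hs).image_mem_nhds hch (hΓD.1.mem_nhds hs)

/-- Either a unit speed curve is injective or it contains an embedded loop, which is open. -/
theorem exists_loop_of_not_injOn [ConnectedSpace Z]
    (hch : ∀ z : Z, ∃ c : ℝ → Z, IsOpenEmbedding c ∧ z ∈ range c) {Γ : ℝ → Z} {D : Set ℝ}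
    (hDc : D.OrdConnected) (hΓ : ∀ s ∈ D, IsUnitSpeedAt μ Γ s) (hinj : ¬ InjOn Γ D) :
    ∃ s r, s < r ∧ Icc s r ⊆ D ∧ Γ s = Γ r ∧ InjOn Γ (Ico s r) ∧ Γ '' Icc s r = univ := by
  have hcont : ContinuousOn Γ D := fun s hs => (hΓ s hs).continuousAt.continuousWithinAt
  obtain ⟨a, ha, b, hb, hab, hΓab⟩ : ∃ a ∈ D, ∃ b ∈ D, a < b ∧ Γ a = Γ b := by
    simp only [InjOn, not_forall] at hinj
    obtain ⟨a, ha, b, hb, h, hne⟩ := hinj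
    rcases lt_or_gt_of_ne hne with hlt | hlt
    · exact ⟨a, ha, b, hb, hlt, h⟩
    · exact ⟨b, hb, a, ha, hlt, h.symm⟩
  have habD : Icc a b ⊆ D := hDc.out ha hb
  -- Local injectivity keeps the double points away from the diagonal. This makes `K` compact, and a
  -- shortest loop exists.
  set K : Set (ℝ × ℝ) := {q | q ∈ Icc a b ×ˢ Icc a b ∧ q.1 < q.2 ∧ Γ q.1 = Γ q.2} with hK
  have hKc : IsCompact K := by
    refine (isCompact_Icc.prod isCompact_Icc).of_isClosed_subset ?_ fun q hq => hq.1
    refine isClosed_of_closure_subset fun q hq => ?_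
    have hq1 : q ∈ Icc a b ×ˢ Icc a b :=
      (isClosed_Icc.prod isClosed_Icc).closure_subset_iff.2 (fun q hq => hq.1) hq
    have hfr := mem_closure_iff_frequently.1 hq
    have hle : q.1 ≤ q.2 :=
      (isClosed_le continuous_fst continuous_snd).closure_subset_iff.2
        (fun q hq => hq.2.1.le) hq
    have heq : Γ q.1 = Γ q.2 :=
      tendsto_nhds_unique_of_frequently_eq
        ((hΓ _ (habD hq1.1)).continuousAt.tendsto.comp continuous_fst.continuousAt)
        ((hΓ _ (habD hq1.2)).continuousAt.tendsto.comp continuous_snd.continuousAt)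
        (hfr.mono fun x hx => hx.2.2)
    refine ⟨hq1, lt_of_le_of_ne hle fun h12 => ?_, heq⟩
    obtain ⟨W, hW, hWi⟩ := (hΓ _ (habD hq1.1)).exists_injOn
    have h1 : ∀ᶠ x : ℝ × ℝ in 𝓝 q, x.1 ∈ W := continuous_fst.continuousAt.eventually hW
    have h2 : ∀ᶠ x : ℝ × ℝ in 𝓝 q, x.2 ∈ W :=
      continuous_snd.continuousAt.eventually (h12 ▸ hW)
    obtain ⟨x, hxK, hx1, hx2⟩ := (hfr.and_eventually (h1.and h2)).exists
    exact hxK.2.1.ne (hWi hx1 hx2 hxK.2.2)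
  obtain ⟨⟨s, r⟩, ⟨hsr, hlt, heq⟩, hmin⟩ := hKc.exists_isMinOn
    ⟨(a, b), ⟨⟨left_mem_Icc.2 hab.le, right_mem_Icc.2 hab.le⟩, hab, hΓab⟩⟩
    (f := fun q => q.2 - q.1) (by fun_prop)
  simp only at hlt heq
  have hmin : ∀ u v, u ∈ Icc a b → v ∈ Icc a b → u < v → Γ u = Γ v → r - s ≤ v - u :=
    fun u v hu hv huv h => isMinOn_iff.1 hmin (u, v) ⟨⟨hu, hv⟩, huv, h⟩
  have hsrI : Icc s r ⊆ Icc a b := Icc_subset_Icc hsr.1.1 hsr.2.2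
  have hsrD : Icc s r ⊆ D := hsrI.trans habD
  have hs := hΓ s (habD hsr.1)
  have hr := hΓ r (habD hsr.2)
  obtain ⟨c, hc, hcs⟩ := hch (Γ s)
  obtain ⟨σ, hσ, hev⟩ := hs.eventuallyEq hc hr heq hcs
  -- If the branches at `s` and `r` ran in opposite directions, moving `v` to the right of `s` and
  -- its partner to the left of `r` would give a shorter loop.
  have hσ1 : σ = 1 := by
    refine hσ.resolve_right ?_
    rintro rfl
    have hlt' : ∀ᶠ v in 𝓝[>] s, v < (s + r) / 2 :=
      mem_nhdsWithin_of_mem_nhds (Iio_mem_nhds (by linarith))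
    obtain ⟨v, hv1, hv2, hv3⟩ := ((hev.filter_mono nhdsWithin_le_nhds).and
      (hlt'.and (eventually_mem_nhdsWithin (a := s) (s := Ioi s)))).exists
    have hv3 : s < v := hv3
    have := hmin v (r + -1 * (v - s)) (hsrI ⟨by linarith, by linarith⟩)
      (hsrI ⟨by linarith, by linarith⟩) (by linarith) hv1
    linarith
  subst hσ1
  refine ⟨s, r, hlt, hsrD, heq, ?_, ?_⟩
  · intro u hu v hv huv
    by_contra hne
    rcases lt_or_gt_of_ne hne with h | h
    · have := hmin u v (hsrI ⟨hu.1, hu.2.le⟩) (hsrI ⟨hv.1, hv.2.le⟩) h huv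
      linarith [hu.1, hv.2]
    · have := hmin v u (hsrI ⟨hv.1, hv.2.le⟩) (hsrI ⟨hu.1, hu.2.le⟩) h huv.symm
      linarith [hv.1, hu.2]
  · refine IsClopen.eq_univ ⟨?_, ?_⟩ ⟨Γ s, s, left_mem_Icc.2 hlt.le, rfl⟩
    · exact (isCompact_Icc.image_of_continuousOn (hcont.mono hsrD)).isClosed
    -- Since `σ = 1`, parameters just below `s` give the same points as parameters just below `r`,
    -- so the closed loop alone covers a neighbourhood of its base point.
    · have hend : Γ '' Icc s r ∈ 𝓝 (Γ s) := by
        have hnear : ∀ᶠ v in 𝓝 s, v < r ∧ s < r + 1 * (v - s) := by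
          refine (eventually_lt_nhds hlt).and ?_
          have : Continuous fun v => r + 1 * (v - s) := by fun_prop
          exact this.continuousAt.eventually_const_lt (by simpa using hlt)
        refine mem_of_superset (hs.image_mem_nhds hch (hev.and hnear)) ?_
        rintro _ ⟨v, ⟨hv, hv1, hv2⟩, rfl⟩
        rcases le_total s v with h | h
        · exact ⟨v, ⟨h, hv1.le⟩, rfl⟩
        · exact ⟨r + 1 * (v - s), ⟨hv2.le, by linarith⟩, hv.symm⟩
      rw [isOpen_iff_mem_nhds]
      rintro _ ⟨v, hv, rfl⟩
      rcases hv.1.eq_or_lt with h | h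
      · rwa [← h]
      · rcases hv.2.eq_or_lt with h' | h'
        · rwa [h', ← heq]
        · exact (hΓ v (hsrD hv)).image_mem_nhds hch (Icc_mem_nhds h h')

end Classification

/-- Connected Hausdorff second countable one-manifolds are lines or circles. -/
theorem line_or_loop {Z : Type*} [TopologicalSpace Z] [T2Space Z] [SecondCountableTopology Z]
    [ConnectedSpace Z] (hch : ∀ z : Z, ∃ c : ℝ → Z, IsOpenEmbedding c ∧ z ∈ range c) :
    (∃ γ : ℝ → Z, IsOpenEmbedding γ ∧ range γ = univ) ∨
    ∃ γ : ℝ → Z, Continuous γ ∧ γ (-1) = γ 1 ∧ InjOn γ (Ico (-1) 1) ∧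
      γ '' Icc (-1) 1 = univ := by
  borelize Z
  obtain ⟨μ, h1, h2, h3⟩ := exists_finite_measure_of_charts hch
  obtain ⟨Γ, D, hDo, hDc, hDn, hΓ, hsurj⟩ := exists_unitSpeed_surjective (μ := μ) hch
  have hcont : ContinuousOn Γ D := fun s hs => (hΓ s hs).continuousAt.continuousWithinAt
  by_cases hinj : InjOn Γ D
  · left
    obtain ⟨k, hk, rfl⟩ := exists_openEmbedding_range_eq hDo hDc hDn
    refine ⟨Γ ∘ k, ?_, ?_⟩
    · refine .of_continuous_injective_isOpenMap
        (hcont.comp_continuous hk.continuous mem_range_self) ?_ ?_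
      · intro x y hxy
        exact hk.injective (hinj ⟨x, rfl⟩ ⟨y, rfl⟩ hxy)
      · rw [isOpenMap_iff_nhds_le]
        intro x W hW
        have := (hΓ (k x) ⟨x, rfl⟩).image_mem_nhds hch (hk.isOpenMap.image_mem_nhds hW)
        refine mem_of_superset this ?_
        rintro _ ⟨_, ⟨y, hy, rfl⟩, rfl⟩
        exact hy
    · rw [range_comp, hsurj]
  · right
    obtain ⟨s, r, hlt, hsub, heq, hi, hs⟩ := exists_loop_of_not_injOn hch hDc hΓ hinj
    set k : ℝ → ℝ := fun x => s + (x + 1) / 2 * (r - s) with hk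
    have hkI : ∀ x ∈ Icc (-1 : ℝ) 1, k x ∈ Icc s r := fun x hx => by
      have h1 : 0 ≤ (x + 1) / 2 := by linarith [hx.1]
      have h2 : (x + 1) / 2 ≤ 1 := by linarith [hx.2]
      constructor <;> simp only [hk] <;> nlinarith
    have hkinj : ∀ x y, k x = k y → x = y := fun x y h => by
      simp only [hk, add_right_inj] at h
      have := mul_right_cancel₀ (sub_ne_zero.2 hlt.ne') h
      linarith
    have hk1 : k (-1) = s := by simp [hk]
    have hk2 : k 1 = r := by simp [hk]
    have h11 : (-1 : ℝ) ≤ 1 := by norm_num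
    set γ : ℝ → Z := IccExtend h11 fun x : Icc (-1 : ℝ) 1 => Γ (k x) with hγ
    have hγeq : ∀ x ∈ Icc (-1 : ℝ) 1, γ x = Γ (k x) := fun x hx => IccExtend_of_mem _ _ hx
    refine ⟨γ, ?_, ?_, ?_, ?_⟩
    · refine Continuous.Icc_extend' ?_
      refine (hcont.mono hsub).comp_continuous (by fun_prop) fun x => hkI x x.2
    · rw [hγeq _ ⟨le_rfl, h11⟩, hγeq _ ⟨h11, le_rfl⟩, hk1, hk2, heq]
    · have hlt' : ∀ x ∈ Ico (-1 : ℝ) 1, k x ∈ Ico s r := fun x hx =>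
        ⟨(hkI x ⟨hx.1, hx.2.le⟩).1, lt_of_le_of_ne (hkI x ⟨hx.1, hx.2.le⟩).2 fun h =>
          hx.2.ne (hkinj _ _ (h.trans hk2.symm))⟩
      intro x hx y hy hxy
      rw [hγeq x ⟨hx.1, hx.2.le⟩, hγeq y ⟨hy.1, hy.2.le⟩] at hxy
      exact hkinj _ _ (hi (hlt' x hx) (hlt' y hy) hxy)
    · rw [eq_univ_iff_forall]
      intro z
      obtain ⟨v, hv, rfl⟩ : z ∈ Γ '' Icc s r := hs ▸ mem_univ z
      have hrs : 0 < r - s := sub_pos.2 hlt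
      have hx : 2 * ((v - s) / (r - s)) - 1 ∈ Icc (-1 : ℝ) 1 := by
        have h1 : 0 ≤ (v - s) / (r - s) := div_nonneg (sub_nonneg.2 hv.1) hrs.le
        have h2 : (v - s) / (r - s) ≤ 1 := (div_le_one hrs).2 (by linarith [hv.2])
        constructor <;> linarith
      refine ⟨_, hx, ?_⟩
      rw [hγeq _ hx]
      congr 1
      simp only [hk]
      field_simp
      ring

/-! ### Strips and their images in the leaf space -/

theorem mem_of_mem_classes {X : Type*} {Δ : Setoid X} {l : Set X} (hl : l ∈ Δ.classes)
    {x y : X} (hx : x ∈ l) : y ∈ l ↔ Quotient.mk Δ y = Quotient.mk Δ x := by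
  obtain ⟨z, rfl⟩ := hl
  have hx : Δ x z := hx
  rw [Quotient.eq]
  exact ⟨fun h => Δ.trans h (Δ.symm hx), fun h => Δ.trans h hx⟩

theorem preimage_mk_mem_classes {X : Type*} {Δ : Setoid X} (x : X) :
    Quotient.mk Δ ⁻¹' {Quotient.mk Δ x} ∈ Δ.classes := by
  refine ⟨x, ?_⟩
  ext y
  simp only [mem_preimage, mem_singleton_iff]
  exact Quotient.eq

theorem eq_preimage_mk {X : Type*} {Δ : Setoid X} {l : Set X} (hl : l ∈ Δ.classes)
    {x : X} (hx : x ∈ l) : l = Quotient.mk Δ ⁻¹' {Quotient.mk Δ x} := by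
  ext y
  rw [mem_of_mem_classes hl hx]
  rfl

section Strips

variable {X : Type*} [TopologicalSpace X] {Δ : Setoid X}

/-- An open embedding of a product `ℝ × T` that maps every line `ℝ × t` onto a leaf. -/
structure IsStrip (Δ : Setoid X) {T : Type*} [TopologicalSpace T] (e : ℝ × T → X) : Prop where
  isOpenEmbedding : IsOpenEmbedding e
  leaf : ∀ t, range (fun x => e (x, t)) ∈ Δ.classes

namespace IsStrip

variable {T : Type*} [TopologicalSpace T] {e : ℝ × T → X}

/-- The curve of leaves of a strip. -/
def base (Δ : Setoid X) (e : ℝ × T → X) (t : T) : Quotient Δ := Quotient.mk Δ (e (0, t))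

theorem mk_apply (he : IsStrip Δ e) (u : ℝ) (t : T) : Quotient.mk Δ (e (u, t)) = base Δ e t :=
  (mem_of_mem_classes (he.leaf t) ⟨0, rfl⟩).1 ⟨u, rfl⟩

theorem mk_eq_base (he : IsStrip Δ e) {x : X} {t : T} (h : Quotient.mk Δ x = base Δ e t) :
    ∃ u, e (u, t) = x :=
  (mem_of_mem_classes (he.leaf t) ⟨0, rfl⟩).2 h

theorem base_injective (he : IsStrip Δ e) : Function.Injective (base Δ e) := by
  intro s t h
  obtain ⟨u, hu⟩ := he.mk_eq_base h
  exact (congrArg Prod.snd (he.isOpenEmbedding.injective hu)).symm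

theorem preimage_image_base (he : IsStrip Δ e) (S : Set T) :
    Quotient.mk Δ ⁻¹' (base Δ e '' S) = e '' (univ ×ˢ S) := by
  ext x
  constructor
  · rintro ⟨t, ht, h⟩
    obtain ⟨u, rfl⟩ := he.mk_eq_base h.symm
    exact ⟨(u, t), ⟨mem_univ _, ht⟩, rfl⟩
  · rintro ⟨⟨u, t⟩, ⟨-, ht⟩, rfl⟩
    exact ⟨t, ht, (he.mk_apply u t).symm⟩

theorem preimage_range_base (he : IsStrip Δ e) :
    Quotient.mk Δ ⁻¹' range (base Δ e) = range e := by
  rw [← image_univ, he.preimage_image_base, univ_prod_univ, image_univ]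

theorem isPreconnected_preimage (he : IsStrip Δ e) {S : Set T} (hS : IsPreconnected S) :
    IsPreconnected (Quotient.mk Δ ⁻¹' (base Δ e '' S)) := by
  rw [he.preimage_image_base]
  exact (isPreconnected_univ.prod hS).image _ he.isOpenEmbedding.continuous.continuousOn

/-- The saturated set over an open `S` is `e (ℝ × S)`, which is open in `X`. This provides the
charts of the leaf space. -/
theorem isOpenEmbedding_base (he : IsStrip Δ e) : IsOpenEmbedding (base Δ e) := by
  refine .of_continuous_injective_isOpenMap ?_ he.base_injective fun S hS => ?_
  · exact continuous_quotient_mk'.comp (he.isOpenEmbedding.continuous.comp (by fun_prop))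
  · refine isQuotientMap_quotient_mk'.isOpen_preimage.1 ?_
    change IsOpen (Quotient.mk Δ ⁻¹' (base Δ e '' S))
    rw [he.preimage_image_base]
    exact he.isOpenEmbedding.isOpenMap _ (isOpen_univ.prod hS)

theorem comp (he : IsStrip Δ e) {T' : Type*} [TopologicalSpace T'] {ι : T' → T}
    (hι : IsOpenEmbedding ι) : IsStrip Δ (fun q : ℝ × T' => e (q.1, ι q.2)) :=
  ⟨he.isOpenEmbedding.comp (IsOpenEmbedding.id.prodMap hι), fun t => he.leaf (ι t)⟩

end IsStrip

/-- Every point lies in a strip over a subset of the line. -/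
def LocallyStrip (Δ : Setoid X) : Prop :=
  ∀ x : X, ∃ (J : Set ℝ) (e : ℝ × J → X), IsStrip Δ e ∧ x ∈ range e

/-- If a leaf meets an open set at the height `u` of a strip, so do the nearby leaves; together they
cover a neighbourhood of every point of that leaf. -/
theorem LocallyStrip.isOpenMap (h : LocallyStrip Δ) : IsOpenMap (Quotient.mk Δ) := by
  intro U hU
  refine isQuotientMap_quotient_mk'.isOpen_preimage.1 (isOpen_iff_mem_nhds.2 ?_)
  rintro x ⟨y, hy, hxy⟩
  obtain ⟨J, e, he, ⟨u, t⟩, rfl⟩ := h y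
  have hxy : Quotient.mk Δ x = IsStrip.base Δ e t := by
    rw [← he.mk_apply u t, hxy]
    rfl
  obtain ⟨v, rfl⟩ := he.mk_eq_base hxy
  have hO : IsOpen {s | e (u, s) ∈ U} :=
    hU.preimage (he.isOpenEmbedding.continuous.comp (by fun_prop))
  refine mem_of_superset ((he.isOpenEmbedding.isOpenMap _ (isOpen_univ.prod hO)).mem_nhds
    ⟨(v, t), ⟨mem_univ _, hy⟩, rfl⟩) ?_
  rintro _ ⟨⟨w, s⟩, ⟨-, hs⟩, rfl⟩
  refine ⟨e (u, s), hs, ?_⟩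
  change Quotient.mk Δ _ = Quotient.mk Δ _
  rw [he.mk_apply, he.mk_apply]

theorem LocallyStrip.isPreconnected_leaf (h : LocallyStrip Δ) (y : Quotient Δ) :
    IsPreconnected (Quotient.mk Δ ⁻¹' {y}) := by
  obtain ⟨x, rfl⟩ := Quotient.exists_rep y
  obtain ⟨J, e, he, ⟨u, t⟩, rfl⟩ := h x
  rw [show Quotient.mk Δ (e (u, t)) = IsStrip.base Δ e t from he.mk_apply u t, ← image_singleton]
  exact he.isPreconnected_preimage isPreconnected_singleton

theorem HasTrivialNhd.exists_strip {ω : Set X} {J : Set ℝ} (h : HasTrivialNhd Δ ω J) :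
    ∃ e : ℝ × J → X, IsStrip Δ e ∧ e '' {p | (p.2 : ℝ) = 0} = ω := by
  obtain ⟨U, hU, -, φ, h0, hleaf⟩ := h
  exact ⟨fun p => φ p, ⟨hU.isOpenEmbedding_subtypeVal.comp φ.isOpenEmbedding, hleaf⟩, h0⟩

end Strips

/-! ### Separation at nonspecial points -/

section NonSpecial

variable {Y : Type*} [TopologicalSpace Y]

theorem disjoint_nhds_of_not_special {y z : Y} (hy : ¬ IsSpecialPoint y) (hyz : y ≠ z) :
    Disjoint (𝓝 y) (𝓝 z) := by
  by_contra hd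
  apply hyz
  have hz : z ∈ hausdorffClosure y := by
    refine mem_iInter₂.2 fun V hV => mem_closure_iff_nhds.2 fun W hW => ?_
    by_contra hne
    rw [Set.not_nonempty_iff_eq_empty] at hne
    exact hd (Filter.disjoint_iff.2 ⟨V, hV, W, hW, by rwa [disjoint_iff_inter_eq_empty, inter_comm]⟩)
  rw [not_not.1 hy] at hz
  exact hz.symm

/-- The usual proof for Hausdorff spaces only separates points of `K` from points outside it, so it
is enough that the points of `K` are nonspecial. -/
theorem isClosed_of_isCompact_not_special {K : Set Y} (hK : IsCompact K)
    (h : ∀ y ∈ K, ¬ IsSpecialPoint y) : IsClosed K := by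
  rw [← isOpen_compl_iff, isOpen_iff_mem_nhds]
  intro z hz
  have := hK.disjoint_nhdsSet_left.2 fun y hy => disjoint_nhds_of_not_special (h y hy)
    (fun hyz => hz (hyz ▸ hy) : y ≠ z)
  obtain ⟨V, hV, W, hW, hVW⟩ := Filter.disjoint_iff.1 this
  exact mem_of_superset hW fun w hw hwK => hVW.le_bot ⟨subset_of_mem_nhdsSet hV hwK, hw⟩

end NonSpecial

/-! ### Regular leaves and their neighbourhoods -/

section ClassF

variable {X : Type*} [TopologicalSpace X] [ChartedSpace (EuclideanHalfSpace 2) X] {Δ : Setoid X}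

theorem IsClassF.leaf_subset_boundary (hΔ : IsClassF Δ) {x : X} (hx : x ∈ (𝓡∂ 2).boundary X) :
    Quotient.mk Δ ⁻¹' {Quotient.mk Δ x} ⊆ (𝓡∂ 2).boundary X := by
  rw [← eq_preimage_mk (hΔ.boundary_component x hx) (mem_connectedComponentIn hx)]
  exact connectedComponentIn_subset _ _

theorem IsClassF.exists_strip_boundary (hΔ : IsClassF Δ) {x : X}
    (hx : x ∈ (𝓡∂ 2).boundary X) : ∃ e : ℝ × Ico (0 : ℝ) 1 → X, IsStrip Δ e ∧
      ∃ t : Ico (0 : ℝ) 1, t.1 = 0 ∧ Quotient.mk Δ x = IsStrip.base Δ e t := by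
  obtain ⟨e, he, h0⟩ := (hΔ.trivial_boundary _ (preimage_mk_mem_classes x)
    (hΔ.leaf_subset_boundary hx)).exists_strip
  obtain ⟨⟨u, t⟩, ht, rfl⟩ : x ∈ e '' {p | (p.2 : ℝ) = 0} := h0 ▸ rfl
  exact ⟨e, he, t, ht, he.mk_apply u t⟩

theorem IsClassF.exists_strip_interior (hΔ : IsClassF Δ) {x : X}
    (hx : x ∉ (𝓡∂ 2).boundary X) : ∃ e : ℝ × Ioo (-1 : ℝ) 1 → X, IsStrip Δ e ∧
      ∃ t : Ioo (-1 : ℝ) 1, t.1 = 0 ∧ Quotient.mk Δ x = IsStrip.base Δ e t := by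
  obtain ⟨e, he, h0⟩ := (hΔ.trivial_interior _ (preimage_mk_mem_classes x)
    fun h => hx (h rfl)).exists_strip
  obtain ⟨⟨u, t⟩, ht, rfl⟩ : x ∈ e '' {p | (p.2 : ℝ) = 0} := h0 ▸ rfl
  exact ⟨e, he, t, ht, he.mk_apply u t⟩

theorem IsClassF.exists_strip (hΔ : IsClassF Δ) (x : X) : ∃ (J : Set ℝ) (e : ℝ × J → X),
    J.OrdConnected ∧ (∀ t ∈ J, t ≠ 0 → J ∈ 𝓝 t) ∧ IsStrip Δ e ∧
      ∃ t : J, t.1 = 0 ∧ Quotient.mk Δ x = IsStrip.base Δ e t := by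
  by_cases hx : x ∈ (𝓡∂ 2).boundary X
  · obtain ⟨e, he, ht⟩ := hΔ.exists_strip_boundary hx
    exact ⟨_, e, ordConnected_Ico, fun t ht h0 => Ico_mem_nhds (lt_of_le_of_ne ht.1 h0.symm) ht.2,
      he, ht⟩
  · obtain ⟨e, he, ht⟩ := hΔ.exists_strip_interior hx
    exact ⟨_, e, ordConnected_Ioo, fun t ht h0 => Ioo_mem_nhds ht.1 ht.2,
      he, ht⟩

theorem IsClassF.locallyStrip (hΔ : IsClassF Δ) : LocallyStrip Δ := by
  intro x
  obtain ⟨J, e, -, -, he, t, -, ht⟩ := hΔ.exists_strip x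
  obtain ⟨u, hu⟩ := he.mk_eq_base ht
  exact ⟨J, e, he, _, hu⟩

/-- A leaf in the interior of a strip is not a boundary leaf. -/
theorem IsClassF.notMem_boundary (hΔ : IsClassF Δ) {J : Set ℝ} {e : ℝ × J → X}
    (he : IsStrip Δ e) {t : J} (ht : J ∈ 𝓝 (t : ℝ)) (u : ℝ) : e (u, t) ∉ (𝓡∂ 2).boundary X := by
  intro hb
  obtain ⟨e', he', s₀, hs₀, hbase⟩ := hΔ.exists_strip_boundary hb
  rw [he.mk_apply] at hbase
  set b := IsStrip.base Δ e
  set β := IsStrip.base Δ e'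
  have hbo : IsOpenEmbedding b := he.isOpenEmbedding_base
  have hβo : IsOpenEmbedding β := he'.isOpenEmbedding_base
  have h1 : β ⁻¹' range b ∈ 𝓝 s₀ := hβo.continuous.continuousAt
    (hbo.isOpen_range.mem_nhds ⟨t, hbase⟩)
  obtain ⟨δ, hδ, hδb⟩ := Metric.mem_nhds_iff.1 h1
  set N : Set (Ico (0 : ℝ) 1) := {s | (s : ℝ) < δ} with hN
  have hNb : N ⊆ β ⁻¹' range b := fun s hs => hδb <| by
    rw [Metric.mem_ball, Subtype.dist_eq, hs₀, Real.dist_eq, sub_zero, abs_of_nonneg s.2.1]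
    exact hs
  -- Removing the endpoint leaves a half-open interval connected, whereas removing `t` would
  -- disconnect a neighbourhood of it. The parameters in `b` of the leaves over `N₀` form an
  -- interval that has points on both sides of `t` but misses `t`.
  set N₀ : Set (Ico (0 : ℝ) 1) := {s | 0 < (s : ℝ) ∧ (s : ℝ) < δ} with hN₀
  have hN₀c : IsPreconnected N₀ := by
    rw [← IsInducing.subtypeVal.isPreconnected_image]
    have : Subtype.val '' N₀ = Ioo 0 δ ∩ Ico (0 : ℝ) 1 := by
      ext s
      constructor
      · rintro ⟨s, hs, rfl⟩
        exact ⟨hs, s.2⟩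
      · rintro ⟨hs, hs'⟩
        exact ⟨⟨s, hs'⟩, hs, rfl⟩
    rw [this]
    exact (ordConnected_Ioo.inter ordConnected_Ico).isPreconnected
  have hsub : β '' N₀ ⊆ range b := by
    rintro _ ⟨s, hs, rfl⟩
    exact hNb hs.2
  have hC : IsPreconnected (b ⁻¹' (β '' N₀)) :=
    (hN₀c.image _ hβo.continuous.continuousOn).preimage_of_isOpenMap hbo.injective
      hbo.isOpenMap hsub
  have hCr : (Subtype.val '' (b ⁻¹' (β '' N₀))).OrdConnected :=
    (hC.image _ continuous_subtype_val.continuousOn).ordConnected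
  have hnb : Subtype.val '' (b ⁻¹' (β '' N)) ∈ 𝓝 (t : ℝ) := by
    have hNo : IsOpen N := isOpen_Iio.preimage continuous_subtype_val
    have h2 : b ⁻¹' (β '' N) ∈ 𝓝 t := hbo.continuous.continuousAt
      ((hβo.isOpenMap _ hNo).mem_nhds ⟨s₀, by simpa [hN, hs₀] using hδ, hbase.symm⟩)
    rw [nhds_subtype_eq_comap] at h2
    have h3 := image_mem_map (m := Subtype.val) h2
    rw [map_comap_of_mem (by simpa using ht)] at h3
    exact h3
  obtain ⟨ε, hε, hεN⟩ := Metric.mem_nhds_iff.1 hnb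
  have hside : ∀ r : ℝ, |r| < ε → r ≠ 0 → t + r ∈ Subtype.val '' (b ⁻¹' (β '' N₀)) := by
    intro r hr hr0
    obtain ⟨q, ⟨s, hs, hsq⟩, hq⟩ := hεN (show t + r ∈ Metric.ball (t : ℝ) ε by simpa using hr)
    refine ⟨q, ⟨s, ⟨lt_of_le_of_ne s.2.1 fun h => hr0 ?_, hs⟩, hsq⟩, hq⟩
    have : s = s₀ := Subtype.ext (h.symm.trans hs₀.symm)
    have : q = t := hbo.injective (by rw [← hsq, this, hbase])
    rw [this] at hq
    linarith
  obtain ⟨q, ⟨s, hs, hsq⟩, hq⟩ := hCr.out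
    (hside (-(ε / 2)) (by rw [abs_neg, abs_of_pos] <;> linarith) (by linarith))
    (hside (ε / 2) (by rw [abs_of_pos] <;> linarith) (by linarith))
    (show (t : ℝ) ∈ _ from ⟨by linarith, by linarith⟩)
  have hqt : q = t := Subtype.ext hq
  have : s = s₀ := hβo.injective (by rw [hsq, hqt, hbase])
  rw [this] at hs
  exact hs.1.ne' hs₀

variable (Δ) in
/-- The leaves that are neither special nor in the boundary. -/
def regularLeaves : Set (Quotient Δ) :=
  {y | ¬ IsSpecialPoint y ∧ ∀ x, Quotient.mk Δ x = y → x ∉ (𝓡∂ 2).boundary X}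

theorem IsClassF.preimage_regularLeaves (hΔ : IsClassF Δ) :
    Quotient.mk Δ ⁻¹' regularLeaves Δ =
      (⋃₀ specialLeaves Δ ∪ (𝓡∂ 2).boundary X)ᶜ := by
  ext x
  rw [mem_compl_iff, mem_union, not_or]
  constructor
  · rintro ⟨h1, h2⟩
    refine ⟨?_, h2 x rfl⟩
    rintro ⟨_, ⟨y, hy, rfl⟩, hxy⟩
    have hxy : Quotient.mk Δ x = y := hxy
    exact h1 (hxy ▸ hy)
  · rintro ⟨h1, h2⟩
    refine ⟨fun h => h1 ⟨_, ⟨_, h, rfl⟩, rfl⟩, fun z hz hzb => h2 ?_⟩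
    exact hΔ.leaf_subset_boundary hzb hz.symm

/-- The transversal `e (0, ·)` meets each leaf of the strip once, so local finiteness at `e (0, t₀)`
leaves only finitely many special parameters near `t₀`. The other parameters are interior in `J`, so
their leaves avoid the boundary. -/
theorem IsClassF.eventually_regular (hΔ : IsClassF Δ)
    (hfin : LocallyFinite (fun ω : specialLeaves Δ => (ω : Set X))) {J : Set ℝ}
    {e : ℝ × J → X} (he : IsStrip Δ e) (hJ : ∀ t ∈ J, t ≠ 0 → J ∈ 𝓝 t) (t₀ : J)
    (ht₀ : t₀.1 = 0) : ∀ᶠ t in 𝓝 t₀, t ≠ t₀ → IsStrip.base Δ e t ∈ regularLeaves Δ := by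
  obtain ⟨N, hN, hNf⟩ := hfin (e (0, t₀))
  set S : Set J := {t | e (0, t) ∈ N ∧ IsSpecialPoint (IsStrip.base Δ e t)} with hS
  have hSf : S.Finite := by
    refine Set.Finite.of_finite_image (f := fun t => Quotient.mk Δ ⁻¹' {IsStrip.base Δ e t})
      ((hNf.image Subtype.val).subset ?_) ?_
    · rintro _ ⟨t, ⟨htN, hts⟩, rfl⟩
      refine ⟨⟨_, _, hts, rfl⟩, ⟨e (0, t), rfl, htN⟩, rfl⟩
    · intro s _ t _ hst
      have hst : Quotient.mk Δ ⁻¹' {IsStrip.base Δ e s} = Quotient.mk Δ ⁻¹' {IsStrip.base Δ e t} := hst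
      have : e (0, s) ∈ Quotient.mk Δ ⁻¹' {IsStrip.base Δ e t} := hst ▸ rfl
      exact he.base_injective this
  have h1 : ∀ᶠ t in 𝓝 t₀, e (0, t) ∈ N := by
    have : Continuous fun t => e (0, t) := he.isOpenEmbedding.continuous.comp (by fun_prop)
    exact this.continuousAt hN
  have h2 : ∀ᶠ t in 𝓝 t₀, t ∉ S \ {t₀} :=
    (hSf.subset sdiff_subset).isClosed.isOpen_compl.mem_nhds fun h => h.2 rfl
  filter_upwards [h1, h2] with t ht1 ht2 hne
  refine ⟨fun hsp => ht2 ⟨⟨ht1, hsp⟩, hne⟩, fun x hx => ?_⟩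
  obtain ⟨u, rfl⟩ := he.mk_eq_base hx
  exact hΔ.notMem_boundary he (hJ t t.2 fun h => hne (Subtype.ext (h.trans ht₀.symm))) u

/-- Small punctured neighbourhoods of a leaf consist of two families of regular leaves. -/
theorem IsClassF.exists_sides (hΔ : IsClassF Δ)
    (hfin : LocallyFinite (fun ω : specialLeaves Δ => (ω : Set X))) (y : Quotient Δ)
    {W : Set (Quotient Δ)} (hW : W ∈ 𝓝 y) : ∃ C₁ C₂ : Set (Quotient Δ),
      IsPreconnected (Quotient.mk Δ ⁻¹' C₁) ∧ IsPreconnected (Quotient.mk Δ ⁻¹' C₂) ∧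
      C₁ ⊆ W ∩ regularLeaves Δ ∧ C₂ ⊆ W ∩ regularLeaves Δ ∧ {y} ∪ (C₁ ∪ C₂) ∈ 𝓝 y := by
  obtain ⟨x, rfl⟩ := Quotient.exists_rep y
  obtain ⟨J, e, hJc, hJ, he, t₀, ht₀, hx⟩ := hΔ.exists_strip x
  set b := IsStrip.base Δ e
  have hbo : IsOpenEmbedding b := he.isOpenEmbedding_base
  have hx' : Quotient.mk Δ x = b t₀ := hx
  have hev := (hΔ.eventually_regular hfin he hJ t₀ ht₀).and
    (hbo.continuous.continuousAt.eventually (hx' ▸ hW : W ∈ 𝓝 (b t₀)))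
  obtain ⟨δ, hδ, hball⟩ := Metric.mem_nhds_iff.1 hev
  have hpre : ∀ a c : ℝ, IsPreconnected {t : J | a < t ∧ (t : ℝ) < c} := fun a c => by
    rw [← IsInducing.subtypeVal.isPreconnected_image]
    have : Subtype.val '' {t : J | a < t ∧ (t : ℝ) < c} = Ioo a c ∩ J := by
      ext s
      constructor
      · rintro ⟨s, hs, rfl⟩
        exact ⟨hs, s.2⟩
      · rintro ⟨hs, hs'⟩
        exact ⟨⟨s, hs'⟩, hs, rfl⟩
    rw [this]
    exact (ordConnected_Ioo.inter hJc).isPreconnected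
  have hsmall : ∀ t : J, |(t : ℝ)| < δ → (t ≠ t₀ → b t ∈ regularLeaves Δ) ∧ b t ∈ W :=
    fun t ht => hball <| by
      rw [Metric.mem_ball, Subtype.dist_eq, ht₀, Real.dist_eq, sub_zero]
      exact ht
  -- For a boundary leaf `J` starts at `0` and the first side is empty.
  refine ⟨_, _, he.isPreconnected_preimage (hpre (-δ) 0), he.isPreconnected_preimage (hpre 0 δ),
    ?_, ?_, ?_⟩
  · rintro _ ⟨t, ⟨h1, h2⟩, rfl⟩
    have := hsmall t (abs_lt.2 ⟨h1, by linarith⟩)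
    exact ⟨this.2, this.1 fun h => h2.ne (h ▸ ht₀)⟩
  · rintro _ ⟨t, ⟨h1, h2⟩, rfl⟩
    have := hsmall t (abs_lt.2 ⟨by linarith, h2⟩)
    exact ⟨this.2, this.1 fun h => h1.ne' (h ▸ ht₀)⟩
  · have hn : b '' Metric.ball t₀ δ ∈ 𝓝 (b t₀) :=
      hbo.isOpenMap.image_mem_nhds (Metric.ball_mem_nhds _ hδ)
    rw [hx']
    refine mem_of_superset hn ?_
    rintro _ ⟨t, ht, rfl⟩
    rw [Metric.mem_ball, Subtype.dist_eq, ht₀, Real.dist_eq, sub_zero, abs_lt] at ht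
    rcases lt_trichotomy (t : ℝ) 0 with h | h | h
    · exact Or.inr (Or.inl ⟨t, ⟨ht.1, h⟩, rfl⟩)
    · exact Or.inl (congrArg b (Subtype.ext (h.trans ht₀.symm)))
    · exact Or.inr (Or.inr ⟨t, ⟨h, ht.2⟩, rfl⟩)

theorem IsClassF.isOpen_regularLeaves (hΔ : IsClassF Δ)
    (hfin : LocallyFinite (fun ω : specialLeaves Δ => (ω : Set X))) :
    IsOpen (regularLeaves Δ) := by
  rw [isOpen_iff_mem_nhds]
  intro y hy
  obtain ⟨C₁, C₂, -, -, h1, h2, hn⟩ := hΔ.exists_sides hfin y univ_mem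
  refine mem_of_superset hn ?_
  rintro z (rfl | hz | hz)
  · exact hy
  · exact (h1 hz).2
  · exact (h2 hz).2

/-- Small strips around regular leaves. -/
theorem IsClassF.exists_strip_regular (hΔ : IsClassF Δ) {y : Quotient Δ}
    (hy : y ∈ regularLeaves Δ) {W : Set (Quotient Δ)} (hW : W ∈ 𝓝 y) :
    ∃ e : ℝ × ℝ → X, IsStrip Δ e ∧ y ∈ range (IsStrip.base Δ e) ∧
      range (IsStrip.base Δ e) ⊆ W := by
  obtain ⟨x, rfl⟩ := Quotient.exists_rep y
  obtain ⟨e, he, t₀, ht₀, hx⟩ := hΔ.exists_strip_interior (hy.2 x rfl)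
  have hx' : Quotient.mk Δ x = IsStrip.base Δ e t₀ := hx
  have hev : IsStrip.base Δ e ⁻¹' W ∈ 𝓝 t₀ :=
    he.isOpenEmbedding_base.continuous.continuousAt (hx' ▸ hW)
  obtain ⟨δ, hδ, hball⟩ := Metric.mem_nhds_iff.1 hev
  have hI : IsOpen (Ioo (max (-1) (-δ)) (min 1 δ)) := isOpen_Ioo
  have h0 : (0 : ℝ) ∈ Ioo (max (-1) (-δ)) (min 1 δ) := by simp [hδ]
  obtain ⟨k, hk, hkr⟩ := exists_openEmbedding_range_eq hI ordConnected_Ioo ⟨0, h0⟩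
  have hkI : ∀ v, k v ∈ Ioo (max (-1) (-δ)) (min 1 δ) := fun v => hkr ▸ mem_range_self v
  have hk1 : ∀ v, k v ∈ Ioo (-1 : ℝ) 1 := fun v =>
    ⟨(le_max_left _ _).trans_lt (hkI v).1, (hkI v).2.trans_le (min_le_left _ _)⟩
  have hk2 : ∀ v, |k v| < δ := fun v =>
    abs_lt.2 ⟨(le_max_right _ _).trans_lt (hkI v).1, (hkI v).2.trans_le (min_le_right _ _)⟩
  have hι : IsOpenEmbedding (fun v => (⟨k v, hk1 v⟩ : Ioo (-1 : ℝ) 1)) := by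
    refine IsOpenEmbedding.of_comp _ isOpen_Ioo.isOpenEmbedding_subtypeVal ?_
    exact hk
  refine ⟨_, he.comp hι, ?_, ?_⟩
  · obtain ⟨v, hv⟩ : (0 : ℝ) ∈ range k := hkr ▸ h0
    refine ⟨v, ?_⟩
    rw [hx']
    exact congrArg (IsStrip.base Δ e) (a₁ := ⟨k v, hk1 v⟩) (Subtype.ext (hv.trans ht₀.symm))
  · rintro _ ⟨v, rfl⟩
    refine hball ?_
    rw [Metric.mem_ball, Subtype.dist_eq, ht₀, Real.dist_eq, sub_zero]
    exact hk2 v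

end ClassF

/-! ### Line bundles over the line -/

/-- A continuous family of injective functions that is increasing at one parameter is increasing
at all of them. -/
theorem strictMono_of_isPreconnected {T : Type*} [TopologicalSpace T] {S : Set T}
    (hS : IsPreconnected S) {g : T → ℝ → ℝ} (hc : ∀ u, ContinuousOn (fun t => g t u) S)
    (hgc : ∀ t ∈ S, Continuous (g t)) (hi : ∀ t ∈ S, Function.Injective (g t)) {t₀ : T}
    (ht₀ : t₀ ∈ S) (h₀ : StrictMono (g t₀)) : ∀ t ∈ S, StrictMono (g t) := by
  intro t ht
  refine ((hgc t ht).strictMono_of_inj (hi t ht)).resolve_right fun hanti => ?_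
  have hd : ContinuousOn (fun t => g t 1 - g t 0) S := (hc 1).sub (hc 0)
  have h1 : g t 1 - g t 0 ≤ 0 := sub_nonpos.2 (hanti zero_lt_one).le
  have h2 : 0 ≤ g t₀ 1 - g t₀ 0 := sub_nonneg.2 (h₀ zero_lt_one).le
  obtain ⟨s, hs, h0⟩ := hS.intermediate_value ht ht₀ hd ⟨h1, h2⟩
  exact one_ne_zero (hi s hs (sub_eq_zero.1 h0))

/-- A trivialization over `[a, d]` and one around the supremum of the reachable points can be joined
at `d` by `piecewiseLe`, so that supremum is reached and cannot lie before `b`. -/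
theorem exists_trivialization_Icc {F E : Type*} [TopologicalSpace F] [TopologicalSpace E]
    {π : E → ℝ} (h : ∀ b, ∃ e : Bundle.Trivialization F π, b ∈ e.baseSet) (a b : ℝ) :
    ∃ e : Bundle.Trivialization F π, Icc a b ⊆ e.baseSet := by
  obtain ⟨ea, hea⟩ := h a
  rcases lt_or_ge b a with hba | hab
  · exact ⟨ea, by simp [hba]⟩
  set s : Set ℝ := {x ∈ Icc a b | ∃ e : Bundle.Trivialization F π, Icc a x ⊆ e.baseSet}
  have ha : a ∈ s := ⟨left_mem_Icc.2 hab, ea, by simp [hea]⟩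
  have hsb : b ∈ upperBounds s := fun x hx => hx.1.2
  set c := sSup s
  have hsc : IsLUB s c := isLUB_csSup ⟨a, ha⟩ ⟨b, hsb⟩
  have hc : c ∈ Icc a b := ⟨hsc.1 ha, hsc.2 hsb⟩
  obtain ⟨-, ec, hec⟩ : c ∈ s := by
    rcases hc.1.eq_or_lt with heq | hlt
    · rwa [← heq]
    refine ⟨hc, ?_⟩
    obtain ⟨ec, hc⟩ := h c
    obtain ⟨c', hc', hc'e⟩ : ∃ c' ∈ Ico a c, Ioc c' c ⊆ ec.baseSet :=
      (mem_nhdsLE_iff_exists_mem_Ico_Ioc_subset hlt).1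
        (mem_nhdsWithin_of_mem_nhds <| IsOpen.mem_nhds ec.open_baseSet hc)
    obtain ⟨d, ⟨hdab, ead, had⟩, hd⟩ : ∃ d ∈ s, d ∈ Ioc c' c := hsc.exists_between hc'.2
    refine ⟨ead.piecewiseLe ec d (had ⟨hdab.1, le_rfl⟩) (hc'e hd), subset_ite.2 ?_⟩
    exact ⟨fun x hx => had ⟨hx.1.1, hx.2⟩, fun x hx => hc'e ⟨hd.1.trans (not_le.1 hx.2), hx.1.2⟩⟩
  rcases hc.2.eq_or_lt with heq | hlt
  · exact ⟨ec, heq ▸ hec⟩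
  obtain ⟨d, hdcb, hd⟩ : ∃ d ∈ Ioc c b, Ico c d ⊆ ec.baseSet :=
    (mem_nhdsGE_iff_exists_mem_Ioc_Ico_subset hlt).1
      (mem_nhdsWithin_of_mem_nhds <| IsOpen.mem_nhds ec.open_baseSet (hec ⟨hc.1, le_rfl⟩))
  have had : Ico a d ⊆ ec.baseSet := Ico_subset_Icc_union_Ico.trans (union_subset hec hd)
  obtain ⟨d', hd'c, hd'd⟩ := exists_between hdcb.1
  exact ((hsc.1 ⟨⟨hc.1.trans hd'c.le, hd'd.le.trans hdcb.2⟩, ec,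
    (Icc_subset_Ico_right hd'd).trans had⟩).not_gt hd'c).elim

theorem strictMono_of_leftInverse {g k : ℝ → ℝ} (hg : StrictMono g)
    (h : ∀ x, g (k x) = x) : StrictMono k := fun x y hxy => by
  rw [← hg.lt_iff_lt, h, h]
  exact hxy

section CoordChange

variable {E : Type*} [TopologicalSpace E] {π : E → ℝ}

theorem continuousOn_coordChange_base (e₁ e₂ : Bundle.Trivialization ℝ π) (u : ℝ) :
    ContinuousOn (fun b => e₁.coordChange e₂ b u) (e₁.baseSet ∩ e₂.baseSet) := by
  have h1 : ContinuousOn (fun b : ℝ => e₁.toOpenPartialHomeomorph.symm (b, u))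
      (e₁.baseSet ∩ e₂.baseSet) :=
    e₁.toOpenPartialHomeomorph.continuousOn_symm.comp (by fun_prop)
      fun b hb => e₁.mem_target.2 hb.1
  have h2 : MapsTo (fun b : ℝ => e₁.toOpenPartialHomeomorph.symm (b, u))
      (e₁.baseSet ∩ e₂.baseSet) e₂.source := fun b hb => by
    rw [e₂.mem_source, e₁.proj_symm_apply' hb.1]
    exact hb.2
  exact continuous_snd.comp_continuousOn (e₂.continuousOn_toFun.comp h1 h2)

theorem coordChange_strictMono (e₁ e₂ : Bundle.Trivialization ℝ π) {S : Set ℝ} (hS : IsPreconnected S)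
    (h₁ : S ⊆ e₁.baseSet) (h₂ : S ⊆ e₂.baseSet) {b₀ : ℝ} (hb₀ : b₀ ∈ S)
    (h : StrictMono (e₁.coordChange e₂ b₀)) : ∀ b ∈ S, StrictMono (e₁.coordChange e₂ b) :=
  strictMono_of_isPreconnected hS
    (fun u => (continuousOn_coordChange_base e₁ e₂ u).mono (subset_inter h₁ h₂))
    (fun _ hb => e₁.continuous_coordChange e₂ (h₁ hb) (h₂ hb))
    (fun _ hb => (e₁.coordChangeHomeomorph e₂ (h₁ hb) (h₂ hb)).injective) hb₀ h

/-- Line bundles over the line are trivial. -/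
theorem exists_homeomorph_of_locally_trivial (hπ : Continuous π)
    (h : ∀ b, ∃ e : Bundle.Trivialization ℝ π, b ∈ e.baseSet) :
    ∃ Ψ : E ≃ₜ ℝ × ℝ, ∀ q, (Ψ q).2 = π q := by
  choose e' he' using fun n : ℕ => exists_trivialization_Icc h (-((n : ℝ) + 1)) ((n : ℝ) + 1)
  have hmem0 : ∀ n : ℕ, (0 : ℝ) ∈ Icc (-((n : ℝ) + 1)) ((n : ℝ) + 1) := fun n => by
    have : (0 : ℝ) ≤ n := n.cast_nonneg
    constructor <;> linarith
  set e₀ := e' 0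
  have h00 : (0 : ℝ) ∈ e₀.baseSet := he' 0 (hmem0 0)
  -- Reversing fibres where necessary orients all trivializations alike over `0`; connectedness of
  -- the base intervals then makes all transitions increasing.
  have horient : ∀ n : ℕ, ∃ e : Bundle.Trivialization ℝ π, Icc (-((n : ℝ) + 1)) ((n : ℝ) + 1) ⊆ e.baseSet ∧
      StrictMono (e₀.coordChange e 0) := by
    intro n
    have h0n := he' n (hmem0 n)
    rcases (e₀.continuous_coordChange (e' n) h00 h0n).strictMono_of_inj
      (e₀.coordChangeHomeomorph (e' n) h00 h0n).injective with hm | ha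
    · exact ⟨e' n, he' n, hm⟩
    · refine ⟨(e' n).transFiberHomeomorph (Homeomorph.neg ℝ), he' n, fun x y hxy => ?_⟩
      exact neg_lt_neg (ha hxy)
  choose e he ho using horient
  have ho2 : ∀ n m : ℕ, StrictMono ((e n).coordChange (e m) 0) := by
    intro n m
    have h1 : StrictMono ((e n).coordChange e₀ 0) :=
      strictMono_of_leftInverse (ho n) fun x => by
        rw [Bundle.Trivialization.coordChange_coordChange _ _ _ (he n (hmem0 n)) h00,
          Bundle.Trivialization.coordChange_same_apply _ (he n (hmem0 n))]
    intro x y hxy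
    have h2 := ho m (h1 hxy)
    rwa [Bundle.Trivialization.coordChange_coordChange _ _ _ (he n (hmem0 n)) h00,
      Bundle.Trivialization.coordChange_coordChange _ _ _ (he n (hmem0 n)) h00] at h2
  have hmono : ∀ (n m : ℕ) (b : ℝ), b ∈ Icc (-((n : ℝ) + 1)) ((n : ℝ) + 1) →
      b ∈ Icc (-((m : ℝ) + 1)) ((m : ℝ) + 1) → StrictMono ((e n).coordChange (e m) b) := by
    intro n m b hn hm
    exact coordChange_strictMono _ _ (ordConnected_Icc.inter ordConnected_Icc).isPreconnected
      (fun x hx => he n hx.1) (fun x hx => he m hx.2) ⟨hmem0 n, hmem0 m⟩ (ho2 n m) b ⟨hn, hm⟩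
  set χ : ℕ → ℝ → ℝ := fun n s => max 0 (min 1 (n + 1 - |s|)) with hχ
  have hχ0 : ∀ (n : ℕ) (s : ℝ), s ∉ Icc (-((n : ℝ) + 1)) ((n : ℝ) + 1) → χ n s = 0 := by
    intro n s hs
    have h1 : (n : ℝ) + 1 - |s| ≤ 0 := by
      by_contra hlt
      exact hs (abs_le.1 (by linarith))
    exact max_eq_left ((min_le_right _ _).trans h1)
  have hχpos : ∀ (n : ℕ) (s : ℝ), |s| < (n : ℝ) + 1 → 0 < χ n s := fun n s hs =>
    lt_max_of_lt_right (lt_min one_pos (sub_pos.2 hs))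
  have hχnn : ∀ n s, 0 ≤ χ n s := fun n s => le_max_left _ _
  have hχc : ∀ n, Continuous (χ n) := fun n => by fun_prop
  -- The tent `χ n` vanishes outside an interval over which `e n` is a trivialization, so the
  -- product is continuous on all of `E` even where `e n` carries no information.
  set f : ℕ → E → ℝ := fun n q => χ n (π q) * Real.sigmoid ((e n q).2) with hf
  have hfc : ∀ n, Continuous (f n) := by
    intro n
    rw [continuous_iff_continuousAt]
    intro q
    by_cases hq : π q ∈ Icc (-((n : ℝ) + 1)) ((n : ℝ) + 1)
    · have h1 : ContinuousAt (fun q => (e n q).2) q :=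
        continuous_snd.continuousAt.comp ((e n).continuousAt ((e n).mem_source.2 (he n hq)))
      exact ((hχc n).comp hπ).continuousAt.mul (continuous_sigmoid.continuousAt.comp h1)
    · have h1 : f n =ᶠ[𝓝 q] fun _ => 0 := by
        filter_upwards [(isClosed_Icc.isOpen_compl.preimage hπ).mem_nhds hq] with x hx
        simp only [hf, hχ0 n _ hx, zero_mul]
      exact continuousAt_const.congr h1.symm
  have hfs : ∀ (n m : ℕ) (b u : ℝ), b ∈ Icc (-((n : ℝ) + 1)) ((n : ℝ) + 1) →
      f m ((e n).toOpenPartialHomeomorph.symm (b, u)) =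
        χ m b * Real.sigmoid ((e n).coordChange (e m) b u) := by
    intro n m b u hb
    simp only [hf, (e n).proj_symm_apply' (he n hb)]
    rfl
  have hexn : ∀ b : ℝ, ∃ n : ℕ, b ∈ Ioo (-((n : ℝ) + 1)) ((n : ℝ) + 1) := fun b => by
    obtain ⟨n, hn⟩ := exists_nat_gt |b|
    exact ⟨n, abs_lt.1 (by linarith)⟩
  have hmon : ∀ (n : ℕ) (b : ℝ), b ∈ Ioo (-((n : ℝ) + 1)) ((n : ℝ) + 1) →
      (∀ j, Monotone fun u => f j ((e n).toOpenPartialHomeomorph.symm (b, u))) ∧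
        ∃ j, StrictMono fun u => f j ((e n).toOpenPartialHomeomorph.symm (b, u)) := by
    intro n b hb
    have hb' := Ioo_subset_Icc_self hb
    refine ⟨fun j => ?_, n, ?_⟩
    · simp only [hfs n j b _ hb']
      by_cases hj : b ∈ Icc (-((j : ℝ) + 1)) ((j : ℝ) + 1)
      · exact (Real.sigmoid_monotone.comp (hmono n j b hb' hj).monotone).const_mul (hχnn j b)
      · simp only [hχ0 j b hj, zero_mul]
        exact monotone_const
    · simp only [hfs n n b _ hb']
      exact (Real.sigmoid_strictMono.comp (hmono n n b hb' hb')).const_mul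
        (hχpos n b (abs_lt.2 hb))
  obtain ⟨Ψ, hΨc, hΨo, hΨ2, hΨm, hΨs⟩ := exists_flattening hπ hfc hχc
    (fun n b => max_le zero_le_one (min_le_left _ _))
    (fun n q => mul_nonneg (hχnn _ _) (Real.sigmoid_nonneg _))
    (fun n q => mul_le_of_le_one_right (hχnn _ _) (Real.sigmoid_le_one _)) (by
      intro q
      obtain ⟨n, hn⟩ := hexn (π q)
      set e₁ := (e n).restrOpen (Ioo (-((n : ℝ) + 1)) ((n : ℝ) + 1)) isOpen_Ioo
      refine ⟨e₁.toOpenPartialHomeomorph.transHomeomorph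
        (Homeomorph.prodComm ℝ ℝ),
        (e n).baseSet ∩ Ioo (-((n : ℝ) + 1)) ((n : ℝ) + 1), ?_, ?_, ?_, ?_⟩
      · exact e₁.mem_source.2 ⟨he n (Ioo_subset_Icc_self hn), hn⟩
      · ext ⟨u, b⟩
        change (b, u) ∈ e₁.target ↔ _
        rw [Bundle.Trivialization.mem_target]
        exact ⟨fun h => ⟨mem_univ _, h⟩, fun h => h.2⟩
      · intro x hx
        exact e₁.coe_fst hx
      · intro b hb
        exact hmon n b hb.2)
  have hbij : Function.Bijective Ψ := by
    constructor
    · intro q q' hqq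
      have hπq : π q = π q' := by rw [← hΨ2, ← hΨ2, hqq]
      obtain ⟨n, hn⟩ := hexn (π q)
      have hb := he n (Ioo_subset_Icc_self hn)
      have hq : (e n).toOpenPartialHomeomorph.symm (π q, (e n q).2) = q :=
        (e n).symm_apply_mk_proj ((e n).mem_source.2 hb)
      have hq' : (e n).toOpenPartialHomeomorph.symm (π q, (e n q').2) = q' := by
        rw [hπq]
        exact (e n).symm_apply_mk_proj ((e n).mem_source.2 (hπq ▸ hb))
      have hs := hΨm (π q) (fun u => (e n).toOpenPartialHomeomorph.symm (π q, u))
        (fun u => (e n).proj_symm_apply' hb) (hmon n _ hn).1 (hmon n _ hn).2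
      have := hs.injective (a₁ := (e n q).2) (a₂ := (e n q').2) (by
        simp only [hq, hq', hqq])
      rw [← hq, ← hq', this]
    · rintro ⟨x, b⟩
      obtain ⟨n, hn⟩ := hexn b
      have hn' := Ioo_subset_Icc_self hn
      have hb := he n hn'
      obtain ⟨u, hu⟩ := hΨs b (fun u => (e n).toOpenPartialHomeomorph.symm (b, u))
        ((e n).toOpenPartialHomeomorph.continuousOn_symm.comp_continuous (by fun_prop)
          fun u => (e n).mem_target.2 hb) (fun u => (e n).proj_symm_apply' hb) (by
          intro j
          simp only [hfs n j b _ hn']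
          by_cases hj : b ∈ Icc (-((j : ℝ) + 1)) ((j : ℝ) + 1)
          · have ht := tendsto_of_strictMono_surjective (hmono n j b hn' hj)
              ((e n).coordChangeHomeomorph (e j) hb (he j hj)).surjective
            simpa using (Real.tendsto_sigmoid_atBot.comp ht.2).const_mul (χ j b)
          · simp [hχ0 j b hj]) (by
          intro j
          simp only [hfs n j b _ hn']
          by_cases hj : b ∈ Icc (-((j : ℝ) + 1)) ((j : ℝ) + 1)
          · have ht := tendsto_of_strictMono_surjective (hmono n j b hn' hj)
              ((e n).coordChangeHomeomorph (e j) hb (he j hj)).surjective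
            simpa using (Real.tendsto_sigmoid_atTop.comp ht.1).const_mul (χ j b)
          · simp [hχ0 j b hj]) x
      exact ⟨_, hu⟩
  exact ⟨(Equiv.ofBijective Ψ hbij).toHomeomorphOfContinuousOpen hΨc hΨo, hΨ2⟩

end CoordChange

/-! ### Pulling leaves back along a curve in the leaf space -/

section Pullback

variable {X : Type*} [TopologicalSpace X] {Δ : Setoid X}

/-- The pull-back of the family of leaves along a curve in the leaf space. -/
abbrev LeafPullback (Δ : Setoid X) (γ : ℝ → Quotient Δ) : Type _ :=
  {q : ℝ × X // γ q.1 = Quotient.mk Δ q.2}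

/-- Over the parameters whose leaves lie in one strip, the first strip coordinate is the fibre
coordinate. Passing to the pull-back keeps apart the copies of a leaf that a closed curve visits
twice. -/
theorem LocallyStrip.exists_trivialization (h : LocallyStrip Δ) {γ : ℝ → Quotient Δ}
    (hγ : Continuous γ) (b : ℝ) :
    ∃ e : Bundle.Trivialization ℝ (fun q : LeafPullback Δ γ => q.1.1), b ∈ e.baseSet := by
  obtain ⟨x, hx⟩ := Quotient.exists_rep (γ b)
  obtain ⟨J, e, he, ⟨u₀, t₀⟩, rfl⟩ := h x
  have : Nonempty J := ⟨t₀⟩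
  set eo := he.isOpenEmbedding.toOpenPartialHomeomorph e
  set bo := he.isOpenEmbedding_base.toOpenPartialHomeomorph (IsStrip.base Δ e)
  have hbV : γ b ∈ range (IsStrip.base Δ e) := ⟨t₀, by rw [← hx]; exact (he.mk_apply u₀ t₀).symm⟩
  set V : Set ℝ := γ ⁻¹' range (IsStrip.base Δ e) with hV
  have hVo : IsOpen V := he.isOpenEmbedding_base.isOpen_range.preimage hγ
  have hbo : ∀ s ∈ V, IsStrip.base Δ e (bo.symm (γ s)) = γ s := fun s hs =>
    bo.right_inv (by
      have hs : γ s ∈ range (IsStrip.base Δ e) := hs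
      simpa [bo] using hs)
  have hmem : ∀ s ∈ V, ∀ u, γ s = Quotient.mk Δ (e (u, bo.symm (γ s))) := fun s hs u => by
    rw [he.mk_apply, hbo s hs]
  have hsrc : ∀ q : LeafPullback Δ γ, q.1.1 ∈ V → q.1.2 ∈ range e := fun q hq => by
    rw [← he.preimage_range_base, mem_preimage, ← q.2]
    exact hq
  have heo : ∀ y ∈ range e, e (eo.symm y) = y := fun y hy => eo.right_inv (by simpa [eo] using hy)
  have heo' : ∀ y, eo.symm (e y) = y := fun y => eo.left_inv (by simp [eo])
  have hrep : ∀ s, γ s = Quotient.mk Δ (Quotient.out (γ s)) := fun s => (Quotient.out_eq _).symm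
  classical
  set inv : ℝ × ℝ → LeafPullback Δ γ := fun p => if hp : p.1 ∈ V then
    ⟨(p.1, e (p.2, bo.symm (γ p.1))), hmem p.1 hp p.2⟩ else ⟨(p.1, Quotient.out (γ p.1)), hrep _⟩
    with hinv
  refine ⟨{ toFun := fun q => (q.1.1, (eo.symm q.1.2).1)
            invFun := inv
            source := (fun q => q.1.1) ⁻¹' V
            target := V ×ˢ univ
            map_source' := fun q hq => ⟨hq, mem_univ _⟩
            map_target' := ?_
            left_inv' := ?_
            right_inv' := ?_
            open_source := hVo.preimage (by fun_prop)
            open_target := hVo.prod isOpen_univ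
            continuousOn_toFun := ?_
            continuousOn_invFun := ?_
            baseSet := V
            open_baseSet := hVo
            source_eq := rfl
            target_eq := rfl
            proj_toFun := fun q hq => rfl }, hbV⟩
  · rintro ⟨s, u⟩ ⟨hs, -⟩
    simp only [hinv, dif_pos hs]
    exact hs
  · intro q hq
    have hq : q.1.1 ∈ V := hq
    simp only [hinv, dif_pos hq]
    refine Subtype.ext (Prod.ext rfl ?_)
    have h1 := heo _ (hsrc q hq)
    have h2 : bo.symm (γ q.1.1) = (eo.symm q.1.2).2 := by
      apply he.base_injective
      rw [hbo _ hq, q.2]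
      nth_rewrite 1 [← h1]
      exact he.mk_apply _ _
    change e (_, bo.symm (γ q.1.1)) = _
    rw [h2]
    exact h1
  · rintro ⟨s, u⟩ ⟨hs, -⟩
    have hs : s ∈ V := hs
    simp only [hinv, dif_pos hs, heo']
  · refine ContinuousOn.prodMk (by fun_prop) ?_
    refine continuous_fst.comp_continuousOn (eo.continuousOn_symm.comp (by fun_prop) ?_)
    intro q hq
    have := hsrc q hq
    simpa [eo] using this
  · refine IsInducing.subtypeVal.continuousOn_iff.2 ?_
    have : ContinuousOn (fun p : ℝ × ℝ => (p.1, e (p.2, bo.symm (γ p.1)))) (V ×ˢ univ) := by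
      refine ContinuousOn.prodMk (by fun_prop) ?_
      refine he.isOpenEmbedding.continuous.comp_continuousOn (ContinuousOn.prodMk (by fun_prop) ?_)
      refine bo.continuousOn_symm.comp (by fun_prop) ?_
      rintro ⟨s, u⟩ ⟨hs, -⟩
      have hs : γ s ∈ range (IsStrip.base Δ e) := hs
      simpa [bo] using hs
    refine this.congr ?_
    rintro ⟨s, u⟩ ⟨hs, -⟩
    have hs : s ∈ V := hs
    simp only [Function.comp, hinv, dif_pos hs]

theorem LocallyStrip.exists_pullback_homeomorph (h : LocallyStrip Δ) {γ : ℝ → Quotient Δ}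
    (hγ : Continuous γ) : ∃ Θ : (ℝ × ℝ) ≃ₜ LeafPullback Δ γ, ∀ q, (Θ q).1.1 = q.2 := by
  obtain ⟨Ψ, hΨ⟩ := exists_homeomorph_of_locally_trivial
    (π := fun q : LeafPullback Δ γ => q.1.1) (by fun_prop) (h.exists_trivialization hγ)
  exact ⟨Ψ.symm, fun q => by rw [← hΨ, Ψ.apply_symm_apply]⟩

/-- When `γ` is an open embedding, a point of `X` determines its parameter, and the projection of
the pull-back to `X` is itself an open embedding. -/
theorem LocallyStrip.exists_strip_of_isOpenEmbedding (h : LocallyStrip Δ) {γ : ℝ → Quotient Δ}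
    (hγ : IsOpenEmbedding γ) : ∃ e : ℝ × ℝ → X, IsStrip Δ e ∧
      range e = Quotient.mk Δ ⁻¹' range γ := by
  obtain ⟨Θ, hΘ⟩ := h.exists_pullback_homeomorph hγ.continuous
  have hmk : ∀ q, γ q.2 = Quotient.mk Δ (Θ q).1.2 := fun q => by rw [← (Θ q).2, hΘ]
  have hsurj : ∀ s x, γ s = Quotient.mk Δ x → ∃ u, (Θ (u, s)).1.2 = x := by
    intro s x hx
    obtain ⟨⟨u, s'⟩, hus⟩ := Θ.surjective ⟨(s, x), hx⟩
    have h1 : s' = s := by simpa [hus] using (hΘ (u, s')).symm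
    subst h1
    exact ⟨u, by rw [hus]⟩
  have hopen : IsOpenEmbedding fun q : LeafPullback Δ γ => q.1.2 := by
    refine .of_continuous_injective_isOpenMap (by fun_prop) ?_ ?_
    · intro q q' hqq
      refine Subtype.ext (Prod.ext (hγ.injective ?_) hqq)
      rw [q.2, q'.2]
      exact congrArg _ hqq
    · rw [isOpenMap_iff_nhds_le]
      rintro ⟨⟨s, x⟩, hsx⟩ W hW
      rw [mem_map, nhds_subtype_eq_comap, mem_comap] at hW
      obtain ⟨W', hW', hsub⟩ := hW
      obtain ⟨A, hA, B, hB, hAB⟩ := mem_nhds_prod_iff.1 hW'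
      have h1 : Quotient.mk Δ ⁻¹' (γ '' A) ∈ 𝓝 x := by
        refine (continuous_quotient_mk' : Continuous (Quotient.mk Δ)).continuousAt ?_
        have := hγ.isOpenMap.image_mem_nhds hA
        simp only at hsx
        rwa [hsx] at this
      filter_upwards [hB, h1]
      rintro z hzB ⟨s', hs', hz⟩
      exact @hsub ⟨(s', z), hz⟩ (hAB ⟨hs', hzB⟩)
  refine ⟨fun q => (Θ q).1.2, ⟨hopen.comp Θ.isOpenEmbedding, fun t => ?_⟩, ?_⟩
  · convert preimage_mk_mem_classes (Δ := Δ) (Θ (0, t)).1.2 using 1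
    ext x
    constructor
    · rintro ⟨u, rfl⟩
      simp only [mem_preimage, mem_singleton_iff]
      rw [← hmk, ← hmk]
    · intro hx
      have hx : Quotient.mk Δ x = _ := hx
      rw [← hmk] at hx
      exact hsurj t x hx.symm
  · ext x
    constructor
    · rintro ⟨q, rfl⟩
      exact ⟨q.2, hmk q⟩
    · rintro ⟨s, hs⟩
      obtain ⟨u, hu⟩ := hsurj s x hs
      exact ⟨_, hu⟩

end Pullback

/-! ### Foliated homeomorphisms and strips -/

section Foliated

variable {X : Type*} [TopologicalSpace X] {Δ : Setoid X}

theorem isFoliated_of_iff {M : Type*} [TopologicalSpace M] {Γ : Setoid M} {A : Set X}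
    {h : M ≃ₜ A} (hA : ∀ x ∈ A, ∀ y, Quotient.mk Δ y = Quotient.mk Δ x → y ∈ A)
    (hiff : ∀ a b, Γ a b ↔ Quotient.mk Δ (h a : X) = Quotient.mk Δ (h b : X)) :
    IsFoliated Γ Δ h := by
  rintro _ ⟨a, rfl⟩
  convert preimage_mk_mem_classes (Δ := Δ) (h a : X) using 1
  ext x
  constructor
  · rintro ⟨b, hb, rfl⟩
    exact (hiff b a).1 hb
  · intro hx
    have hx : Quotient.mk Δ x = Quotient.mk Δ (h a : X) := hx
    refine ⟨h.symm ⟨x, hA _ (h a).2 x hx⟩, ?_, by simp⟩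
    refine (hiff _ a).2 ?_
    simpa using hx

/-- The subset `ℝ × J` of the plane as a product. -/
def stripHomeomorph (J : Set ℝ) : (univ ×ˢ J : Set (ℝ × ℝ)) ≃ₜ ℝ × J where
  toFun p := (p.1.1, ⟨p.1.2, p.2.2⟩)
  invFun q := ⟨(q.1, q.2), ⟨mem_univ _, q.2.2⟩⟩
  left_inv _ := rfl
  right_inv _ := rfl
  continuous_toFun := by fun_prop
  continuous_invFun := by fun_prop

theorem canonicalFoliation_prod_iff {J : Set ℝ} (p q : (univ ×ˢ J : Set (ℝ × ℝ))) :
    canonicalFoliation (univ ×ˢ J) p q ↔ p.1.2 = q.1.2 :=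
  ⟨fun h => h.1, fun h => ⟨h, fun _ _ => ⟨mem_univ _, p.2.2⟩⟩⟩

theorem IsStrip.foliatedHomeomorphic {e : ℝ × Ioo (-1 : ℝ) 1 → X} (he : IsStrip Δ e) :
    FoliatedHomeomorphic (canonicalFoliation openStrip) Δ (range e) := by
  refine ⟨(stripHomeomorph _).trans he.isOpenEmbedding.isEmbedding.toHomeomorph,
    isFoliated_of_iff ?_ fun p q => ?_⟩
  · rintro _ ⟨⟨u, t⟩, rfl⟩ y hy
    rw [he.mk_apply] at hy
    obtain ⟨v, rfl⟩ := he.mk_eq_base hy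
    exact ⟨_, rfl⟩
  · refine (canonicalFoliation_prod_iff (J := Ioo (-1) 1) p q).trans ?_
    change _ ↔ Quotient.mk Δ (e (p.1.1, ⟨p.1.2, p.2.2⟩)) = Quotient.mk Δ (e (q.1.1, ⟨q.1.2, q.2.2⟩))
    rw [he.mk_apply, he.mk_apply, he.base_injective.eq_iff,
      Subtype.mk.injEq]

theorem IsFoliated.isStrip {Q : Set X} (hQ : IsOpen Q) {φ : openStrip ≃ₜ Q}
    (hφ : IsFoliated (canonicalFoliation openStrip) Δ φ) :
    IsStrip Δ fun q : ℝ × Ioo (-1 : ℝ) 1 => (φ ((stripHomeomorph _).symm q) : X) := by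
  refine ⟨hQ.isOpenEmbedding_subtypeVal.comp
    (φ.isOpenEmbedding.comp (stripHomeomorph _).symm.isOpenEmbedding), fun t => ?_⟩
  convert hφ _ ((canonicalFoliation openStrip).mem_classes ((stripHomeomorph _).symm (0, t)))
    using 1
  ext x
  constructor
  · rintro ⟨u, rfl⟩
    exact ⟨(stripHomeomorph _).symm (u, t), (canonicalFoliation_prod_iff _ _).2 rfl, rfl⟩
  · rintro ⟨p, hp, rfl⟩
    refine ⟨p.1.1, ?_⟩
    have hp : p.1.2 = t := ((canonicalFoliation_prod_iff _ _).1 hp)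
    refine congrArg (fun p => (φ p : X)) (Subtype.ext (Prod.ext rfl hp.symm))

end Foliated

/-! ### Cylinders and Möbius bands -/

section Glue

variable {X : Type*} [TopologicalSpace X] {Δ : Setoid X}

/-- The straight line isotopy from the identity to an increasing homeomorphism. -/
theorem exists_isotopy_homeomorph {g : ℝ → ℝ} (hg : StrictMono g) (hs : Function.Surjective g) :
    ∃ Λ : (ℝ × Icc (-1 : ℝ) 1) ≃ₜ ℝ × Icc (-1 : ℝ) 1, ∀ q,
      Λ q = ((1 - q.2) / 2 * q.1 + (1 + q.2) / 2 * g q.1, q.2) := by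
  have hgc : Continuous g := (hg.orderIsoOfSurjective g hs).continuous
  set H : ℝ × Icc (-1 : ℝ) 1 → ℝ := fun q => (1 - q.2) / 2 * q.1 + (1 + q.2) / 2 * g q.1 with hH
  have hHc : Continuous H := by fun_prop
  have hm : ∀ t, StrictMono fun x => H (x, t) := by
    rintro ⟨t, ht1, ht2⟩ x y hxy
    have hgxy := hg hxy
    have h1 : 0 ≤ (1 - t) / 2 := by linarith
    have h2 : 0 ≤ (1 + t) / 2 := by linarith
    simp only [hH]
    rcases h1.eq_or_lt with h | h
    · have : (1 + t) / 2 = 1 := by linarith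
      rw [← h, this]
      linarith
    · nlinarith [mul_lt_mul_of_pos_left hxy h, mul_le_mul_of_nonneg_left hgxy.le h2]
  have hbij : Function.Bijective fun q : ℝ × Icc (-1 : ℝ) 1 => (H q, q.2) := by
    constructor
    · rintro ⟨x, t⟩ ⟨y, s⟩ h
      simp only [Prod.mk.injEq] at h
      obtain ⟨h, rfl⟩ := h
      rw [(hm t).injective h]
    · rintro ⟨y, t⟩
      obtain ⟨z, hz⟩ := hs y
      have h1 : 0 ≤ (1 - (t : ℝ)) / 2 := by linarith [t.2.2]
      have h2 : 0 ≤ (1 + (t : ℝ)) / 2 := by linarith [t.2.1]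
      -- With `g z = y`, both the identity and `g` are at most `y` at `min y z` and at least `y` at
      -- `max y z`, hence so are their convex combinations.
      obtain ⟨x, hx⟩ := mem_range_of_exists_le_of_exists_ge (c := y) (f := fun x => H (x, t))
        (by fun_prop) ⟨min y z, by
          have h3 := mul_le_mul_of_nonneg_left (min_le_left y z) h1
          have h4 := mul_le_mul_of_nonneg_left (hg.monotone (min_le_right y z)) h2
          simp only [hH]
          rw [hz] at h4
          linarith⟩ ⟨max y z, by
          have h3 := mul_le_mul_of_nonneg_left (le_max_left y z) h1
          have h4 := mul_le_mul_of_nonneg_left (hg.monotone (le_max_right y z)) h2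
          simp only [hH]
          rw [hz] at h4
          linarith⟩
      exact ⟨(x, t), Prod.ext hx rfl⟩
  exact ⟨(Equiv.ofBijective _ hbij).toHomeomorphOfContinuousOpen (hHc.prodMk continuous_snd)
    (isOpenMap_level hHc hm), fun q => rfl⟩

/-- `P` identifies points only on the two end lines, and there exactly by `ρ`. It therefore descends
to a continuous bijection from the glued space, and `hcl` makes this bijection closed. -/
theorem foliatedHomeomorphic_glued {Q : Set X} {ρ : ℝ → ℝ} {γ : ℝ → Quotient Δ}
    {P : ℝ × Icc (-1 : ℝ) 1 → X} (hPc : Continuous P)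
    (hPγ : ∀ q, Quotient.mk Δ (P q) = γ q.2) (hPinj : ∀ t, Function.Injective fun x => P (x, t))
    (hPsurj : ∀ (t : Icc (-1 : ℝ) 1) x, Quotient.mk Δ x = γ t → ∃ u, P (u, t) = x)
    (hγ1 : γ (-1) = γ 1) (hγi : InjOn γ (Ico (-1) 1))
    (hγQ : Quotient.mk Δ ⁻¹' (γ '' Icc (-1) 1) = Q)
    (hcl : ∀ C : Set (ℝ × Icc (-1 : ℝ) 1), IsClosed C → IsClosed ((↑) ⁻¹' (P '' C) : Set Q))
    (hglue : ∀ x, P (x, ⟨-1, by simp⟩) = P (ρ x, ⟨1, by simp⟩)) :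
    FoliatedHomeomorphic (gluedFoliation ρ) Δ Q := by
  have hQ : ∀ q, P q ∈ Q := fun q => by
    rw [← hγQ, mem_preimage, hPγ]
    exact ⟨_, q.2.2, rfl⟩
  have hends : ∀ s t : Icc (-1 : ℝ) 1, γ s = γ t → s = t ∨ (s.1 = -1 ∧ t.1 = 1) ∨
      (s.1 = 1 ∧ t.1 = -1) := by
    rintro ⟨s, hs⟩ ⟨t, ht⟩ hst
    simp only at hst ⊢
    rcases hs.2.eq_or_lt with rfl | hs'
    · rcases ht.2.eq_or_lt with rfl | ht'
      · exact Or.inl rfl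
      · exact Or.inr (Or.inr ⟨rfl, (hγi ⟨le_rfl, by norm_num⟩ ⟨ht.1, ht'⟩ (hγ1.trans hst)).symm⟩)
    · rcases ht.2.eq_or_lt with rfl | ht'
      · exact Or.inr (Or.inl ⟨hγi ⟨hs.1, hs'⟩ ⟨le_rfl, by norm_num⟩ (hst.trans hγ1.symm), rfl⟩)
      · exact Or.inl (Subtype.ext (hγi ⟨hs.1, hs'⟩ ⟨ht.1, ht'⟩ hst))
  set η : closedStrip ≃ₜ ℝ × Icc (-1 : ℝ) 1 := stripHomeomorph _
  set F : closedStrip → Q := fun p => ⟨P (η p), hQ _⟩ with hF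
  have hFc : Continuous F := (hPc.comp η.continuous).subtype_mk _
  have hηm : ∀ p : closedStrip, p.1.2 = -1 → η p = (p.1.1, ⟨-1, by simp⟩) := fun p hp =>
    Prod.ext rfl (Subtype.ext hp)
  have hη1 : ∀ p : closedStrip, p.1.2 = 1 → η p = (p.1.1, ⟨1, by simp⟩) := fun p hp =>
    Prod.ext rfl (Subtype.ext hp)
  have hFg : ∀ p q, glue ρ p q → F p = F q := by
    rintro p q ⟨hp, hq, hpq⟩
    refine Subtype.ext ?_
    simp only [hF]
    rw [hηm p hp, hη1 q hq, hpq]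
    exact hglue _
  have hFinj : ∀ p q, F p = F q → p = q ∨ glue ρ p q ∨ glue ρ q p := by
    intro p q hpq
    have hpq : P (η p) = P (η q) := congrArg Subtype.val hpq
    have h1 : γ (η p).2 = γ (η q).2 := by rw [← hPγ, ← hPγ, hpq]
    rcases hends _ _ h1 with h | ⟨h, h'⟩ | ⟨h, h'⟩
    · left
      apply η.injective
      refine Prod.ext (hPinj (η p).2 ?_) h
      simp only
      rw [Prod.mk.eta, hpq, h]
    · right; left
      refine ⟨h, h', ?_⟩
      rw [hηm p h, hη1 q h', hglue] at hpq
      exact (hPinj _ hpq).symm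
    · right; right
      refine ⟨h', h, ?_⟩
      rw [hηm q h', hη1 p h, hglue] at hpq
      exact hPinj _ hpq
  set G : Glued ρ → Q := Quot.lift F hFg with hG
  have hGc : Continuous G := continuous_quot_lift hFg hFc
  have hbij : Function.Bijective G := by
    constructor
    · rintro ⟨p⟩ ⟨q⟩ hpq
      rcases hFinj p q hpq with rfl | h | h
      · rfl
      · exact Quot.sound h
      · exact (Quot.sound h).symm
    · rintro ⟨x, hx⟩
      obtain ⟨t, ht, hxt⟩ := hγQ.symm ▸ hx
      obtain ⟨u, hu⟩ := hPsurj ⟨t, ht⟩ x hxt.symm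
      exact ⟨Quot.mk _ (η.symm (u, ⟨t, ht⟩)), Subtype.ext (by simpa [hG, hF] using hu)⟩
  have hGcl : IsClosedMap G := by
    intro C hC
    have hC' : IsClosed (Quot.mk (glue ρ) ⁻¹' C) := hC.preimage continuous_quot_mk
    have h1 : IsClosed (η '' (Quot.mk (glue ρ) ⁻¹' C)) := η.isClosedMap _ hC'
    convert hcl _ h1 using 1
    ext x
    constructor
    · rintro ⟨⟨p⟩, hp, rfl⟩
      exact ⟨η p, ⟨p, hp, rfl⟩, rfl⟩
    · rintro ⟨_, ⟨p, hp, rfl⟩, hpx⟩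
      exact ⟨Quot.mk _ p, hp, Subtype.ext hpx⟩
  set h : Glued ρ ≃ₜ Q := (Equiv.ofBijective G hbij).toHomeomorphOfContinuousClosed hGc hGcl
  have hh : ∀ p, (h (Quot.mk _ p) : X) = P (η p) := fun p => rfl
  refine ⟨h, isFoliated_of_iff ?_ fun a b => ⟨fun hab => ?_, fun hab => ?_⟩⟩
  · intro x hx y hxy
    rw [← hγQ, mem_preimage] at hx ⊢
    rwa [hxy]
  -- `Setoid.map` is the equivalence generated by the image relation, so only generators have to be
  -- checked.
  · replace hab : Relation.EqvGen (Relation.Map (canonicalFoliation closedStrip)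
      (Quot.mk (glue ρ)) (Quot.mk (glue ρ))) a b := hab
    induction hab with
    | rel a b hab =>
      obtain ⟨p, q, hpq, hp, hq⟩ := hab
      rw [← hp, ← hq, hh, hh, hPγ, hPγ]
      exact congrArg γ hpq.1
    | refl a => rfl
    | symm a b _ ih => exact ih.symm
    | trans a b c _ _ ih1 ih2 => exact ih1.trans ih2
  · induction a using Quot.ind with | mk p => ?_
    induction b using Quot.ind with | mk q => ?_
    rw [hh, hh, hPγ, hPγ] at hab
    have hline : ∀ p q : closedStrip, p.1.2 = q.1.2 →
        gluedFoliation ρ (Quot.mk _ p) (Quot.mk _ q) := fun p q hpq =>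
      Relation.EqvGen.rel _ _ ⟨p, q, (canonicalFoliation_prod_iff (J := Icc (-1) 1) p q).2 hpq,
        rfl, rfl⟩
    have hcross : ∀ p q : closedStrip, p.1.2 = -1 → q.1.2 = 1 →
        gluedFoliation ρ (Quot.mk _ p) (Quot.mk _ q) := fun p q hp hq => by
      have hsound : (Quot.mk (glue ρ) p : Glued ρ) =
          Quot.mk (glue ρ) (η.symm (ρ p.1.1, ⟨1, by simp⟩)) := Quot.sound ⟨hp, rfl, rfl⟩
      rw [hsound]
      exact hline _ _ hq.symm
    rcases hends _ _ hab with h | ⟨h, h'⟩ | ⟨h, h'⟩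
    · exact hline p q (congrArg Subtype.val h)
    · exact hcross p q h h'
    · exact (gluedFoliation ρ).symm (hcross q p h' h)

/-- The pulled-back strip over `[-1, 1]` covers `Q`, and its end lines are two copies of one leaf.
The direction of the comparison map between these copies decides between the two models. -/
theorem LocallyStrip.cylinder_or_mobius (hL : LocallyStrip Δ) {Q : Set X} {γ : ℝ → Quotient Δ}
    (hγ : Continuous γ) (hγ1 : γ (-1) = γ 1) (hγi : InjOn γ (Ico (-1) 1))
    (hγQ : Quotient.mk Δ ⁻¹' (γ '' Icc (-1) 1) = Q) (hT2 : T2Space (γ '' Icc (-1) 1)) :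
    FoliatedHomeomorphic cylinderFoliation Δ Q ∨ FoliatedHomeomorphic mobiusFoliation Δ Q := by
  obtain ⟨Θ, hΘ⟩ := hL.exists_pullback_homeomorph hγ
  set e : ℝ × ℝ → X := fun q => (Θ q).1.2 with he
  have hec : Continuous e := by fun_prop
  have hmk : ∀ q, Quotient.mk Δ (e q) = γ q.2 := fun q => by rw [← hΘ q, (Θ q).2]
  have hsurj : ∀ s x, Quotient.mk Δ x = γ s → ∃ u, e (u, s) = x := by
    intro s x hx
    obtain ⟨⟨u, s'⟩, hus⟩ := Θ.surjective ⟨(s, x), hx.symm⟩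
    have h1 : s' = s := by simpa [hus] using (hΘ (u, s')).symm
    subst h1
    exact ⟨u, by simp only [he, hus]⟩
  have hinj : ∀ s, Function.Injective fun u => e (u, s) := by
    intro s u v huv
    have : Θ (u, s) = Θ (v, s) := Subtype.ext (Prod.ext ((hΘ (u, s)).trans (hΘ (v, s)).symm) huv)
    exact congrArg Prod.fst (Θ.injective this)
  have hmem : ∀ x, γ 1 = Quotient.mk Δ (e (x, -1)) := fun x => by rw [hmk, hγ1]
  -- The monodromy: the coordinate over `1` of the point with coordinate `x` over `-1`.
  set f : ℝ → ℝ := fun x => (Θ.symm ⟨(1, e (x, -1)), hmem x⟩).1 with hf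
  have hfc : Continuous f := by
    refine continuous_fst.comp (Θ.symm.continuous.comp (Continuous.subtype_mk ?_ _))
    fun_prop
  have hfe : ∀ x, e (f x, 1) = e (x, -1) := fun x => by
    have h1 : Θ (Θ.symm ⟨(1, e (x, -1)), hmem x⟩) = ⟨(1, e (x, -1)), hmem x⟩ :=
      Θ.apply_symm_apply _
    have h2 : (Θ.symm ⟨(1, e (x, -1)), hmem x⟩).2 = 1 := by rw [← hΘ, h1]
    have h3 : Θ.symm ⟨(1, e (x, -1)), hmem x⟩ = (f x, 1) := Prod.ext rfl h2
    rw [h3] at h1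
    simp only [he]
    rw [h1]
  have hfi : Function.Injective f := fun x y hxy => hinj (-1) (by
    simp only
    rw [← hfe x, ← hfe y, hxy])
  have hfs : Function.Surjective f := fun y => by
    obtain ⟨x, hx⟩ := hsurj (-1) (e (y, 1)) (by rw [hmk, hγ1])
    exact ⟨x, hinj 1 (by simp only; rw [hfe, hx])⟩
  -- Here `ρ` is the identity or the reflection. The isotopy from the identity at `-1` to `f ∘ ρ` at
  -- `1` replaces the gluing map `f` by `ρ`, since `ρ` is an involution.
  have key : ∀ ρ : ℝ → ℝ, (∀ x, ρ (ρ x) = x) → StrictMono (fun x => f (ρ x)) →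
      FoliatedHomeomorphic (gluedFoliation ρ) Δ Q := by
    intro ρ hρ hm
    obtain ⟨Λ, hΛ⟩ := exists_isotopy_homeomorph hm
      (hfs.comp (fun x => ⟨ρ x, hρ x⟩ : Function.Surjective ρ))
    have hΛ2 : ∀ q, (Λ q).2 = q.2 := fun q => by rw [hΛ]
    set ι : ℝ × Icc (-1 : ℝ) 1 → ℝ × ℝ := Prod.map id Subtype.val
    have hι : IsEmbedding ι := IsEmbedding.id.prodMap IsEmbedding.subtypeVal
    have hmemQ : ∀ q, e (ι (Λ q)) ∈ Q := fun q => by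
      rw [← hγQ, mem_preimage, hmk]
      exact ⟨_, (Λ q).2.2, rfl⟩
    refine foliatedHomeomorphic_glued (P := fun q => e (ι (Λ q)))
      (hec.comp (hι.continuous.comp Λ.continuous)) (fun q => ?_) (fun t x y hxy => ?_)
      (fun t x hx => ?_) hγ1 hγi hγQ (fun C hC => ?_) fun x => ?_
    · rw [hmk]
      change γ (Λ q).2 = _
      rw [hΛ2]
    · have h1 : Λ (x, t) = Λ (y, t) := by
        refine Prod.ext (hinj t ?_) ((hΛ2 (x, t)).trans (hΛ2 (y, t)).symm)
        have h3 : ∀ z, ι (Λ (z, t)) = ((Λ (z, t)).1, (t : ℝ)) := fun z =>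
          Prod.ext rfl (congrArg Subtype.val (hΛ2 (z, t)))
        simp only [h3] at hxy
        exact hxy
      exact congrArg Prod.fst (Λ.injective h1)
    · obtain ⟨u, hu⟩ := hsurj t x hx
      refine ⟨(Λ.symm (u, t)).1, ?_⟩
      have h1 : ((Λ.symm (u, t)).1, t) = Λ.symm (u, t) := by
        refine Prod.ext rfl ?_
        have h2 := hΛ2 (Λ.symm (u, t))
        rwa [Λ.apply_symm_apply] at h2
      rw [h1, Λ.apply_symm_apply]
      exact hu
    -- The strip is embedded in `[-1, 1] × Q` as the set where `γ s` is the leaf of `x`. This set is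
    -- closed because the leaves in question form a Hausdorff space, and the projection along the
    -- compact factor is a closed map.
    · set K : ℝ × Icc (-1 : ℝ) 1 → Icc (-1 : ℝ) 1 × Q := fun q => (q.2, ⟨e (ι q), by
        rw [← hγQ, mem_preimage, hmk]
        exact ⟨_, q.2.2, rfl⟩⟩) with hK
      have hKc : Continuous K :=
        continuous_snd.prodMk ((hec.comp hι.continuous).subtype_mk _)
      have hKe : IsEmbedding K := by
        refine IsEmbedding.of_comp hKc
          (g := fun p : Icc (-1 : ℝ) 1 × Q => ((p.1 : ℝ), (p.2 : X))) (by fun_prop) ?_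
        have h1 : IsEmbedding fun q => (Θ (ι q)).1 :=
          IsEmbedding.subtypeVal.comp (Θ.isEmbedding.comp hι)
        convert h1 using 1
        funext q
        exact Prod.ext (hΘ (ι q)).symm rfl
      have hQγ : ∀ x ∈ Q, Quotient.mk Δ x ∈ γ '' Icc (-1) 1 := fun x hx => by
        rwa [← hγQ] at hx
      have hKr : IsClosed (range K) := by
        set a : Icc (-1 : ℝ) 1 × Q → γ '' Icc (-1) 1 := fun p => ⟨γ p.1, p.1, p.1.2, rfl⟩
        set b : Icc (-1 : ℝ) 1 × Q → γ '' Icc (-1) 1 := fun p =>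
          ⟨Quotient.mk Δ (p.2 : X), hQγ _ p.2.2⟩
        have ha : Continuous a := Continuous.subtype_mk (by fun_prop) _
        have hb : Continuous b := Continuous.subtype_mk
          (continuous_quotient_mk'.comp (by fun_prop)) _
        convert isClosed_eq ha hb using 1
        ext ⟨s, x⟩
        constructor
        · rintro ⟨q, hq⟩
          rw [← hq]
          exact Subtype.ext (hmk (ι q)).symm
        · intro hx
          have hx : γ s = Quotient.mk Δ (x : X) := congrArg Subtype.val hx
          obtain ⟨u, hu⟩ := hsurj s x hx.symm
          exact ⟨(u, s), Prod.ext rfl (Subtype.ext hu)⟩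
      have hcl : IsClosed (K '' (Λ '' C)) :=
        (IsClosedEmbedding.mk hKe hKr).isClosedMap _ (Λ.isClosedMap _ hC)
      convert isClosedMap_snd_of_compactSpace _ hcl using 1
      ext x
      constructor
      · rintro ⟨q, hq, hqx⟩
        exact ⟨_, ⟨_, ⟨q, hq, rfl⟩, rfl⟩, Subtype.ext hqx⟩
      · rintro ⟨_, ⟨_, ⟨q, hq, rfl⟩, rfl⟩, rfl⟩
        exact ⟨q, hq, rfl⟩
    · have h1 : ι (Λ (x, ⟨-1, by simp⟩)) = (x, -1) := by
        rw [hΛ]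
        refine Prod.ext ?_ rfl
        simp [ι]
      have h2 : ι (Λ (ρ x, ⟨1, by simp⟩)) = (f x, 1) := by
        rw [hΛ]
        refine Prod.ext ?_ rfl
        simp [ι, hρ]
      simp only [h1, h2, hfe]
  rcases hfc.strictMono_of_inj hfi with hm | hm
  · exact Or.inl (key (fun t => t) (fun x => rfl) hm)
  · exact Or.inr (key (fun t => -t) (fun x => neg_neg x) fun x y hxy => hm (neg_lt_neg hxy))

end Glue

/-! ### Components of the set of regular leaves -/

section Components

variable {X : Type*} [TopologicalSpace X] {Δ : Setoid X}

theorem IsFoliated.mk_eq {M : Type*} [TopologicalSpace M] {Γ : Setoid M} {A : Set X} {h : M ≃ₜ A}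
    (hh : IsFoliated Γ Δ h) {a b : M} (hab : Γ a b) :
    Quotient.mk Δ (h a : X) = Quotient.mk Δ (h b : X) :=
  (mem_of_mem_classes (hh _ (Γ.mem_classes b)) ⟨b, Γ.refl b, rfl⟩).1 ⟨a, hab, rfl⟩

/-- The transversal `0 × [-1, 1]` meets every leaf of the glued strip. -/
theorem FoliatedHomeomorphic.isCompact_image_glued {ρ : ℝ → ℝ} {Q : Set X}
    (h : FoliatedHomeomorphic (gluedFoliation ρ) Δ Q) : IsCompact (Quotient.mk Δ '' Q) := by
  obtain ⟨h, hh⟩ := h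
  set c : Icc (-1 : ℝ) 1 → closedStrip := fun t => (stripHomeomorph _).symm (0, t)
  have hc : Continuous c := (stripHomeomorph _).symm.continuous.comp (by fun_prop)
  have hcc : Continuous fun t => Quotient.mk Δ (h (Quot.mk (glue ρ) (c t)) : X) :=
    continuous_quotient_mk'.comp
      (continuous_subtype_val.comp (h.continuous.comp (continuous_quot_mk.comp hc)))
  convert isCompact_range hcc using 1
  ext y
  constructor
  · rintro ⟨x, hx, rfl⟩
    obtain ⟨⟨p⟩, hp⟩ := h.surjective ⟨x, hx⟩
    refine ⟨⟨p.1.2, p.2.2⟩, ?_⟩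
    have h1 : gluedFoliation ρ (Quot.mk _ (c ⟨p.1.2, p.2.2⟩)) (Quot.mk _ p) :=
      Relation.EqvGen.rel _ _ ⟨c _, p, (canonicalFoliation_prod_iff (J := Icc (-1) 1) _ p).2 rfl,
        rfl, rfl⟩
    exact (hh.mk_eq h1).trans (congrArg (fun q : Q => Quotient.mk Δ (q : X)) hp)
  · rintro ⟨t, rfl⟩
    exact ⟨_, Subtype.coe_prop _, rfl⟩

variable [ChartedSpace (EuclideanHalfSpace 2) X]

/-- A component of the union of the regular leaves, described in the leaf space. -/
theorem IsClassF.exists_image_component (hΔ : IsClassF Δ)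
    (hfin : LocallyFinite (fun ω : specialLeaves Δ => (ω : Set X))) {Q : Set X}
    (hQ : IsComponentOf (⋃₀ specialLeaves Δ ∪ (𝓡∂ 2).boundary X)ᶜ Q) :
    ∃ Z : Set (Quotient Δ), Q = Quotient.mk Δ ⁻¹' Z ∧ IsOpen Z ∧ IsConnected Z ∧
      Z ⊆ regularLeaves Δ ∧ ∀ C ⊆ regularLeaves Δ, IsPreconnected (Quotient.mk Δ ⁻¹' C) →
        (C ∩ Z).Nonempty → C ⊆ Z := by
  rw [← hΔ.preimage_regularLeaves] at hQ
  set F := Quotient.mk Δ ⁻¹' regularLeaves Δ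
  obtain ⟨x₀, hx₀, rfl⟩ := hQ
  set Q := connectedComponentIn F x₀
  have hQF : Q ⊆ F := connectedComponentIn_subset _ _
  -- A connected union of regular leaves that meets the component is absorbed by it; with single
  -- leaves this gives saturation, with strips openness in the leaf space.
  have habs : ∀ C ⊆ regularLeaves Δ, IsPreconnected (Quotient.mk Δ ⁻¹' C) →
      ∀ x ∈ Q, Quotient.mk Δ x ∈ C → Quotient.mk Δ ⁻¹' C ⊆ Q := by
    intro C hC hCp x hxQ hxC
    have h1 := hCp.subset_connectedComponentIn (x := x) hxC (preimage_mono hC)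
    rwa [← connectedComponentIn_eq hxQ] at h1
  have hsat : ∀ x ∈ Q, Quotient.mk Δ ⁻¹' {Quotient.mk Δ x} ⊆ Q := fun x hx =>
    habs _ (singleton_subset_iff.2 (hQF hx)) (hΔ.locallyStrip.isPreconnected_leaf _) x hx rfl
  have hQZ : Q = Quotient.mk Δ ⁻¹' (Quotient.mk Δ '' Q) := by
    refine (subset_preimage_image _ _).antisymm ?_
    rintro y ⟨x, hx, hxy⟩
    exact hsat x hx hxy.symm
  refine ⟨Quotient.mk Δ '' Q, hQZ, ?_, ?_, ?_, ?_⟩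
  · rw [isOpen_iff_mem_nhds]
    rintro _ ⟨x, hx, rfl⟩
    obtain ⟨e, he, hxe, hsub⟩ := hΔ.exists_strip_regular (hQF hx)
      ((hΔ.isOpen_regularLeaves hfin).mem_nhds (hQF hx))
    refine mem_of_superset (he.isOpenEmbedding_base.isOpen_range.mem_nhds hxe) ?_
    intro z hz
    obtain ⟨w, rfl⟩ := Quotient.exists_rep z
    refine ⟨w, habs _ hsub ?_ x hx hxe hz, rfl⟩
    rw [← image_univ]
    exact he.isPreconnected_preimage isPreconnected_univ
  · exact (isConnected_connectedComponentIn_iff.2 hx₀).image _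
      continuous_quotient_mk'.continuousOn
  · rintro _ ⟨x, hx, rfl⟩
    exact hQF hx
  · rintro C hC hCp ⟨_, hxC, x, hx, rfl⟩ z hz
    obtain ⟨w, rfl⟩ := Quotient.exists_rep z
    exact ⟨w, habs C hC hCp x hx hxC hz, rfl⟩

/-- The classification of open connected families of regular leaves. -/
theorem IsClassF.foliatedHomeomorphic_component [SecondCountableTopology X] (hΔ : IsClassF Δ)
    {Z : Set (Quotient Δ)} (hZo : IsOpen Z) (hZc : IsConnected Z) (hZ : Z ⊆ regularLeaves Δ) :
    FoliatedHomeomorphic cylinderFoliation Δ (Quotient.mk Δ ⁻¹' Z) ∨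
      FoliatedHomeomorphic mobiusFoliation Δ (Quotient.mk Δ ⁻¹' Z) ∨
      FoliatedHomeomorphic (canonicalFoliation openStrip) Δ (Quotient.mk Δ ⁻¹' Z) := by
  have hcou : SecondCountableTopology (Quotient Δ) :=
    isQuotientMap_quotient_mk'.secondCountableTopology hΔ.locallyStrip.isOpenMap
  have hcon : ConnectedSpace Z := isConnected_iff_connectedSpace.1 hZc
  have hT2 : T2Space Z := by
    rw [t2Space_iff_disjoint_nhds]
    intro y z hyz
    have h1 := disjoint_nhds_of_not_special (hZ y.2).1 (fun h => hyz (Subtype.ext h) : y.1 ≠ z.1)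
    rw [nhds_subtype_eq_comap, nhds_subtype_eq_comap]
    exact disjoint_comap h1
  have hch : ∀ z : Z, ∃ c : ℝ → Z, IsOpenEmbedding c ∧ z ∈ range c := by
    intro z
    obtain ⟨e, he, ⟨v, hv⟩, hsub⟩ := hΔ.exists_strip_regular (hZ z.2) (hZo.mem_nhds z.2)
    refine ⟨fun t => ⟨IsStrip.base Δ e t, hsub ⟨t, rfl⟩⟩,
      IsOpenEmbedding.of_comp _ hZo.isOpenEmbedding_subtypeVal he.isOpenEmbedding_base,
      v, Subtype.ext hv⟩
  rcases line_or_loop hch with ⟨γ, hγ, hr⟩ | ⟨γ, hγ, hγ1, hγi, hr⟩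
  · right; right
    have hγ' : IsOpenEmbedding fun t => (γ t : Quotient Δ) :=
      hZo.isOpenEmbedding_subtypeVal.comp hγ
    have hr' : range (fun t => (γ t : Quotient Δ)) = Z := by
      rw [show (fun t => (γ t : Quotient Δ)) = Subtype.val ∘ γ from rfl, range_comp, hr,
        image_univ, Subtype.range_coe]
    obtain ⟨e, he, her⟩ := hΔ.locallyStrip.exists_strip_of_isOpenEmbedding hγ'
    obtain ⟨k, hk, hkr⟩ := exists_openEmbedding_range_eq (isOpen_Ioo (a := (-1 : ℝ)) (b := 1))
      ordConnected_Ioo ⟨0, by norm_num, by norm_num⟩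
    set η : ℝ ≃ₜ range k := hk.isEmbedding.toHomeomorph
    set θ : Ioo (-1 : ℝ) 1 ≃ₜ ℝ := (Homeomorph.setCongr hkr.symm).trans η.symm
    have := (he.comp θ.isOpenEmbedding).foliatedHomeomorphic
    convert this using 1
    rw [← hr', ← her]
    ext x
    constructor
    · rintro ⟨q, rfl⟩
      exact ⟨(q.1, θ.symm q.2), by simp⟩
    · rintro ⟨q, rfl⟩
      exact ⟨_, rfl⟩
  · have hr' : (fun t => (γ t : Quotient Δ)) '' Icc (-1) 1 = Z := by
      rw [show (fun t => (γ t : Quotient Δ)) = Subtype.val ∘ γ from rfl, image_comp, hr,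
        image_univ, Subtype.range_coe]
    have := hΔ.locallyStrip.cylinder_or_mobius (Q := Quotient.mk Δ ⁻¹' Z)
      (γ := fun t => (γ t : Quotient Δ)) (by fun_prop) (congrArg _ hγ1)
      (Subtype.val_injective.comp_injOn hγi) (by rw [hr']) (by rw [hr']; exact hT2)
    tauto

/-- The leaf space of the piece is compact and has no special points, hence is closed as well as
open. -/
theorem eq_univ_of_glued [ConnectedSpace X] {ρ : ℝ → ℝ}
    {Z : Set (Quotient Δ)} (hZo : IsOpen Z) (hZn : Z.Nonempty) (hZ : Z ⊆ regularLeaves Δ)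
    (h : FoliatedHomeomorphic (gluedFoliation ρ) Δ (Quotient.mk Δ ⁻¹' Z)) :
    Quotient.mk Δ ⁻¹' Z = univ := by
  have h1 := h.isCompact_image_glued
  rw [image_preimage_eq _ Quotient.mk_surjective] at h1
  have hcl := isClosed_of_isCompact_not_special h1 fun y hy => (hZ hy).1
  obtain ⟨z, hz⟩ := hZn
  obtain ⟨x, rfl⟩ := Quotient.exists_rep z
  exact IsClopen.eq_univ ⟨hcl.preimage continuous_quotient_mk',
    hZo.preimage continuous_quotient_mk'⟩ ⟨x, hz⟩

end Components

/-! ### Strip atlases with nonseparated top leaves -/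

section Atlas

theorem isPreconnected_of_ordConnected_coe {J : Set ℝ} (hJ : J.OrdConnected) {S : Set J}
    (hS : S.OrdConnected) : IsPreconnected S := by
  rw [← IsInducing.subtypeVal.isPreconnected_image]
  refine Set.OrdConnected.isPreconnected (ordConnected_iff.2 ?_)
  rintro _ ⟨s, hs, rfl⟩ _ ⟨t, ht, rfl⟩ - r hr
  exact ⟨⟨r, hJ.out s.2 t.2 hr⟩, hS.out hs ht ⟨hr.1, hr.2⟩, rfl⟩

/-- A partition of `A` into lines that is trivial over the sets where the functions `χ j` are
positive, with a common orientation; the leaves at the level `1` need not be separated. -/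
structure IsStripAtlas {A J : Type*} [TopologicalSpace A] (τ : A → unitInterval)
    (e : J → OpenPartialHomeomorph A (ℝ × unitInterval)) (χ : J → unitInterval → ℝ) (j₀ : J) :
    Prop where
  continuous : Continuous τ
  continuous_height : ∀ j, Continuous (χ j)
  height_nonneg : ∀ j b, 0 ≤ χ j b
  height_le_one : ∀ j b, χ j b ≤ 1
  target_eq : ∀ j, (e j).target = univ ×ˢ {b | 0 < χ j b}
  snd_apply : ∀ j, ∀ a ∈ (e j).source, (e j a).2 = τ a
  mem_source : ∀ j a, τ a < 1 → 0 < χ j (τ a) → a ∈ (e j).source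
  height_pos_iff : ∀ b, 0 < χ j₀ b ↔ b < 1
  exists_mem_source : ∀ a, ∃ j, a ∈ (e j).source
  strictMono : ∀ j b, b < 1 → 0 < χ j b → StrictMono fun u => (e j₀ ((e j).symm (u, b))).1

namespace IsStripAtlas

variable {A J : Type*} [TopologicalSpace A] {τ : A → unitInterval}
  {e : J → OpenPartialHomeomorph A (ℝ × unitInterval)} {χ : J → unitInterval → ℝ} {j₀ : J}

theorem mem_target (h : IsStripAtlas τ e χ j₀) {j : J} (u : ℝ) {b : unitInterval}
    (hb : 0 < χ j b) : (u, b) ∈ (e j).target := by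
  rw [h.target_eq]
  exact ⟨mem_univ _, hb⟩

theorem symm_mem (h : IsStripAtlas τ e χ j₀) {j : J} (u : ℝ) {b : unitInterval}
    (hb : 0 < χ j b) : (e j).symm (u, b) ∈ (e j).source :=
  (e j).map_target (h.mem_target u hb)

theorem apply_symm (h : IsStripAtlas τ e χ j₀) {j : J} (u : ℝ) {b : unitInterval}
    (hb : 0 < χ j b) : e j ((e j).symm (u, b)) = (u, b) :=
  (e j).right_inv (h.mem_target u hb)

theorem level_symm (h : IsStripAtlas τ e χ j₀) {j : J} (u : ℝ) {b : unitInterval}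
    (hb : 0 < χ j b) : τ ((e j).symm (u, b)) = b := by
  rw [← h.snd_apply j _ (h.symm_mem u hb), h.apply_symm u hb]

theorem symm_apply (h : IsStripAtlas τ e χ j₀) {j : J} {a : A} (ha : a ∈ (e j).source) :
    (e j).symm ((e j a).1, τ a) = a := by
  rw [← h.snd_apply j a ha]
  exact (e j).left_inv ha

theorem height_pos (h : IsStripAtlas τ e χ j₀) {j : J} {a : A} (ha : a ∈ (e j).source) :
    0 < χ j (τ a) := by
  have h1 := (e j).map_source ha
  rw [h.target_eq] at h1
  rw [← h.snd_apply j a ha]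
  exact h1.2

theorem transition_inverse (h : IsStripAtlas τ e χ j₀) {i j : J} {b : unitInterval} (hb : b < 1)
    (hi : 0 < χ i b) (hj : 0 < χ j b) (u : ℝ) :
    (e i ((e j).symm ((e j ((e i).symm (u, b))).1, b))).1 = u := by
  have h1 : (e i).symm (u, b) ∈ (e j).source :=
    h.mem_source _ _ (by rwa [h.level_symm u hi]) (by rwa [h.level_symm u hi])
  have h2 := h.symm_apply h1
  rw [h.level_symm u hi] at h2
  rw [h2, h.apply_symm u hi]

/-- Below the top, every chart over the level `b` parametrizes the same line, and each is oriented
by comparison with `e j₀`. -/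
theorem strictMono_transition (h : IsStripAtlas τ e χ j₀) {i j : J} {b : unitInterval}
    (hb : b < 1) (hi : 0 < χ i b) (hj : 0 < χ j b) :
    StrictMono fun u => (e i ((e j).symm (u, b))).1 := by
  have h0 : 0 < χ j₀ b := (h.height_pos_iff b).2 hb
  intro u v huv
  refine (h.strictMono i b hb hi).lt_iff_lt.1 ?_
  have key : ∀ w, (e j₀ ((e i).symm ((e i ((e j).symm (w, b))).1, b))).1 =
      (e j₀ ((e j).symm (w, b))).1 := by
    intro w
    have h1 : (e j).symm (w, b) ∈ (e i).source :=
      h.mem_source _ _ (by rwa [h.level_symm w hj]) (by rwa [h.level_symm w hj])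
    have h2 := h.symm_apply h1
    rw [h.level_symm w hj] at h2
    rw [h2]
  simp only [key]
  exact h.strictMono j b hb hj huv

/-- The points below the top level. -/
def below (τ : A → unitInterval) : Set A := {a | τ a < 1}

theorem dense_below (h : IsStripAtlas τ e χ j₀) : Dense (below τ) := by
  intro a
  rcases (unitInterval.le_one' (t := τ a)).lt_or_eq with ha | ha
  · exact subset_closure ha
  obtain ⟨j, hj⟩ := h.exists_mem_source a
  have : NeBot (𝓝[<] (1 : unitInterval)) := nhdsLT_neBot_of_exists_lt ⟨0, zero_lt_one⟩
  have h1 : Tendsto (fun b : unitInterval => (e j).symm ((e j a).1, b)) (𝓝[<] 1) (𝓝 a) := by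
    have h2 := (e j).continuousAt_symm ((e j).map_source hj)
    have h3 : e j a = ((e j a).1, (1 : unitInterval)) := Prod.ext rfl ((h.snd_apply j a hj).trans ha)
    have h4 : Tendsto (fun b : unitInterval => ((e j a).1, b)) (𝓝 1) (𝓝 (e j a)) := by
      have h5 : Continuous fun b : unitInterval => ((e j a).1, b) := Continuous.prodMk_right _
      have h6 := h5.tendsto 1
      rwa [← h3] at h6
    have h5 := (h2.tendsto.comp h4).mono_left (nhdsWithin_le_nhds (s := Iio 1))
    rwa [(e j).left_inv hj] at h5
  refine mem_closure_of_tendsto h1 ?_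
  have h6 : ∀ᶠ b in 𝓝 (1 : unitInterval), 0 < χ j b :=
    (h.continuous_height j).continuousAt.eventually_const_lt (by simpa [ha] using h.height_pos hj)
  filter_upwards [nhdsWithin_le_nhds h6, self_mem_nhdsWithin] with b hb hb1
  change τ _ < 1
  rw [h.level_symm _ hb]
  exact hb1

/-- The normalized coordinate of a chart, before extension to the top level. -/
noncomputable def coord (τ : A → unitInterval) (e : J → OpenPartialHomeomorph A (ℝ × unitInterval))
    (χ : J → unitInterval → ℝ) (j : J) : A → ℝ :=
  (e j).source.indicator fun a => χ j (τ a) * Real.sigmoid (e j a).1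

theorem coord_of_mem {j : J} {a : A} (ha : a ∈ (e j).source) :
    coord τ e χ j a = χ j (τ a) * Real.sigmoid (e j a).1 := indicator_of_mem ha _

theorem coord_nonneg (h : IsStripAtlas τ e χ j₀) (j : J) (a : A) : 0 ≤ coord τ e χ j a :=
  indicator_nonneg (fun _ _ => mul_nonneg (h.height_nonneg j _) (Real.sigmoid_nonneg _)) a

theorem coord_le (h : IsStripAtlas τ e χ j₀) (j : J) (a : A) : coord τ e χ j a ≤ χ j (τ a) :=
  indicator_le' (fun _ _ => mul_le_of_le_one_right (h.height_nonneg j _) (Real.sigmoid_le_one _))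
    (fun _ _ => h.height_nonneg j _) a

/-- Where the height vanishes, the coordinate is squeezed between `0` and the height. The points
left over lie on top leaves outside the chart. -/
theorem continuousAt_coord (h : IsStripAtlas τ e χ j₀) {j : J} {a : A}
    (ha : a ∈ (e j).source ∨ χ j (τ a) = 0) : ContinuousAt (coord τ e χ j) a := by
  have hχc : Continuous fun a => χ j (τ a) := (h.continuous_height j).comp h.continuous
  rcases ha with ha | ha
  · have h1 : ContinuousAt (fun a => χ j (τ a) * Real.sigmoid (e j a).1) a :=
      hχc.continuousAt.mul (continuous_sigmoid.continuousAt.comp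
        (continuous_fst.continuousAt.comp ((e j).continuousAt ha)))
    refine h1.congr ?_
    filter_upwards [(e j).open_source.mem_nhds ha] with x hx
    exact (coord_of_mem hx).symm
  · have h0 : coord τ e χ j a = 0 :=
      le_antisymm ((h.coord_le j a).trans_eq ha) (h.coord_nonneg j a)
    have h2 : Tendsto (fun a => χ j (τ a)) (𝓝 a) (𝓝 0) := ha ▸ hχc.tendsto a
    rw [ContinuousAt, h0]
    exact squeeze_zero (h.coord_nonneg j) (h.coord_le j) h2

/-- Near a leaf of the top level outside a chart, the coordinate of this chart is large, with a
constant sign. -/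
theorem exists_nhds_large [T2Space A] (h : IsStripAtlas τ e χ j₀) {j : J} {q : A} (hq : τ q = 1)
    (hqj : q ∉ (e j).source) (hχ : 0 < χ j 1) {R : ℝ} (hR : 0 < R) :
    (∀ᶠ a in 𝓝[below τ] q, R < (e j a).1) ∨ ∀ᶠ a in 𝓝[below τ] q, (e j a).1 < -R := by
  obtain ⟨l, hl1, hl⟩ : ∃ l < (1 : unitInterval), ∀ b, l ≤ b → 0 < χ j b := by
    have h6 : {b | 0 < χ j b} ∈ 𝓝 (1 : unitInterval) :=
      (h.continuous_height j).continuousAt.eventually_const_lt hχ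
    obtain ⟨l, hl, hsub⟩ := (nhds_top_basis (α := unitInterval)).mem_iff.1 h6
    obtain ⟨m, hlm, hm⟩ := exists_between hl
    exact ⟨m, hm, fun b hb => hsub (hlm.trans_le hb)⟩
  -- A compact box of the chart `j` is closed in the Hausdorff space `A` and misses `q`, so near `q`
  -- the coordinate leaves `[-R, R]`.
  have hcomp : IsCompact ((e j).symm '' (Icc (-R) R ×ˢ Icc l 1)) := by
    refine (isCompact_Icc.prod (isClosed_Icc.isCompact)).image_of_continuousOn
      ((e j).continuousOn_symm.mono ?_)
    rintro ⟨u, b⟩ ⟨-, hb⟩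
    exact h.mem_target u (hl b hb.1)
  have hqK : q ∉ (e j).symm '' (Icc (-R) R ×ˢ Icc l 1) := by
    rintro ⟨⟨u, b⟩, ⟨-, hb⟩, rfl⟩
    exact hqj (h.symm_mem u (hl b hb.1))
  have hN : ((e j).symm '' (Icc (-R) R ×ˢ Icc l 1))ᶜ ∩ τ ⁻¹' Ioi l ∈ 𝓝 q :=
    inter_mem (hcomp.isClosed.isOpen_compl.mem_nhds hqK)
      ((isOpen_Ioi.preimage h.continuous).mem_nhds (by simpa [hq] using hl1))
  obtain ⟨i, hi⟩ := h.exists_mem_source q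
  have hNi : e i '' (((e j).symm '' (Icc (-R) R ×ˢ Icc l 1))ᶜ ∩ τ ⁻¹' Ioi l ∩ (e i).source) ∈
      𝓝 (e i q) := (e i).image_mem_nhds hi (inter_mem hN ((e i).open_source.mem_nhds hi))
  obtain ⟨U, hU, V, hV, hUV⟩ := mem_nhds_prod_iff.1 hNi
  obtain ⟨x₁, x₂, hx, hxU⟩ := mem_nhds_iff_exists_Ioo_subset.1 hU
  replace hV : V ∈ 𝓝 (e i q).2 := hV
  rw [h.snd_apply i q hi, hq] at hV
  obtain ⟨m, hm, hmV⟩ := (nhds_top_basis (α := unitInterval)).mem_iff.1 hV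
  -- A chart `i` around `q` shows that the nearby points below the top contain a connected set `D`
  -- to which all closer ones belong, so the coordinate cannot change sign.
  set D : Set A := (e i).symm '' (Ioo x₁ x₂ ×ˢ Ioo m 1) with hD
  have hbox : ∀ p ∈ Ioo x₁ x₂ ×ˢ Ioi m, p ∈ (e i).target ∧ (e i).symm p ∈
      ((e j).symm '' (Icc (-R) R ×ˢ Icc l 1))ᶜ ∩ τ ⁻¹' Ioi l := by
    rintro ⟨u, b⟩ ⟨hu, hb⟩
    obtain ⟨a, ⟨ha, hai⟩, hap⟩ := hUV ⟨hxU hu, hmV hb⟩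
    rw [← hap, (e i).left_inv hai]
    exact ⟨(e i).map_source hai, ha⟩
  have hDc : IsPreconnected D := by
    refine (isPreconnected_Ioo.prod (isPreconnected_of_ordConnected_coe ordConnected_Icc
      ordConnected_Ioo)).image _ ((e i).continuousOn_symm.mono ?_)
    rintro ⟨u, b⟩ ⟨hu, hb⟩
    exact (hbox (u, b) ⟨hu, hb.1⟩).1
  have hDmem : ∀ᶠ a in 𝓝[below τ] q, a ∈ D := by
    have h1 : ∀ᶠ a in 𝓝 q, e i a ∈ Ioo x₁ x₂ ×ˢ Ioi m := by
      refine ((e i).continuousAt hi).eventually_mem ((isOpen_Ioo.prod isOpen_Ioi).mem_nhds ⟨hx, ?_⟩)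
      rw [h.snd_apply i q hi, hq]
      exact hm
    filter_upwards [nhdsWithin_le_nhds h1, nhdsWithin_le_nhds ((e i).open_source.mem_nhds hi),
      self_mem_nhdsWithin] with a ha hai ha1
    refine ⟨e i a, ⟨ha.1, ha.2, ?_⟩, (e i).left_inv hai⟩
    rw [h.snd_apply i a hai]
    exact ha1
  have hDprop : ∀ a ∈ D, a ∈ (e j).source ∧ (R < (e j a).1 ∨ (e j a).1 < -R) := by
    rintro _ ⟨⟨u, b⟩, ⟨hu, hb⟩, rfl⟩
    obtain ⟨ht, hK, hl'⟩ := hbox (u, b) ⟨hu, hb.1⟩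
    have hτ : τ ((e i).symm (u, b)) = b := by
      rw [← h.snd_apply i _ ((e i).map_target ht), (e i).right_inv ht]
    have hs : (e i).symm (u, b) ∈ (e j).source :=
      h.mem_source _ _ (by rw [hτ]; exact hb.2) (hl _ (le_of_lt hl'))
    refine ⟨hs, ?_⟩
    by_contra hcon
    push Not at hcon
    exact hK ⟨e j ((e i).symm (u, b)), ⟨⟨hcon.2, hcon.1⟩, by
      rw [h.snd_apply j _ hs]
      exact ⟨le_of_lt hl', unitInterval.le_one'⟩⟩, (e j).left_inv hs⟩
  have hκc : ContinuousOn (fun a => (e j a).1) D :=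
    continuous_fst.comp_continuousOn ((e j).continuousOn.mono fun a ha => (hDprop a ha).1)
  by_cases hpos : ∃ a ∈ D, R < (e j a).1
  · left
    obtain ⟨a₀, ha₀, hR₀⟩ := hpos
    refine hDmem.mono fun a ha => (hDprop a ha).2.resolve_right fun hneg => ?_
    obtain ⟨z, hz, hz0⟩ := hDc.intermediate_value ha ha₀ hκc
      (show (0 : ℝ) ∈ Icc _ _ from ⟨by linarith, by linarith⟩)
    have hz0 : (e j z).1 = 0 := hz0
    rcases (hDprop z hz).2 with h' | h' <;> linarith
  · right
    exact hDmem.mono fun a ha => (hDprop a ha).2.resolve_left fun h' => hpos ⟨a, ha, h'⟩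

/-- At a top leaf outside the chart the coordinate tends to plus or minus infinity, so its sigmoid
has the limit `1` or `0`. -/
theorem exists_tendsto_coord [T2Space A] (h : IsStripAtlas τ e χ j₀) (j : J) (q : A) :
    ∃ y, Tendsto (coord τ e χ j) (𝓝[below τ] q) (𝓝 y) := by
  by_cases hq : q ∈ (e j).source ∨ χ j (τ q) = 0
  · exact ⟨_, (h.continuousAt_coord hq).continuousWithinAt⟩
  push Not at hq
  obtain ⟨hqj, hχ⟩ := hq
  have hχ : 0 < χ j (τ q) := (h.height_nonneg j _).lt_of_ne hχ.symm
  have hq1 : τ q = 1 := by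
    by_contra hne
    exact hqj (h.mem_source j q (lt_of_le_of_ne unitInterval.le_one' hne) hχ)
  have hχ1 : 0 < χ j 1 := hq1 ▸ hχ
  have hev : ∀ᶠ a in 𝓝[below τ] q, a ∈ (e j).source := by
    have h1 : ∀ᶠ a in 𝓝 q, 0 < χ j (τ a) :=
      ((h.continuous_height j).comp h.continuous).continuousAt.eventually_const_lt hχ
    filter_upwards [nhdsWithin_le_nhds h1, self_mem_nhdsWithin] with a ha ha1
    exact h.mem_source j a ha1 ha
  have hχt : Tendsto (fun a => χ j (τ a)) (𝓝[below τ] q) (𝓝 (χ j (τ q))) :=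
    ((h.continuous_height j).comp h.continuous).continuousWithinAt
  have key : ∀ g : ℝ, Tendsto (fun a => Real.sigmoid (e j a).1) (𝓝[below τ] q) (𝓝 g) →
      ∃ y, Tendsto (coord τ e χ j) (𝓝[below τ] q) (𝓝 y) := fun g hg =>
    ⟨_, (hχt.mul hg).congr' (hev.mono fun a ha => (coord_of_mem ha).symm)⟩
  -- `exists_nhds_large` chooses a sign for each `R` separately; one failure of the positive sign at
  -- `R₀` forces the negative one for all larger bounds.
  by_cases hall : ∀ R : ℝ, 0 < R → ∀ᶠ a in 𝓝[below τ] q, R < (e j a).1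
  · refine key 1 (Real.tendsto_sigmoid_atTop.comp (tendsto_atTop.2 fun R => ?_))
    filter_upwards [hall (max R 1) (by positivity)] with a ha
    exact (le_max_left _ _).trans ha.le
  · simp only [not_forall] at hall
    obtain ⟨R₀, hR₀, hn⟩ := hall
    refine key 0 (Real.tendsto_sigmoid_atBot.comp (tendsto_atBot.2 fun R => ?_))
    rcases h.exists_nhds_large hq1 hqj hχ1 (lt_max_of_lt_left hR₀ : 0 < max R₀ (-R)) with h1 | h1
    · exact absurd (h1.mono fun a ha => (le_max_left _ _).trans_lt ha) hn
    · filter_upwards [h1] with a ha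
      have := le_max_right R₀ (-R)
      linarith

/-- The normalized coordinate of a chart, extended by continuity to all leaves. -/
noncomputable def extCoord (τ : A → unitInterval)
    (e : J → OpenPartialHomeomorph A (ℝ × unitInterval)) (χ : J → unitInterval → ℝ) (j : J) :
    A → ℝ :=
  extendFrom (below τ) (coord τ e χ j)

theorem continuous_extCoord [T2Space A] (h : IsStripAtlas τ e χ j₀) (j : J) :
    Continuous (extCoord τ e χ j) :=
  continuous_extendFrom h.dense_below (h.exists_tendsto_coord j)

theorem extCoord_eq (h : IsStripAtlas τ e χ j₀) {j : J} {a : A}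
    (ha : a ∈ (e j).source ∨ χ j (τ a) = 0) : extCoord τ e χ j a = coord τ e χ j a :=
  extendFrom_eq (h.dense_below a) (h.continuousAt_coord ha).continuousWithinAt

theorem extCoord_of_below (h : IsStripAtlas τ e χ j₀) (j : J) {a : A} (ha : τ a < 1) :
    extCoord τ e χ j a = coord τ e χ j a := by
  refine h.extCoord_eq (or_iff_not_imp_right.2 fun h0 => h.mem_source j a ha ?_)
  exact (h.height_nonneg j _).lt_of_ne' h0

theorem extCoord_nonneg [T2Space A] (h : IsStripAtlas τ e χ j₀) (j : J) (a : A) :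
    0 ≤ extCoord τ e χ j a :=
  (isClosed_le continuous_const (h.continuous_extCoord j)).closure_subset_iff.2
    (fun a ha => (h.coord_nonneg j a).trans_eq (h.extCoord_of_below j ha).symm) (h.dense_below a)

theorem extCoord_le [T2Space A] (h : IsStripAtlas τ e χ j₀) (j : J) (a : A) :
    extCoord τ e χ j a ≤ χ j (τ a) :=
  (isClosed_le (h.continuous_extCoord j)
    ((h.continuous_height j).comp h.continuous)).closure_subset_iff.2
    (fun a ha => (h.extCoord_of_below j ha).trans_le (h.coord_le j a)) (h.dense_below a)

theorem extCoord_symm_self (h : IsStripAtlas τ e χ j₀) {j : J} {b : unitInterval}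
    (hb : 0 < χ j b) (u : ℝ) :
    extCoord τ e χ j ((e j).symm (u, b)) = χ j b * Real.sigmoid u := by
  rw [h.extCoord_eq (Or.inl (h.symm_mem u hb)), coord_of_mem (h.symm_mem u hb), h.level_symm u hb,
    h.apply_symm u hb]

theorem extCoord_symm (h : IsStripAtlas τ e χ j₀) {i j : J} {b : unitInterval} (hb1 : b < 1)
    (hi : 0 < χ i b) (hj : 0 < χ j b) (u : ℝ) :
    extCoord τ e χ i ((e j).symm (u, b)) =
      χ i b * Real.sigmoid (e i ((e j).symm (u, b))).1 := by
  have h1 : (e j).symm (u, b) ∈ (e i).source :=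
    h.mem_source _ _ (by rwa [h.level_symm u hj]) (by rwa [h.level_symm u hj])
  rw [h.extCoord_eq (Or.inl h1), coord_of_mem h1, h.level_symm u hj]

theorem strictMono_extCoord_self (h : IsStripAtlas τ e χ j₀) {j : J} {b : unitInterval}
    (hb : 0 < χ j b) : StrictMono fun u => extCoord τ e χ j ((e j).symm (u, b)) := by
  simp only [h.extCoord_symm_self hb]
  exact Real.sigmoid_strictMono.const_mul hb

/-- At the top level the inequality is a limit from below, so strictness may be lost; the chart's
own term supplies it in the weighted sum. -/
theorem monotone_extCoord [T2Space A] (h : IsStripAtlas τ e χ j₀) (i : J) {j : J}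
    {b : unitInterval} (hb : 0 < χ j b) :
    Monotone fun u => extCoord τ e χ i ((e j).symm (u, b)) := by
  have hlt : ∀ b : unitInterval, b < 1 → 0 < χ j b →
      Monotone fun u => extCoord τ e χ i ((e j).symm (u, b)) := by
    intro b hb1 hb
    rcases (h.height_nonneg i b).eq_or_lt with hi | hi
    · have : ∀ u, extCoord τ e χ i ((e j).symm (u, b)) = 0 := fun u =>
        le_antisymm ((h.extCoord_le i _).trans_eq (by rw [h.level_symm u hb, hi]))
          (h.extCoord_nonneg i _)
      simp only [this]
      exact monotone_const
    · simp only [h.extCoord_symm hb1 hi hb]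
      exact ((Real.sigmoid_strictMono.comp
        (h.strictMono_transition hb1 hi hb)).const_mul hi).monotone
  rcases (unitInterval.le_one' (t := b)).lt_or_eq with hb1 | rfl
  · exact hlt b hb1 hb
  intro u v huv
  have : NeBot (𝓝[<] (1 : unitInterval)) := nhdsLT_neBot_of_exists_lt ⟨0, zero_lt_one⟩
  have hlim : ∀ w, Tendsto (fun b => extCoord τ e χ i ((e j).symm (w, b))) (𝓝[<] 1)
      (𝓝 (extCoord τ e χ i ((e j).symm (w, 1)))) := by
    intro w
    have h1 : Continuous fun b : unitInterval => (w, b) := Continuous.prodMk_right w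
    exact ((h.continuous_extCoord i).continuousAt.tendsto.comp
      (((e j).continuousAt_symm (h.mem_target w hb)).tendsto.comp (h1.tendsto 1))).mono_left
        nhdsWithin_le_nhds
  refine le_of_tendsto_of_tendsto (hlim u) (hlim v) ?_
  have h6 : ∀ᶠ b in 𝓝 (1 : unitInterval), 0 < χ j b :=
    (h.continuous_height j).continuousAt.eventually_const_lt hb
  filter_upwards [nhdsWithin_le_nhds h6, self_mem_nhdsWithin] with b hb hb1
  exact hlt b hb1 hb huv

theorem tendsto_extCoord [T2Space A] (h : IsStripAtlas τ e χ j₀) (i : J) {b : unitInterval}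
    (hb : b < 1) :
    Tendsto (fun u => extCoord τ e χ i ((e j₀).symm (u, b))) atBot (𝓝 0) ∧
      Tendsto (fun u => extCoord τ e χ i ((e j₀).symm (u, b))) atTop (𝓝 (χ i b)) := by
  have h0 : 0 < χ j₀ b := (h.height_pos_iff b).2 hb
  rcases (h.height_nonneg i b).eq_or_lt with hi | hi
  · have : ∀ u, extCoord τ e χ i ((e j₀).symm (u, b)) = 0 := fun u =>
      le_antisymm ((h.extCoord_le i _).trans_eq (by rw [h.level_symm u h0, hi]))
        (h.extCoord_nonneg i _)
    simp only [this, ← hi]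
    exact ⟨tendsto_const_nhds, tendsto_const_nhds⟩
  · obtain ⟨htop, hbot⟩ := tendsto_of_strictMono_surjective (h.strictMono_transition hb hi h0)
      fun u => ⟨_, h.transition_inverse hb hi h0 u⟩
    simp only [h.extCoord_symm hb hi h0]
    constructor
    · simpa using (Real.tendsto_sigmoid_atBot.comp hbot).const_mul (χ i b)
    · simpa using (Real.tendsto_sigmoid_atTop.comp htop).const_mul (χ i b)

/-- A space with a strip atlas is a strip in the plane. -/
theorem exists_isOpenEmbedding [T2Space A] [Countable J] (h : IsStripAtlas τ e χ j₀) :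
    ∃ Ψ : A → ℝ × unitInterval, IsOpenEmbedding Ψ ∧ (∀ a, (Ψ a).2 = τ a) ∧
      ∀ x b, b < 1 → (x, b) ∈ range Ψ := by
  obtain ⟨Ψ, hc, ho, hΨτ, hmono, hsurj⟩ := exists_flattening h.continuous
    (f := extCoord τ e χ) h.continuous_extCoord h.continuous_height h.height_le_one
    h.extCoord_nonneg h.extCoord_le (fun a => by
      obtain ⟨j, hj⟩ := h.exists_mem_source a
      exact ⟨e j, _, hj, h.target_eq j, h.snd_apply j, fun b hb =>
        ⟨fun i => h.monotone_extCoord i hb, j, h.strictMono_extCoord_self hb⟩⟩)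
  have hinj : ∀ a a', τ a < 1 → Ψ a = Ψ a' → a = a' := by
    intro a a' ha haa
    have hτ : τ a' = τ a := by rw [← hΨτ, ← hΨτ, haa]
    have h0 : 0 < χ j₀ (τ a) := (h.height_pos_iff _).2 ha
    have hs := hmono (τ a) (fun u => (e j₀).symm (u, τ a)) (fun u => h.level_symm u h0)
      (fun i => h.monotone_extCoord i h0) ⟨j₀, h.strictMono_extCoord_self h0⟩
    have h1 := h.symm_apply (h.mem_source j₀ a ha h0)
    have h2 := h.symm_apply (h.mem_source j₀ a' (hτ ▸ ha) (hτ ▸ h0))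
    rw [hτ] at h2
    have h3 : (e j₀ a).1 = (e j₀ a').1 := hs.injective (by
      rw [h1, h2, haa])
    rw [← h1, ← h2, h3]
  refine ⟨Ψ, .of_continuous_injective_isOpenMap hc ?_ ho, hΨτ, fun x b hb => ?_⟩
  · intro a a' haa
    by_contra hne
    -- Two top points with the same image have disjoint neighbourhoods whose open images overlap. By
    -- density the overlap contains the image of a point below the top, where `Ψ` is already
    -- injective.
    obtain ⟨U, U', hU, hU', haU, haU', hd⟩ := t2_separation hne
    have hτ : τ a = 1 := by
      by_contra hlt
      exact hne (hinj a a' (lt_of_le_of_ne unitInterval.le_one' hlt) haa)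
    have h1 : Ψ '' U ∩ Ψ '' U' ∈ 𝓝 (Ψ a) :=
      inter_mem ((ho _ hU).mem_nhds ⟨a, haU, rfl⟩) ((ho _ hU').mem_nhds ⟨a', haU', haa.symm⟩)
    have h2 : ∃ z ∈ Ψ ⁻¹' (Ψ '' U ∩ Ψ '' U'), z ∈ below τ :=
      mem_closure_iff_nhds.1 (h.dense_below a) _ (hc.continuousAt h1)
    obtain ⟨z, ⟨⟨w, hw, hwz⟩, ⟨w', hw', hwz'⟩⟩, hz⟩ := h2
    have e1 := hinj z w hz hwz.symm
    have e2 := hinj z w' hz hwz'.symm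
    exact hd.le_bot ⟨hw, (e1.symm.trans e2) ▸ hw'⟩
  · have h0 : 0 < χ j₀ b := (h.height_pos_iff b).2 hb
    obtain ⟨u, hu⟩ := hsurj b (fun u => (e j₀).symm (u, b))
      ((e j₀).continuousOn_symm.comp_continuous (by fun_prop) fun u => h.mem_target u h0)
      (fun u => h.level_symm u h0) (fun i => (h.tendsto_extCoord i hb).1)
      (fun i => (h.tendsto_extCoord i hb).2) x
    exact ⟨_, hu⟩

end IsStripAtlas

end Atlas

/-! ### Recognizing model strips -/

section ModelStrip

variable {X : Type*} [TopologicalSpace X] {Δ : Setoid X}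

/-- A union of leaves that embeds into `ℝ × [0, 1]`, with full leaves below the level `1` and
leaves at the level `1` that are isolated there, is a model strip. -/
theorem exists_modelStrip_of_isOpenEmbedding (hleaf : ∀ y, IsPreconnected (Quotient.mk Δ ⁻¹' {y}))
    {P : Set (Quotient Δ)} {Ψ : Quotient.mk Δ ⁻¹' P → ℝ × unitInterval} (hΨ : IsOpenEmbedding Ψ)
    (hfull : ∀ x b, b < 1 → (x, b) ∈ range Ψ)
    (hlevel : ∀ a a' : Quotient.mk Δ ⁻¹' P, Quotient.mk Δ (a : X) = Quotient.mk Δ (a' : X) →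
      (Ψ a).2 = (Ψ a').2)
    (hbelow : ∀ a a' : Quotient.mk Δ ⁻¹' P, (Ψ a).2 < 1 → (Ψ a).2 = (Ψ a').2 →
      Quotient.mk Δ (a : X) = Quotient.mk Δ (a' : X))
    (htop : ∀ a, (Ψ a).2 = 1 → ∀ᶠ a' in 𝓝 a, (Ψ a').2 = 1 →
      Quotient.mk Δ (a' : X) = Quotient.mk Δ (a : X)) :
    ∃ S : Set (ℝ × ℝ), IsModelStrip S ∧
      FoliatedHomeomorphic (canonicalFoliation S) Δ (Quotient.mk Δ ⁻¹' P) := by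
  set ι : ℝ × unitInterval → ℝ × ℝ := Prod.map id Subtype.val
  have hι : IsEmbedding ι := IsEmbedding.id.prodMap IsEmbedding.subtypeVal
  have hemb : IsEmbedding fun a => ι (Ψ a) := hι.comp hΨ.isEmbedding
  set S : Set (ℝ × ℝ) := range fun a => ι (Ψ a) with hS
  have hmemS : ∀ x (b : unitInterval), (x, (b : ℝ)) ∈ S ↔ (x, b) ∈ range Ψ := by
    intro x b
    constructor
    · rintro ⟨a, ha⟩
      exact ⟨a, hι.injective ha⟩
    · rintro ⟨a, ha⟩
      exact ⟨a, congrArg ι ha⟩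
  -- The trace of a leaf on the top line. The nonempty traces are the boundary intervals: open by
  -- `htop`, disjoint by injectivity, order connected because leaves are connected.
  set O : Quotient Δ → Set ℝ := fun y =>
    {x | ∃ a : Quotient.mk Δ ⁻¹' P, Ψ a = (x, 1) ∧ Quotient.mk Δ (a : X) = y} with hO
  have hOo : ∀ y, IsOpen (O y) := by
    intro y
    rw [isOpen_iff_mem_nhds]
    rintro x ⟨a, hax, hay⟩
    have h1 := hΨ.isOpenMap.image_mem_nhds (htop a (by rw [hax]))
    rw [hax] at h1
    have h2 : Continuous fun x : ℝ => (x, (1 : unitInterval)) := by fun_prop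
    filter_upwards [h2.continuousAt h1]
    rintro x' ⟨a', ha', ha'x⟩
    exact ⟨a', ha'x, (ha' (by rw [ha'x])).trans hay⟩
  have hOd : ∀ y y', ∀ x ∈ O y, x ∈ O y' → y = y' := by
    rintro y y' x ⟨a, hax, rfl⟩ ⟨a', hax', rfl⟩
    rw [hΨ.injective (hax.trans hax'.symm)]
  have hOc : ∀ y, (O y).OrdConnected := by
    intro y
    by_cases hy : (O y).Nonempty
    swap
    · rw [Set.not_nonempty_iff_eq_empty.1 hy]
      exact ordConnected_empty
    obtain ⟨x₀, a₀, ha₀, hay₀⟩ := hy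
    have h1 : IsPreconnected {a : Quotient.mk Δ ⁻¹' P | Quotient.mk Δ (a : X) = y} := by
      rw [← IsInducing.subtypeVal.isPreconnected_image]
      convert hleaf y using 1
      ext x
      constructor
      · rintro ⟨a, ha, rfl⟩
        exact ha
      · intro hx
        have hx : Quotient.mk Δ x = y := hx
        refine ⟨⟨x, ?_⟩, hx, rfl⟩
        rw [mem_preimage, hx, ← hay₀]
        exact a₀.2
    have h2 := h1.image (fun a => (Ψ a).1) (continuous_fst.comp hΨ.continuous).continuousOn
    have h3 : O y = (fun a => (Ψ a).1) '' {a | Quotient.mk Δ (a : X) = y} := by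
      ext x
      constructor
      · rintro ⟨a, hax, hay⟩
        exact ⟨a, hay, congrArg Prod.fst hax⟩
      · rintro ⟨a, hay, rfl⟩
        refine ⟨a, Prod.ext rfl ?_, hay⟩
        rw [hlevel a a₀ (Eq.trans hay hay₀.symm), ha₀]
    rw [h3]
    exact h2.ordConnected
  have hOS : ∀ x, (x, (1 : ℝ)) ∈ S ↔ ∃ y, x ∈ O y := by
    intro x
    rw [show (1 : ℝ) = ((1 : unitInterval) : ℝ) from rfl, hmemS]
    constructor
    · rintro ⟨a, ha⟩
      exact ⟨_, a, ha, rfl⟩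
    · rintro ⟨y, a, ha, -⟩
      exact ⟨a, ha⟩
  refine ⟨S, ⟨0, 1, zero_lt_one, ?_, ?_, ?_, ?_⟩, ?_⟩
  · rintro ⟨x, t⟩ ⟨-, ht⟩
    exact (hmemS x ⟨t, ht.1.le, ht.2.le⟩).2 (hfull _ _ (Subtype.mk_lt_mk.2 ht.2))
  · rintro _ ⟨a, rfl⟩
    exact ⟨mem_univ _, (Ψ a).2.2⟩
  -- The level `0` lies below `1`, so `hfull` makes the bottom line complete.
  · refine ⟨{univ}, pairwiseDisjoint_singleton _ _, ?_, ?_⟩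
    · rintro _ rfl
      exact ⟨univ_nonempty, isOpen_univ, ordConnected_univ⟩
    · rw [sUnion_singleton]
      exact (eq_univ_of_forall fun x => (hmemS x 0).2 (hfull _ _ zero_lt_one)).symm
  · refine ⟨{K | K.Nonempty ∧ ∃ y, K = O y}, ?_, ?_, ?_⟩
    · rintro _ ⟨-, y, rfl⟩ _ ⟨-, y', rfl⟩ hne
      refine Set.disjoint_left.2 fun x hx hx' => hne ?_
      rw [hOd y y' x hx hx']
    · rintro _ ⟨hn, y, rfl⟩
      exact ⟨hn, hOo y, hOc y⟩
    · ext x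
      constructor
      · rintro ⟨_, ⟨-, y, rfl⟩, hx⟩
        exact (hOS x).2 ⟨y, hx⟩
      · intro hx
        obtain ⟨y, hy⟩ := (hOS x).1 hx
        exact ⟨_, ⟨⟨x, hy⟩, y, rfl⟩, hy⟩
  · set h : Quotient.mk Δ ⁻¹' P ≃ₜ S := hemb.toHomeomorph
    refine ⟨h.symm, isFoliated_of_iff (fun x hx y hxy => ?_) fun p q => ?_⟩
    · rw [mem_preimage] at hx ⊢
      rwa [hxy]
    obtain ⟨a, rfl⟩ := h.surjective p
    obtain ⟨a', rfl⟩ := h.surjective q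
    rw [h.symm_apply_apply, h.symm_apply_apply]
    have hval : ∀ a, (h a : ℝ × ℝ) = ((Ψ a).1, ((Ψ a).2 : ℝ)) := fun a => rfl
    constructor
    · rintro ⟨hab, hseg⟩
      simp only [hval] at hab hseg
      have hab : (Ψ a).2 = (Ψ a').2 := Subtype.ext hab
      rcases (unitInterval.le_one' (t := (Ψ a).2)).lt_or_eq with hlt | heq
      · exact hbelow a a' hlt hab
      rw [heq] at hseg
      -- A top segment inside `S` is connected and covered by disjoint open traces, so it lies in
      -- one leaf.
      have hcov : uIcc (Ψ a).1 (Ψ a').1 ⊆ O (Quotient.mk Δ (a : X)) ∪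
          ⋃ y ∈ {y | y ≠ Quotient.mk Δ (a : X)}, O y := by
        intro x hx
        obtain ⟨y, hy⟩ := (hOS x).1 (hseg x hx)
        by_cases hya : y = Quotient.mk Δ (a : X)
        · exact Or.inl (hya ▸ hy)
        · exact Or.inr (mem_biUnion hya hy)
      have hsub := isPreconnected_uIcc.subset_left_of_subset_union (hOo _)
        (isOpen_biUnion fun y _ => hOo y) (Set.disjoint_left.2 fun x hx hx' => by
          obtain ⟨y, hy, hxy⟩ := mem_iUnion₂.1 hx'
          exact hy (hOd _ _ x hxy hx)) hcov
        ⟨_, left_mem_uIcc, a, Prod.ext rfl heq, rfl⟩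
      obtain ⟨z, hz, hza⟩ := hsub right_mem_uIcc
      have : z = a' := hΨ.injective (hz.trans (Prod.ext rfl (hab ▸ heq.symm)))
      rw [← hza, this]
    · intro haa
      have hab := hlevel a a' haa
      refine ⟨congrArg Subtype.val hab, fun x hx => ?_⟩
      simp only [hval] at hx ⊢
      rcases (unitInterval.le_one' (t := (Ψ a).2)).lt_or_eq with hlt | heq
      · exact (hmemS x _).2 (hfull _ _ hlt)
      · rw [heq]
        exact (hOS x).2 ⟨_, (hOc _).uIcc_subset ⟨a, Prod.ext rfl heq, rfl⟩
          ⟨a', Prod.ext rfl (hab ▸ heq), haa.symm⟩ hx⟩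

end ModelStrip

/-! ### Charts of a union of leaves and their orientation -/

section Charts

variable {X : Type*} [TopologicalSpace X] {Δ : Setoid X}

/-- A strip and a curve of leaves in it give a chart of a union of leaves. -/
theorem IsStrip.exists_chart {T : Type*} [TopologicalSpace T] {e : ℝ × T → X}
    (he : IsStrip Δ e) {P : Set (Quotient Δ)} {τ : Quotient.mk Δ ⁻¹' P → unitInterval}
    (hτ : Continuous τ) {V : Set unitInterval} (hV : IsOpen V) (hVn : V.Nonempty)
    {σ : unitInterval → Quotient Δ}
    (hσ : ContinuousOn σ V) (hσe : ∀ b ∈ V, σ b ∈ range (IsStrip.base Δ e))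
    (hσP : ∀ b ∈ V, σ b ∈ P)
    (hτσ : ∀ b ∈ V, ∀ x : Quotient.mk Δ ⁻¹' P, Quotient.mk Δ (x : X) = σ b → τ x = b)
    (ho : IsOpen {x : Quotient.mk Δ ⁻¹' P | Quotient.mk Δ (x : X) ∈ σ '' V}) :
    ∃ E : OpenPartialHomeomorph (Quotient.mk Δ ⁻¹' P) (ℝ × unitInterval),
      E.source = {x : Quotient.mk Δ ⁻¹' P | Quotient.mk Δ (x : X) ∈ σ '' V} ∧ E.target = univ ×ˢ V ∧
      (∀ x, (E x).2 = τ x) := by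
  classical
  obtain ⟨b₀, hb₀⟩ := hVn
  have hne : Nonempty T := ⟨(hσe b₀ hb₀).choose⟩
  set eo := he.isOpenEmbedding.toOpenPartialHomeomorph e with heo_def
  set bo := he.isOpenEmbedding_base.toOpenPartialHomeomorph _ with hbo_def
  have heo : ∀ x ∈ range e, e (eo.symm x) = x := fun x hx =>
    eo.right_inv (by simpa [eo] using hx)
  have heo' : ∀ q, eo.symm (e q) = q := fun q => eo.left_inv (by simp [eo])
  have hbo : ∀ b ∈ V, IsStrip.base Δ e (bo.symm (σ b)) = σ b := fun b hb =>
    bo.right_inv (by simpa [bo] using hσe b hb)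
  have hmk : ∀ u, ∀ b ∈ V, Quotient.mk Δ (e (u, bo.symm (σ b))) = σ b := fun u b hb => by
    rw [he.mk_apply, hbo b hb]
  have hsrc : ∀ x : Quotient.mk Δ ⁻¹' P, Quotient.mk Δ (x : X) ∈ σ '' V → (x : X) ∈ range e := by
    rintro x ⟨b, hb, hx⟩
    obtain ⟨t, ht⟩ := hσe b hb
    obtain ⟨u, hu⟩ := he.mk_eq_base (hx.symm.trans ht.symm)
    exact ⟨_, hu⟩
  have hmemP : ∀ u, ∀ b ∈ V, e (u, bo.symm (σ b)) ∈ Quotient.mk Δ ⁻¹' P := fun u b hb => by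
    rw [mem_preimage, hmk u b hb]
    exact hσP b hb
  set inv : ℝ × unitInterval → Quotient.mk Δ ⁻¹' P := fun p =>
    if hp : p.2 ∈ V then ⟨e (p.1, bo.symm (σ p.2)), hmemP p.1 p.2 hp⟩
    else ⟨e (0, bo.symm (σ b₀)), hmemP 0 b₀ hb₀⟩ with hinv
  refine ⟨
    { toFun := fun x => ((eo.symm (x : X)).1, τ x)
      invFun := inv
      source := {x | Quotient.mk Δ (x : X) ∈ σ '' V}
      target := univ ×ˢ V
      map_source' := ?_
      map_target' := ?_
      left_inv' := ?_
      right_inv' := ?_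
      open_source := ho
      open_target := isOpen_univ.prod hV
      continuousOn_toFun := ?_
      continuousOn_invFun := ?_ }, rfl, rfl, fun x => rfl⟩
  · rintro x ⟨b, hb, hx⟩
    refine ⟨mem_univ _, ?_⟩
    simp only
    rwa [hτσ b hb x hx.symm]
  · rintro ⟨u, b⟩ ⟨-, hb⟩
    refine ⟨b, hb, ?_⟩
    simp only [hinv, dif_pos hb]
    exact (hmk u b hb).symm
  · rintro x hx
    obtain ⟨b, hb, hxb⟩ := hx
    have hτx := hτσ b hb x hxb.symm
    have hb' : τ x ∈ V := hτx ▸ hb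
    simp only [hinv, dif_pos hb']
    refine Subtype.ext ?_
    have h1 := heo _ (hsrc x ⟨b, hb, hxb⟩)
    have h2 : bo.symm (σ (τ x)) = (eo.symm (x : X)).2 := by
      apply he.base_injective
      rw [hbo _ hb', hτx, hxb]
      nth_rewrite 1 [← h1]
      exact he.mk_apply _ _
    change e (_, bo.symm (σ (τ x))) = _
    rw [h2]
    exact h1
  · rintro ⟨u, b⟩ ⟨-, hb⟩
    have hb : b ∈ V := hb
    refine Prod.ext ?_ ?_
    · simp only [hinv, dif_pos hb, heo']
    · refine hτσ b hb _ ?_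
      simp only [hinv, dif_pos hb]
      exact hmk u b hb
  · refine ContinuousOn.prodMk ?_ hτ.continuousOn
    refine continuous_fst.comp_continuousOn (eo.continuousOn_symm.comp (by fun_prop) ?_)
    intro x hx
    simpa [eo] using hsrc x hx
  · refine IsInducing.subtypeVal.continuousOn_iff.2 ?_
    have : ContinuousOn (fun p : ℝ × unitInterval => e (p.1, bo.symm (σ p.2))) (univ ×ˢ V) := by
      refine he.isOpenEmbedding.continuous.comp_continuousOn (ContinuousOn.prodMk (by fun_prop) ?_)
      refine bo.continuousOn_symm.comp (hσ.comp (by fun_prop) fun p hp => hp.2) ?_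
      rintro ⟨u, b⟩ ⟨-, hb⟩
      simpa [bo] using hσe b hb
    refine this.congr ?_
    rintro ⟨u, b⟩ ⟨-, hb⟩
    have hb : b ∈ V := hb
    simp only [Function.comp, hinv, dif_pos hb]

/-- A chart can be oriented by another one. -/
theorem exists_oriented_chart {A : Type*} [TopologicalSpace A] {τ : A → unitInterval}
    {E₀ E : OpenPartialHomeomorph A (ℝ × unitInterval)} {V : Set unitInterval}
    (hEt : E.target = univ ×ˢ V) (hEτ : ∀ x, (E x).2 = τ x) (hE₀τ : ∀ x, (E₀ x).2 = τ x)
    {K : Set unitInterval} (hK : IsPreconnected K) (hKV : K ⊆ V)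
    (hKs : ∀ u, ∀ b ∈ K, E.symm (u, b) ∈ E₀.source) :
    ∃ E' : OpenPartialHomeomorph A (ℝ × unitInterval), E'.source = E.source ∧
      E'.target = univ ×ˢ V ∧ (∀ x, (E' x).2 = τ x) ∧
      ∀ b ∈ K, StrictMono fun u => (E₀ (E'.symm (u, b))).1 := by
  have htar : ∀ u, ∀ b ∈ K, (u, b) ∈ E.target := fun u b hb => by
    rw [hEt]
    exact ⟨mem_univ _, hKV hb⟩
  have hτs : ∀ u, ∀ b ∈ K, τ (E.symm (u, b)) = b := fun u b hb => by
    rw [← hEτ, E.right_inv (htar u b hb)]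
  set g : unitInterval → ℝ → ℝ := fun b u => (E₀ (E.symm (u, b))).1 with hg
  have hcont : ContinuousOn (fun p : ℝ × unitInterval => g p.2 p.1) (univ ×ˢ K) := by
    refine continuous_fst.comp_continuousOn (E₀.continuousOn.comp
      (E.continuousOn_symm.mono ?_) ?_)
    · rintro ⟨u, b⟩ ⟨-, hb⟩
      exact htar u b hb
    · rintro ⟨u, b⟩ ⟨-, hb⟩
      exact hKs u b hb
  have hcb : ∀ u, ContinuousOn (fun b => g b u) K := fun u =>
    hcont.comp (f := fun b => (u, b)) (by fun_prop) fun b hb => ⟨mem_univ _, hb⟩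
  have hcu : ∀ b ∈ K, Continuous (g b) := fun b hb =>
    hcont.comp_continuous (f := fun u => (u, b)) (by fun_prop) fun u => ⟨mem_univ _, hb⟩
  have hinj : ∀ b ∈ K, Function.Injective (g b) := by
    intro b hb u v huv
    have h1 : E₀ (E.symm (u, b)) = E₀ (E.symm (v, b)) := Prod.ext huv (by
      rw [hE₀τ, hE₀τ, hτs u b hb, hτs v b hb])
    have h2 := E₀.injOn (hKs u b hb) (hKs v b hb) h1
    exact congrArg Prod.fst (E.symm.injOn (htar u b hb) (htar v b hb) h2)
  rcases K.eq_empty_or_nonempty with rfl | ⟨b₀, hb₀⟩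
  · exact ⟨E, rfl, hEt, hEτ, fun b hb => absurd hb (notMem_empty b)⟩
  rcases (hcu b₀ hb₀).strictMono_of_inj (hinj b₀ hb₀) with hm | hm
  · exact ⟨E, rfl, hEt, hEτ, strictMono_of_isPreconnected hK hcb hcu hinj hb₀ hm⟩
  · set N : (ℝ × unitInterval) ≃ₜ ℝ × unitInterval :=
      (Homeomorph.neg ℝ).prodCongr (Homeomorph.refl _)
    refine ⟨E.transHomeomorph N, rfl, ?_, fun x => hEτ x, ?_⟩
    · change N.symm ⁻¹' E.target = _
      rw [hEt]
      rfl
    · exact strictMono_of_isPreconnected (g := fun b u => g b (-u)) hK (fun u => hcb (-u))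
        (fun b hb => (hcu b hb).comp continuous_neg)
        (fun b hb => (hinj b hb).comp neg_injective) hb₀ fun u v huv => hm (neg_lt_neg huv)

end Charts

/-! ### The closure of one half of a component -/

section HalfClosure

/-- The curve on `[0, 1]` that agrees with `γ` on `[0, 1)` and ends at `y`. -/
noncomputable def closedCurve {Y : Type*} (γ : Ioo (-1 : ℝ) 1 → Y) (y : Y) (b : unitInterval) : Y :=
  if h : b < 1 then γ ⟨b, neg_one_lt_zero.trans_le b.2.1, h⟩ else y

theorem closedCurve_of_lt {Y : Type*} (γ : Ioo (-1 : ℝ) 1 → Y) (y : Y) {b : unitInterval}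
    (h : b < 1) : closedCurve γ y b = γ ⟨b, neg_one_lt_zero.trans_le b.2.1, h⟩ := dif_pos h

theorem closedCurve_one {Y : Type*} (γ : Ioo (-1 : ℝ) 1 → Y) (y : Y) : closedCurve γ y 1 = y :=
  dif_neg (lt_irrefl _)

theorem continuousOn_closedCurve {Y : Type*} [TopologicalSpace Y] {γ : Ioo (-1 : ℝ) 1 → Y}
    (hγ : Continuous γ) (y : Y) : ContinuousOn (closedCurve γ y) (Iio 1) := by
  rw [continuousOn_iff_continuous_domRestrict]
  have h1 : Continuous fun b : Iio (1 : unitInterval) =>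
      γ ⟨b.1, neg_one_lt_zero.trans_le b.1.2.1, b.2⟩ :=
    hγ.comp (Continuous.subtype_mk (by fun_prop) _)
  convert h1 using 1
  funext b
  exact closedCurve_of_lt γ y b.2

theorem continuous_closedCurve {Y : Type*} [TopologicalSpace Y] {γ : Ioo (-1 : ℝ) 1 → Y}
    (hγ : Continuous γ) {y : Y}
    (hy : ∀ W ∈ 𝓝 y, ∃ r : unitInterval, r < 1 ∧ ∀ t : Ioo (-1 : ℝ) 1, (r : ℝ) < t → γ t ∈ W) :
    Continuous (closedCurve γ y) := by
  rw [continuous_iff_continuousAt]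
  intro b
  rcases (unitInterval.le_one' (t := b)).lt_or_eq with hb | rfl
  · exact (continuousOn_closedCurve hγ y).continuousAt (isOpen_Iio.mem_nhds hb)
  · intro W hW
    rw [closedCurve_one] at hW
    obtain ⟨r, hr, hrW⟩ := hy W hW
    have hev : ∀ᶠ b in 𝓝 (1 : unitInterval), r < b := isOpen_Ioi.mem_nhds hr
    rw [mem_map]
    filter_upwards [hev] with b hb
    rcases (unitInterval.le_one' (t := b)).lt_or_eq with hb1 | rfl
    · rw [mem_preimage, closedCurve_of_lt γ y hb1]
      exact hrW _ hb
    · rw [mem_preimage, closedCurve_one]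
      exact mem_of_mem_nhds hW

variable {X : Type*} [TopologicalSpace X] [ChartedSpace (EuclideanHalfSpace 2) X] {Δ : Setoid X}

/-- A compact arc of nonspecial leaves is closed although the leaf space need not be Hausdorff;
hence new limit leaves occur only as the parameter tends to `1`. -/
theorem IsStrip.isClosed_image_Icc {e : ℝ × Ioo (-1 : ℝ) 1 → X} (he : IsStrip Δ e)
    (hreg : range (IsStrip.base Δ e) ⊆ regularLeaves Δ) {r : unitInterval} (hr : r < 1) :
    IsClosed (IsStrip.base Δ e '' {t | 0 ≤ t.1 ∧ t.1 ≤ r}) := by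
  refine isClosed_of_isCompact_not_special (IsCompact.image ?_ he.isOpenEmbedding_base.continuous)
    fun y hy => (hreg (image_subset_range _ _ hy)).1
  rw [Subtype.isCompact_iff]
  convert isCompact_Icc (a := (0 : ℝ)) (b := r) using 1
  ext t
  constructor
  · rintro ⟨t, ht, rfl⟩
    exact ht
  · intro ht
    exact ⟨⟨t, neg_one_lt_zero.trans_le ht.1, ht.2.trans_lt hr⟩, ht, rfl⟩

/-- The leaves of a component converge to every leaf in the closure of one half. -/
theorem IsClassF.eventually_of_mem_closure (hΔ : IsClassF Δ)
    (hfin : LocallyFinite (fun ω : specialLeaves Δ => (ω : Set X)))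
    {e : ℝ × Ioo (-1 : ℝ) 1 → X} (he : IsStrip Δ e)
    (hreg : range (IsStrip.base Δ e) ⊆ regularLeaves Δ)
    (habs : ∀ C ⊆ regularLeaves Δ, IsPreconnected (Quotient.mk Δ ⁻¹' C) →
      (C ∩ range (IsStrip.base Δ e)).Nonempty → C ⊆ range (IsStrip.base Δ e))
    {y : Quotient Δ} (hy : y ∈ closure (IsStrip.base Δ e '' {t | 0 ≤ t.1}))
    (hyn : y ∉ IsStrip.base Δ e '' {t | 0 ≤ t.1}) {W : Set (Quotient Δ)} (hW : W ∈ 𝓝 y) :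
    ∃ r : unitInterval, r < 1 ∧ ∀ t : Ioo (-1 : ℝ) 1, (r : ℝ) < t → IsStrip.base Δ e t ∈ W := by
  set γ := IsStrip.base Δ e
  set H := γ '' {t | 0 ≤ t.1}
  have hγ : IsOpenEmbedding γ := he.isOpenEmbedding_base
  obtain ⟨C₁, C₂, hC₁, hC₂, hW₁, hW₂, hN⟩ := hΔ.exists_sides hfin y hW
  have hside : ∀ C, IsPreconnected (Quotient.mk Δ ⁻¹' C) → C ⊆ W ∩ regularLeaves Δ →
      y ∈ closure (C ∩ H) →
      ∃ r : unitInterval, r < 1 ∧ ∀ t : Ioo (-1 : ℝ) 1, (r : ℝ) < t → γ t ∈ W := by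
    intro C hC hCW hyC
    -- The closed arc up to `r` misses `y`, so the leaves of the half that accumulate at `y` within
    -- `C` have parameters beyond `r`.
    have hlate : ∀ r : unitInterval, r < 1 → ∃ t : Ioo (-1 : ℝ) 1, (r : ℝ) < t ∧ γ t ∈ C := by
      intro r hr
      have hO := (he.isClosed_image_Icc hreg hr).isOpen_compl.mem_nhds
        (fun h => hyn (image_mono (fun t ht => ht.1) h) : y ∈ _)
      obtain ⟨_, hz, hzC, t, ht, rfl⟩ := mem_closure_iff_nhds.1 hyC _ hO
      refine ⟨t, ?_, hzC⟩
      by_contra hle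
      exact hz ⟨t, ⟨ht, not_lt.1 hle⟩, rfl⟩
    obtain ⟨t₀, ht₀, ht₀C⟩ := hlate 0 zero_lt_one
    -- The component absorbs the connected side `C`, so `C` corresponds to an interval of
    -- parameters; it contains parameters arbitrarily close to `1`, hence everything after `t₀`.
    have hCZ : C ⊆ range γ := habs C (fun z hz => (hCW hz).2) hC ⟨_, ht₀C, t₀, rfl⟩
    have hCc : IsPreconnected C := by
      rw [← image_preimage_eq C (Quotient.mk_surjective (s := Δ))]
      exact hC.image _ continuous_quotient_mk'.continuousOn
    have hD : (Subtype.val '' (γ ⁻¹' C)).OrdConnected :=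
      ((hCc.preimage_of_isOpenMap hγ.injective hγ.isOpenMap hCZ).image _
        continuous_subtype_val.continuousOn).ordConnected
    have ht₀' : (0 : ℝ) ≤ t₀ := le_of_lt ht₀
    refine ⟨⟨t₀, ht₀', t₀.2.2.le⟩, Subtype.mk_lt_mk.2 t₀.2.2, fun t ht => ?_⟩
    have ht' : (t₀ : ℝ) < t := ht
    obtain ⟨s, hs, hsC⟩ := hlate ⟨t, (ht₀'.trans_lt ht').le, t.2.2.le⟩ (Subtype.mk_lt_mk.2 t.2.2)
    obtain ⟨t', ht'C, htt⟩ := hD.out ⟨t₀, ht₀C, rfl⟩ ⟨s, hsC, rfl⟩ ⟨ht'.le, le_of_lt hs⟩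
    rw [Subtype.ext htt] at ht'C
    exact (hCW ht'C).1
  have h1 : y ∈ closure (C₁ ∩ H ∪ C₂ ∩ H) := by
    rw [mem_closure_iff_nhds] at hy ⊢
    intro U hU
    obtain ⟨z, ⟨hzU, hzN⟩, hzH⟩ := hy _ (inter_mem hU hN)
    rcases hzN with hz | hz | hz
    · exact absurd (hz ▸ hzH) hyn
    · exact ⟨z, hzU, Or.inl ⟨hz, hzH⟩⟩
    · exact ⟨z, hzU, Or.inr ⟨hz, hzH⟩⟩
  rw [closure_union] at h1
  rcases h1 with h1 | h1
  · exact hside C₁ hC₁ hW₁ h1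
  · exact hside C₂ hC₂ hW₂ h1

/-- The closure of one half of a component is a model strip. -/
theorem IsClassF.exists_modelStrip_closure [T2Space X] [SecondCountableTopology X]
    (hΔ : IsClassF Δ) (hfin : LocallyFinite (fun ω : specialLeaves Δ => (ω : Set X)))
    {e : ℝ × Ioo (-1 : ℝ) 1 → X} (he : IsStrip Δ e)
    (hreg : range (IsStrip.base Δ e) ⊆ regularLeaves Δ)
    (habs : ∀ C ⊆ regularLeaves Δ, IsPreconnected (Quotient.mk Δ ⁻¹' C) →
      (C ∩ range (IsStrip.base Δ e)).Nonempty → C ⊆ range (IsStrip.base Δ e)) :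
    ∃ S : Set (ℝ × ℝ), IsModelStrip S ∧
      FoliatedHomeomorphic (canonicalFoliation S) Δ (closure (e '' {q | 0 ≤ q.2.1})) := by
  classical
  set γ := IsStrip.base Δ e with hγ_def
  have hγ : IsOpenEmbedding γ := he.isOpenEmbedding_base
  set H : Set (Quotient Δ) := γ '' {t | 0 ≤ t.1} with hH
  set P : Set (Quotient Δ) := closure H with hP
  have hlim := fun {y} => hΔ.eventually_of_mem_closure hfin he hreg habs (y := y)
  have hclosed := fun {r : unitInterval} (hr : r < 1) => he.isClosed_image_Icc hreg hr
  -- Openness of the quotient map lets closure commute with preimage, so the closure in `X` is a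
  -- union of leaves.
  have hcl : closure (e '' {q | 0 ≤ q.2.1}) = Quotient.mk Δ ⁻¹' P := by
    rw [hP, hΔ.locallyStrip.isOpenMap.preimage_closure_eq_closure_preimage
      continuous_quotient_mk', hH, he.preimage_image_base]
    congr 2
    ext q
    simp
  rw [hcl]
  have hPγ : ∀ t, γ t ∈ P → 0 ≤ t.1 := by
    intro t ht
    by_contra hneg
    have hO : IsOpen (γ '' {t | t.1 < 0}) :=
      hγ.isOpenMap _ (isOpen_Iio.preimage continuous_subtype_val)
    obtain ⟨_, ⟨s, hs, rfl⟩, s', hs', hss⟩ :=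
      mem_closure_iff_nhds.1 ht _ (hO.mem_nhds ⟨t, not_le.1 hneg, rfl⟩)
    rw [hγ.injective hss] at hs'
    exact (show s.1 < 0 from hs).not_ge hs'
  -- the level function
  set lev : Quotient Δ → unitInterval := fun y =>
    if h : ∃ t, 0 ≤ t.1 ∧ γ t = y then ⟨h.choose.1, h.choose_spec.1, h.choose.2.2.le⟩ else 1
    with hlev
  have hlevγ : ∀ (t : Ioo (-1 : ℝ) 1) (ht : 0 ≤ t.1), lev (γ t) = ⟨t.1, ht, t.2.2.le⟩ := by
    intro t ht
    have h : ∃ s, 0 ≤ s.1 ∧ γ s = γ t := ⟨t, ht, rfl⟩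
    simp only [hlev, dif_pos h]
    have h1 : h.choose = t := hγ.injective h.choose_spec.2
    simp only [h1]
  have hlev1 : ∀ y ∉ H, lev y = 1 := fun y hy => dif_neg hy
  have hlevσ : ∀ y b, b < 1 → lev (closedCurve γ y b) = b := fun y b hb => by
    rw [closedCurve_of_lt γ y hb, hlevγ _ b.2.1]
  have hlevσ1 : ∀ y ∉ H, ∀ b, lev (closedCurve γ y b) = b := fun y hy b => by
    rcases (unitInterval.le_one' (t := b)).lt_or_eq with hb | rfl
    · exact hlevσ y b hb
    · rw [closedCurve_one, hlev1 y hy]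
  have hHlt : ∀ z ∈ H, lev z < 1 := by
    rintro _ ⟨t, ht, rfl⟩
    rw [hlevγ t ht]
    exact Subtype.mk_lt_mk.2 t.2.2
  have hσlev : ∀ y z, lev z < 1 → closedCurve γ y (lev z) = z := by
    intro y z hz
    by_cases hzH : z ∈ H
    · obtain ⟨t, ht, rfl⟩ := hzH
      rw [closedCurve_of_lt γ y hz]
      congr 1
      exact Subtype.ext (congrArg (fun b : unitInterval => (b : ℝ)) (hlevγ t ht))
    · rw [hlev1 z hzH] at hz
      exact absurd hz (lt_irrefl _)
  have hσH : ∀ y b, b < 1 → closedCurve γ y b ∈ H := fun y b hb => by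
    rw [closedCurve_of_lt γ y hb]
    exact ⟨_, b.2.1, rfl⟩
  have hle_iff : ∀ z (r : unitInterval), r < 1 →
      (lev z ≤ r ↔ z ∈ γ '' {t | 0 ≤ t.1 ∧ t.1 ≤ r}) := by
    intro z r hr
    constructor
    · intro hz
      rw [← hσlev z z (hz.trans_lt hr), closedCurve_of_lt γ z (hz.trans_lt hr)]
      exact ⟨_, ⟨(lev z).2.1, hz⟩, rfl⟩
    · rintro ⟨t, ⟨ht, htr⟩, rfl⟩
      rw [hlevγ t ht]
      exact htr
  set τ : Quotient.mk Δ ⁻¹' P → unitInterval := fun a => lev (Quotient.mk Δ (a : X)) with hτ_def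
  have hmkc : Continuous fun a : Quotient.mk Δ ⁻¹' P => Quotient.mk Δ (a : X) :=
    continuous_quotient_mk'.comp continuous_subtype_val
  have hτ : Continuous τ := by
    -- The levels above `r` form the complement of a closed arc, and the levels below `r` come from
    -- an open piece of the strip.
    rw [OrderTopology.continuous_iff]
    intro r
    constructor
    · rcases (unitInterval.le_one' (t := r)).lt_or_eq with hr | rfl
      · convert (hclosed hr).isOpen_compl.preimage hmkc using 1
        ext a
        rw [mem_preimage, mem_preimage, mem_compl_iff, ← hle_iff _ r hr, not_le]
        rfl
      · convert isOpen_empty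
        ext a
        simpa using unitInterval.le_one'
    · have hO : IsOpen (γ '' {t | t.1 < r}) :=
        hγ.isOpenMap _ (isOpen_Iio.preimage continuous_subtype_val)
      convert hO.preimage hmkc using 1
      ext a
      constructor
      · intro ha
        have ha : lev (Quotient.mk Δ (a : X)) < r := ha
        have ha1 := ha.trans_le unitInterval.le_one'
        rw [mem_preimage, ← hσlev (Quotient.mk Δ (a : X)) _ ha1, closedCurve_of_lt γ _ ha1]
        exact ⟨_, ha, rfl⟩
      · rintro ⟨t, ht, hta⟩
        have ht0 : 0 ≤ t.1 := hPγ t (hta ▸ a.2)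
        change lev (Quotient.mk Δ (a : X)) < r
        have hta : γ t = Quotient.mk Δ (a : X) := hta
        rw [← hta, hlevγ t ht0]
        exact ht
  -- the chart below the top level
  set t₀ : Ioo (-1 : ℝ) 1 := ⟨0, by norm_num, by norm_num⟩
  obtain ⟨E₀, hE₀s, hE₀t, hE₀τ⟩ := he.exists_chart (σ := closedCurve γ (γ t₀)) hτ isOpen_Iio
    ⟨0, mem_Iio.2 zero_lt_one⟩ (continuousOn_closedCurve hγ.continuous _)
    (fun b hb => image_subset_range _ _ (hσH _ b hb)) (fun b hb => subset_closure (hσH _ b hb))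
    (fun b hb x hx => by
      change lev (Quotient.mk Δ (x : X)) = b
      rw [hx, hlevσ _ b hb]) (by
      convert hγ.isOpen_range.preimage hmkc using 1
      ext a
      constructor
      · rintro ⟨b, hb, hba⟩
        rw [mem_preimage, ← hba]
        exact image_subset_range _ _ (hσH _ b hb)
      · rintro ⟨t, ht⟩
        have ht : γ t = Quotient.mk Δ (a : X) := ht
        have ht1 : lev (Quotient.mk Δ (a : X)) < 1 := by
          rw [← ht]
          exact hHlt _ ⟨t, hPγ t (ht ▸ a.2), rfl⟩
        exact ⟨_, ht1, hσlev _ _ ht1⟩)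
  -- the charts at the leaves of the top level
  have hchart : ∀ y : (P \ H : Set (Quotient Δ)),
      ∃ (c : unitInterval) (E : OpenPartialHomeomorph (Quotient.mk Δ ⁻¹' P) (ℝ × unitInterval)),
        c < 1 ∧ (E.source = {x : Quotient.mk Δ ⁻¹' P |
          Quotient.mk Δ (x : X) ∈ closedCurve γ y.1 '' Ioi c}) ∧ E.target = univ ×ˢ Ioi c ∧
        (∀ x, (E x).2 = τ x) ∧
        (∀ b ∈ Ioo c 1, StrictMono fun u => (E₀ (E.symm (u, b))).1) ∧
        ∃ N, IsOpen N ∧ y.1 ∈ N ∧ ∀ z ∈ N, z ∈ P → z ∉ H → z = y.1 := by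
    rintro ⟨y, hyP, hyH⟩
    obtain ⟨x, rfl⟩ := Quotient.exists_rep y
    set y := Quotient.mk Δ x
    obtain ⟨J, e', -, -, he', s₀, -, hs₀⟩ := hΔ.exists_strip x
    set α := IsStrip.base Δ e'
    have hα : IsOpenEmbedding α := he'.isOpenEmbedding_base
    have hyα : y ∈ range α := ⟨s₀, hs₀.symm⟩
    obtain ⟨c, hc1, hc⟩ := hlim hyP hyH (hα.isOpen_range.mem_nhds hyα)
    -- The curve of leaves converges to both `y` and `z`, but inside one strip distinct leaves have
    -- disjoint neighbourhoods. So a strip contains at most one limit leaf.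
    have hiso : ∀ z ∈ range α, z ∈ P → z ∉ H → z = y := by
      rintro _ ⟨s, rfl⟩ hzP hzH
      by_contra hne
      have hss : s ≠ s₀ := fun h => hne (h ▸ hs₀.symm)
      obtain ⟨U, U', hU, hU', hsU, hsU', hd⟩ := t2_separation hss
      obtain ⟨r, hr, hrU⟩ := hlim hzP hzH ((hα.isOpenMap _ hU).mem_nhds ⟨s, hsU, rfl⟩)
      obtain ⟨r', hr', hrU'⟩ := hlim hyP hyH
        ((hα.isOpenMap _ hU').mem_nhds ⟨s₀, hsU', hs₀.symm⟩)
      obtain ⟨q, hq, hq1⟩ := exists_between (max_lt hr hr')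
      set t : Ioo (-1 : ℝ) 1 := ⟨q, neg_one_lt_zero.trans_le q.2.1, hq1⟩
      obtain ⟨v, hv, hvt⟩ := hrU t ((le_max_left r r').trans_lt hq)
      obtain ⟨v', hv', hvt'⟩ := hrU' t ((le_max_right r r').trans_lt hq)
      have : v = v' := hα.injective (hvt.trans hvt'.symm)
      exact hd.le_bot ⟨hv, this ▸ hv'⟩
    have hσα : ∀ b ∈ Ioi c, closedCurve γ y b ∈ range α := by
      intro b hb
      rcases (unitInterval.le_one' (t := b)).lt_or_eq with hb1 | rfl
      · rw [closedCurve_of_lt γ y hb1]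
        exact hc _ hb
      · rwa [closedCurve_one]
    obtain ⟨E, hEs, hEt, hEτ⟩ := he'.exists_chart (σ := closedCurve γ y) hτ isOpen_Ioi
      ⟨1, hc1⟩ (continuous_closedCurve hγ.continuous fun W hW => hlim hyP hyH hW).continuousOn
      hσα (fun b hb => by
        rcases (unitInterval.le_one' (t := b)).lt_or_eq with hb1 | rfl
        · exact subset_closure (hσH _ b hb1)
        · rwa [closedCurve_one])
      (fun b hb x hx => by
        change lev (Quotient.mk Δ (x : X)) = b
        rw [hx, hlevσ1 _ hyH]) (by
        convert (hα.isOpen_range.inter (hclosed hc1).isOpen_compl).preimage hmkc using 1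
        ext a
        rw [mem_preimage, mem_inter_iff, mem_compl_iff, ← hle_iff _ c hc1, not_le]
        constructor
        · rintro ⟨b, hb, hba⟩
          rw [← hba, hlevσ1 _ hyH]
          exact ⟨hσα b hb, hb⟩
        · rintro ⟨haα, hac⟩
          refine ⟨_, hac, ?_⟩
          rcases (unitInterval.le_one' (t := lev (Quotient.mk Δ (a : X)))).lt_or_eq with h1 | h1
          · exact hσlev _ _ h1
          · rw [h1, closedCurve_one]
            exact (hiso _ haα a.2 fun haH => (hHlt _ haH).ne h1).symm)
    -- Below the top the new chart is compared with `E₀` over the connected set `(c, 1)`, so at most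
    -- one reflection is needed.
    obtain ⟨E', hE's, hE't, hE'τ, hE'm⟩ := exists_oriented_chart (E₀ := E₀) (K := Ioo c 1) hEt hEτ
      hE₀τ (isPreconnected_of_ordConnected_coe ordConnected_Icc ordConnected_Ioo)
      (fun b hb => hb.1) (fun u b hb => by
        have ht : (u, b) ∈ E.target := by
          rw [hEt]
          exact ⟨mem_univ _, hb.1⟩
        have hτb : τ (E.symm (u, b)) = b := by rw [← hEτ, E.right_inv ht]
        have hτb' : lev (Quotient.mk Δ (E.symm (u, b) : X)) = b := hτb
        rw [hE₀s]
        refine ⟨b, hb.2, ?_⟩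
        have := hσlev (γ t₀) (Quotient.mk Δ (E.symm (u, b) : X)) (by rw [hτb']; exact hb.2)
        rwa [hτb'] at this)
    exact ⟨c, E', hc1, hE's.trans hEs, hE't, hE'τ, hE'm, range α, hα.isOpen_range, hyα, hiso⟩
  choose c E hc1 hEs hEt hEτ hEm N hNo hyN hN using hchart
  have hcou : SecondCountableTopology (Quotient Δ) :=
    isQuotientMap_quotient_mk'.secondCountableTopology hΔ.locallyStrip.isOpenMap
  have hdisc : DiscreteTopology (P \ H : Set (Quotient Δ)) := by
    rw [discreteTopology_iff_isOpen_singleton]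
    intro y
    convert (hNo y).preimage continuous_subtype_val using 1
    ext z
    constructor
    · rintro rfl
      exact hyN z
    · intro hz
      exact Subtype.ext (hN y z.1 hz z.2.1 z.2.2)
  have hcount : Countable (P \ H : Set (Quotient Δ)) :=
    TopologicalSpace.separableSpace_iff_countable.1 inferInstance
  -- The heights `1 - b` and `max 0 (b - c y)` are positive exactly over the levels of the
  -- respective charts.
  have hatlas : IsStripAtlas τ (fun j : Option (P \ H : Set (Quotient Δ)) => j.elim E₀ E)
      (fun j b => j.elim (1 - (b : ℝ)) fun y => max 0 ((b : ℝ) - c y)) none :=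
    { continuous := hτ
      continuous_height := by
        rintro (_ | y)
        · exact continuous_const.sub continuous_subtype_val
        · exact continuous_const.max (continuous_subtype_val.sub continuous_const)
      height_nonneg := by
        rintro (_ | y) b
        · exact sub_nonneg.2 b.2.2
        · exact le_max_left _ _
      height_le_one := by
        rintro (_ | y) b
        · exact sub_le_self _ b.2.1
        · exact max_le zero_le_one (by
            have h1 := b.2.2
            have h2 := (c y).2.1
            linarith)
      target_eq := by
        rintro (_ | y)
        · refine hE₀t.trans ?_
          congr 1
          ext b
          exact (sub_pos (a := (1 : ℝ)) (b := b)).symm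
        · refine (hEt y).trans ?_
          congr 1
          ext b
          simp
      snd_apply := by
        rintro (_ | y) a -
        · exact hE₀τ a
        · exact hEτ y a
      mem_source := by
        rintro (_ | y) a ha hpos
        · simp only [Option.elim_none]
          rw [hE₀s]
          exact ⟨_, ha, hσlev _ _ ha⟩
        · simp only [Option.elim_some]
          rw [hEs y]
          refine ⟨_, ?_, hσlev _ _ ha⟩
          simpa using hpos
      height_pos_iff := fun b => sub_pos
      exists_mem_source := by
        intro a
        by_cases haH : Quotient.mk Δ (a : X) ∈ H
        · refine ⟨none, ?_⟩
          simp only [Option.elim_none]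
          rw [hE₀s]
          exact ⟨_, hHlt _ haH, hσlev _ _ (hHlt _ haH)⟩
        · refine ⟨some ⟨_, a.2, haH⟩, ?_⟩
          simp only [Option.elim_some]
          rw [hEs]
          exact ⟨1, hc1 _, closedCurve_one _ _⟩
      strictMono := by
        rintro (_ | y) b hb hpos
        · intro u v huv
          have ht : ∀ w, E₀ (E₀.symm (w, b)) = (w, b) := fun w => E₀.right_inv (by
            rw [hE₀t]
            exact ⟨mem_univ _, hb⟩)
          simpa [ht] using huv
        · exact hEm y b ⟨by simpa using hpos, hb⟩ }
  obtain ⟨Ψ, hΨ, hΨτ, hfull⟩ := hatlas.exists_isOpenEmbedding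
  refine exists_modelStrip_of_isOpenEmbedding hΔ.locallyStrip.isPreconnected_leaf hΨ hfull
    (fun a a' haa => ?_) (fun a a' ha haa => ?_) fun a ha => ?_
  · rw [hΨτ, hΨτ]
    exact congrArg lev haa
  · rw [hΨτ] at ha haa
    rw [hΨτ] at haa
    have h1 : lev (Quotient.mk Δ (a : X)) = lev (Quotient.mk Δ (a' : X)) := haa
    rw [← hσlev (γ t₀) _ ha, h1, hσlev (γ t₀) _ (h1 ▸ ha)]
  · have htop : ∀ a, (Ψ a).2 = 1 → Quotient.mk Δ (a : X) ∉ H := fun a ha haH => by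
      rw [hΨτ] at ha
      exact (hHlt _ haH).ne ha
    set y : (P \ H : Set (Quotient Δ)) := ⟨_, a.2, htop a ha⟩
    filter_upwards [((hNo y).preimage hmkc).mem_nhds (hyN y)] with a' ha' ha'1
    exact hN y _ ha' a'.2 (htop a' ha'1)

end HalfClosure

/-! ### Both halves, and the theorem -/

section Halves

/-- The reflection of the interval `(-1, 1)`. -/
def reflectIoo : Ioo (-1 : ℝ) 1 ≃ₜ Ioo (-1 : ℝ) 1 where
  toFun t := ⟨-t, neg_lt_neg t.2.2, by linarith [t.2.1]⟩
  invFun t := ⟨-t, neg_lt_neg t.2.2, by linarith [t.2.1]⟩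
  left_inv t := Subtype.ext (neg_neg _)
  right_inv t := Subtype.ext (neg_neg _)
  continuous_toFun := by fun_prop
  continuous_invFun := by fun_prop

variable {X : Type*} [TopologicalSpace X] [ChartedSpace (EuclideanHalfSpace 2) X] {Δ : Setoid X}

/-- The closures of both halves of a component are model strips. -/
theorem IsClassF.exists_modelStrip_closure_halves [T2Space X] [SecondCountableTopology X]
    (hΔ : IsClassF Δ) (hfin : LocallyFinite (fun ω : specialLeaves Δ => (ω : Set X)))
    {Z : Set (Quotient Δ)} (hZo : IsOpen Z) (hZ : Z ⊆ regularLeaves Δ)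
    (habs : ∀ C ⊆ regularLeaves Δ, IsPreconnected (Quotient.mk Δ ⁻¹' C) →
      (C ∩ Z).Nonempty → C ⊆ Z)
    {φ : openStrip ≃ₜ Quotient.mk Δ ⁻¹' Z} (hφ : IsFoliated (canonicalFoliation openStrip) Δ φ) :
    (∃ S : Set (ℝ × ℝ), IsModelStrip S ∧ FoliatedHomeomorphic (canonicalFoliation S) Δ
      (closure ((fun p : openStrip => (φ p : X)) '' {p | p.1.2 ≤ 0}))) ∧
    (∃ S : Set (ℝ × ℝ), IsModelStrip S ∧ FoliatedHomeomorphic (canonicalFoliation S) Δ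
      (closure ((fun p : openStrip => (φ p : X)) '' {p | 0 ≤ p.1.2}))) := by
  set η : openStrip ≃ₜ ℝ × Ioo (-1 : ℝ) 1 := stripHomeomorph _
  set e : ℝ × Ioo (-1 : ℝ) 1 → X := fun q => (φ (η.symm q) : X) with he_def
  have he : IsStrip Δ e := hφ.isStrip (hZo.preimage continuous_quotient_mk')
  have hrange : range (IsStrip.base Δ e) = Z := by
    have h1 : Quotient.mk Δ ⁻¹' range (IsStrip.base Δ e) = Quotient.mk Δ ⁻¹' Z := by
      rw [he.preimage_range_base]
      ext x
      constructor
      · rintro ⟨q, rfl⟩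
        exact Subtype.coe_prop _
      · intro hx
        exact ⟨η (φ.symm ⟨x, hx⟩), by simp [e]⟩
    exact Quotient.mk_surjective.preimage_injective h1
  -- Reversing the transversal turns the lower half into an upper one.
  have he' := he.comp reflectIoo.isOpenEmbedding
  have hrange' : range (IsStrip.base Δ fun q : ℝ × Ioo (-1 : ℝ) 1 => e (q.1, reflectIoo q.2)) =
      Z := by
    rw [← hrange]
    exact reflectIoo.surjective.range_comp (IsStrip.base Δ e)
  constructor
  · convert hΔ.exists_modelStrip_closure hfin he' (by rwa [hrange']) (by rwa [hrange']) using 5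
    ext x
    constructor
    · rintro ⟨p, hp, rfl⟩
      have hp : p.1.2 ≤ 0 := hp
      refine ⟨((η p).1, reflectIoo (η p).2), neg_nonneg.2 hp, ?_⟩
      simp only [he_def]
      rw [show reflectIoo (reflectIoo (η p).2) = (η p).2 from reflectIoo.symm_apply_apply _,
        Prod.mk.eta, η.symm_apply_apply]
    · rintro ⟨q, hq, rfl⟩
      exact ⟨_, show -(q.2 : ℝ) ≤ 0 from neg_nonpos.2 hq, rfl⟩
  · convert hΔ.exists_modelStrip_closure hfin he (by rwa [hrange]) (by rwa [hrange]) using 5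
    ext x
    constructor
    · rintro ⟨p, hp, rfl⟩
      exact ⟨η p, hp, congrArg (fun p => (φ p : X)) (η.symm_apply_apply p)⟩
    · rintro ⟨q, hq, rfl⟩
      exact ⟨_, hq, rfl⟩

end Halves

end StripFoliation

open StripFoliation in
theorem theorem1 {X : Type*} [TopologicalSpace X] [T2Space X] [SecondCountableTopology X]
    [ChartedSpace (EuclideanHalfSpace 2) X] [ConnectedSpace X]
    (Δ : Setoid X) (hΔ : IsClassF Δ)
    (hfin : LocallyFinite (fun ω : specialLeaves Δ => (ω : Set X)))
    (Q : Set X) (hQ : IsComponentOf (⋃₀ specialLeaves Δ ∪ (𝓡∂ 2).boundary X)ᶜ Q) :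
    ((FoliatedHomeomorphic cylinderFoliation Δ Q ∨
        FoliatedHomeomorphic mobiusFoliation Δ Q ∨
        FoliatedHomeomorphic (canonicalFoliation openStrip) Δ Q) ∧
      (FoliatedHomeomorphic cylinderFoliation Δ Q ∨
        FoliatedHomeomorphic mobiusFoliation Δ Q → Q = Set.univ)) ∧
    ∀ φ : openStrip ≃ₜ Q, IsFoliated (canonicalFoliation openStrip) Δ φ →
      (∃ S : Set (ℝ × ℝ), IsModelStrip S ∧
        FoliatedHomeomorphic (canonicalFoliation S) Δ
          (closure ((fun p : openStrip => (φ p : X)) '' {p | p.1.2 ≤ 0}))) ∧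
      (∃ S : Set (ℝ × ℝ), IsModelStrip S ∧
        FoliatedHomeomorphic (canonicalFoliation S) Δ
          (closure ((fun p : openStrip => (φ p : X)) '' {p | 0 ≤ p.1.2}))) := by
  obtain ⟨Z, rfl, hZo, hZc, hZ, habs⟩ := hΔ.exists_image_component hfin hQ
  refine ⟨⟨hΔ.foliatedHomeomorphic_component hZo hZc hZ, ?_⟩, fun φ hφ =>
    hΔ.exists_modelStrip_closure_halves hfin hZo hZ habs hφ⟩
  rintro (h | h)
  · exact eq_univ_of_glued hZo hZc.nonempty hZ h
  · exact eq_univ_of_glued hZo hZc.nonempty hZ h
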